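/- Let $p\ge 3$ be an integer, $\lambda=\lambda_p=2\cos(\pi/p)$, $S=\begin{pmatrix}1&\lambda\\0&1\end{pmatrix}$, $T=\begin{pmatrix}0&-1\\1&0\end{pmatrix}$, $U=ST$, and let $G_p=\langle S,T\rangle/\{\pm I\}$ be the Hecke group. For $k\in\mathbb Z^+$ and a matrix $M=\begin{pmatrix}a&b\\c&d\end{pmatrix}$ put $(f\mid M)(z)=(cz+d)^{-2k}f\!\left(\frac{az+b}{cz+d}\right)$. A rational period function (RPF) of weight $2k$ on $G_p$ is a rational function $q\in\mathbb C(z)$ with $q+q\mid T=0$ and $q+q\mid U+\dots+q\mid U^{p-1}=0$. A $\lambda_p$-BQF is a form $Q=[A,B,C]=Ax^2+Bxy+Cy^2$ with $A,B,C\in\mathbb Z[\lambda]$ and $D=B^2-4AC>0$, required to be primitive, $(A)+(B)+(C)=(1)$, if $\mathbb Z[\lambda]$ is a principal ideal domain. Two forms $Q_1,Q_2$ are $G_p$-equivalent if $Q_2(x,y)=Q_1(ax+by,cx+dy)$ for some $\begin{pmatrix}a&b\\c&d\end{pmatrix}\in G_p$. For an equivalence class $\mathcal A$ let $-\mathcal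 A=\{-Q: Q\in\mathcal A\}$. Let $x\in\mathbb R$ be a hyperbolic fixed point of $G_p$ and let $M=\begin{pmatrix}a&b\\c&d\end{pmatrix}$ generate the stabilizer of $x$ in $G_p$. The form associated with $x$ is $Q_x=\frac{\pm1}{g}[c,d-a,-b]$ if $x=\frac{a-d\pm\sqrt{(a+d)^2-4}}{2c}$, where $g>0$ is a fixed positive generator, depending only on the ideal, of $(c,d-a,-b)$ if $\mathbb Z[\lambda]$ is a principal ideal domain, and $g=1$ otherwise. If $Q_x=[A,B,C]$ then $x=\frac{-B+\sqrt D}{2A}$, and the Hecke conjugate of $x$ is $x'=\frac{-B-\sqrt D}{2A}$. A class is hyperbolic if it is the class of some $Q_x$. For a class $\mathcal A$ let $$Z_{\mathcal A}=\{x : Q_x\in\mathcal A,\ Q_x=[A,B,C]\text{ with }A>0>C\}.$$ For a hyperbolic fixed point $x$ let $q_{k,x}$ be the principal part at $z=x$ of $\dfrac{(x-x')^k}{(z-x)^k(z-x')^k}$, and let $q_{k,0}(z)=a_0(1-z^{-2k})$ if $2k\ne2$ and $q_{k,0}(z)=a_0(1-z^{-2})+b_1z^{-1}$ if $2k=2$,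 with constants $a_0,b_1\in\mathbb C$. **Corollary.** Let $q$ be an RPF of weight $2k$ on $G_p$, where $k\in\mathbb Z^+$. Then there are $L\ge0$, distinct hyperbolic $G_p$-equivalence classes $\mathcal A_1,\dots,\mathcal A_L$ of $\lambda_p$-BQFs such that all $Z_{\mathcal A_\ell}$ and $Z_{-\mathcal A_\ell}$ are finite and the set of positive poles of $q$ is $\bigcup_{\ell=1}^L Z_{\mathcal A_\ell}$, and complex constants $C_1,\dots,C_L$, $a_0$, $b_1$, $c_0,c_1,\dots,c_{2k-1}$ such that $$q(z)=\sum_{\ell=1}^{L}C_\ell\Bigl(\sum_{\alpha\in Z_{\mathcal A_\ell}}q_{k,\alpha}(z)-\sum_{\alpha\in Z_{-\mathcal A_\ell}}q_{k,\alpha'}(z)\Bigr)+c_0\,q_{k,0}(z)+\sum_{n=1}^{2k-1}\frac{c_n}{z^n}.$$ -/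

import Mathlib

noncomputable section

namespace HeckeRPF

/-! ### Hecke groups -/

/-- `λ_p = 2 cos (π / p)`. -/
def lam (p : ℕ) : ℝ := 2 * Real.cos (Real.pi / p)

/-- The ring `ℤ[λ_p]`, as a subring of the reals. -/
abbrev LamRing (p : ℕ) : Subalgebra ℤ ℝ := Algebra.adjoin ℤ {lam p}

/-- The matrix `S = (1, λ_p; 0, 1)`. -/
def matS (p : ℕ) : Matrix.SpecialLinearGroup (Fin 2) ℝ :=
  ⟨!![1, lam p; 0, 1], by simp [Matrix.det_fin_two]⟩

/-- The matrix `T = (0, -1; 1, 0)`. -/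
def matT : Matrix.SpecialLinearGroup (Fin 2) ℝ :=
  ⟨!![0, -1; 1, 0], by simp [Matrix.det_fin_two]⟩

/-- The matrix `U = S T`. -/
def matU (p : ℕ) : Matrix.SpecialLinearGroup (Fin 2) ℝ := matS p * matT

/-- The group of matrices generated by `S` and `T`. It contains `T ^ 2 = -I`, and the Hecke group
`G_p` is its quotient by `{I, -I}`; everything below is insensitive to the sign of a matrix. -/
def heckeGroup (p : ℕ) : Subgroup (Matrix.SpecialLinearGroup (Fin 2) ℝ) :=
  Subgroup.closure {matS p, matT}

/-- The real number `x` is fixed by the linear fractional transformation `M`, in the form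
`a x + b = x (c x + d)`. (Here `c x + d` cannot vanish: `a x + b` would vanish too, which is
impossible for an invertible matrix.) -/
def Fixes (M : Matrix.SpecialLinearGroup (Fin 2) ℝ) (x : ℝ) : Prop :=
  M 0 0 * x + M 0 1 = x * (M 1 0 * x + M 1 1)

/-- `M` is a hyperbolic element of the Hecke group that fixes `x` and generates, up to sign, the
group of all elements of the Hecke group that fix `x`. -/
structure IsStabilizerGenerator (p : ℕ) (M : Matrix.SpecialLinearGroup (Fin 2) ℝ) (x : ℝ) :
    Prop where
  mem : M ∈ heckeGroup p
  hyperbolic : 2 < |M 0 0 + M 1 1|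
  fixes : Fixes M x
  generates : ∀ N ∈ heckeGroup p, Fixes N x → ∃ n : ℤ, N = M ^ n ∨ N = -M ^ n

/-! ### Binary quadratic forms -/

/-- Indefinite binary quadratic forms `[A, B, C] = A x ^ 2 + B x y + C y ^ 2` over `ℤ[λ_p]`,
required to be primitive if `ℤ[λ_p]` is a principal ideal domain. -/
@[ext]
structure BQF (p : ℕ) where
  A : LamRing p
  B : LamRing p
  C : LamRing p
  disc_pos : 0 < (B : ℝ) ^ 2 - 4 * (A : ℝ) * (C : ℝ)
  primitive : IsPrincipalIdealRing (LamRing p) →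
    Ideal.span {A} ⊔ Ideal.span {B} ⊔ Ideal.span {C} = (⊤ : Ideal (LamRing p))

namespace BQF

variable {p : ℕ}

/-- The value `Q(x, y)`. -/
def val (Q : BQF p) (x y : ℝ) : ℝ := Q.A * x ^ 2 + Q.B * x * y + Q.C * y ^ 2

/-- The discriminant `D = B ^ 2 - 4 A C`. -/
def disc (Q : BQF p) : ℝ := (Q.B : ℝ) ^ 2 - 4 * (Q.A : ℝ) * (Q.C : ℝ)

/-- The other root `(-B - √D) / (2 A)` of the form. -/
def conjRoot (Q : BQF p) : ℝ := (-(Q.B : ℝ) - √Q.disc) / (2 * (Q.A : ℝ))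

/-- The form `-Q = [-A, -B, -C]`. -/
instance : Neg (BQF p) where
  neg Q :=
    { A := -Q.A
      B := -Q.B
      C := -Q.C
      disc_pos := by
        have h := Q.disc_pos
        push_cast
        linarith
      primitive := fun h => by
        have h' := Q.primitive h
        simpa only [Ideal.span_singleton_neg] using h' }

/-- `Q₂ = Q₁ ∘ V` for some `V` in the Hecke group, where
`(Q ∘ V)(x, y) = Q (a x + b y, c x + d y)`. -/
def Equivalent (Q₁ Q₂ : BQF p) : Prop :=
  ∃ V ∈ heckeGroup p, ∀ x y : ℝ,
    Q₂.val x y = Q₁.val (V 0 0 * x + V 0 1 * y) (V 1 0 * x + V 1 1 * y)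

/-- The equivalence class of a form. -/
def eqvClass (Q : BQF p) : Set (BQF p) := {Q' | Equivalent Q Q'}

end BQF

open Classical in
/-- The normalizing factor `g` of the ideal `I`: if `ℤ[λ_p]` is a principal ideal domain, a fixed
positive generator of `I` (for `I ≠ 0`), and `g = 1` otherwise. -/
def normFactor (p : ℕ) (I : Ideal (LamRing p)) : ℝ :=
  if h : IsPrincipalIdealRing (LamRing p) ∧ ∃ g : LamRing p, 0 < (g : ℝ) ∧ I = Ideal.span {g}
  then (Classical.choose h.2 : LamRing p)
  else 1

/-- `IsFormOf Q x`: the number `x` is a hyperbolic fixed point of the Hecke group, and `Q = Q_x` is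
the form associated with it. That is, if `M = (a, b; c, d)` generates the stabilizer of `x` and `g`
is the normalizing factor of the ideal `(c, d - a, -b)`, then `Q = (1 / g) [c, d - a, -b]` or
`Q = (-1 / g) [c, d - a, -b]` according as `x = (a - d + √((a + d) ^ 2 - 4)) / (2 c)` or
`x = (a - d - √((a + d) ^ 2 - 4)) / (2 c)`. -/
def IsFormOf {p : ℕ} (Q : BQF p) (x : ℝ) : Prop :=
  ∃ M : Matrix.SpecialLinearGroup (Fin 2) ℝ, IsStabilizerGenerator p M x ∧
    ∃ u v w : LamRing p, (u : ℝ) = M 1 0 ∧ (v : ℝ) = M 1 1 - M 0 0 ∧ (w : ℝ) = -M 0 1 ∧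
      let g : ℝ := normFactor p (Ideal.span {u} ⊔ Ideal.span {v} ⊔ Ideal.span {w})
      let s : ℝ := √((M 0 0 + M 1 1) ^ 2 - 4)
      (x = (M 0 0 - M 1 1 + s) / (2 * M 1 0) ∧
          (Q.A : ℝ) = 1 / g * u ∧ (Q.B : ℝ) = 1 / g * v ∧ (Q.C : ℝ) = 1 / g * w) ∨
        (x = (M 0 0 - M 1 1 - s) / (2 * M 1 0) ∧
          (Q.A : ℝ) = -1 / g * u ∧ (Q.B : ℝ) = -1 / g * v ∧ (Q.C : ℝ) = -1 / g * w)

/-- A form is hyperbolic if it is the form associated with some hyperbolic fixed point. -/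
def BQF.IsHyperbolic {p : ℕ} (Q : BQF p) : Prop := ∃ x : ℝ, IsFormOf Q x

/-- A set of forms is a hyperbolic equivalence class if it is the class of a hyperbolic form. -/
def IsHyperbolicClass {p : ℕ} (𝒜 : Set (BQF p)) : Prop :=
  ∃ Q : BQF p, Q.IsHyperbolic ∧ 𝒜 = Q.eqvClass

/-- `-𝒜`, the set of all `-Q` with `Q ∈ 𝒜`. -/
def negClass {p : ℕ} (𝒜 : Set (BQF p)) : Set (BQF p) := (fun Q => -Q) '' 𝒜

/-- A (hyperbolic) form `[A, B, C]` is simple if `A > 0 > C`. -/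
def BQF.IsSimple {p : ℕ} (Q : BQF p) : Prop := 0 < (Q.A : ℝ) ∧ (Q.C : ℝ) < 0

/-- `Z_𝒜`, the set of numbers `x` whose associated form `Q_x` is simple and lies in `𝒜`. -/
def simpleNumbers {p : ℕ} (𝒜 : Set (BQF p)) : Set ℝ :=
  {x | ∃ Q : BQF p, IsFormOf Q x ∧ Q ∈ 𝒜 ∧ Q.IsSimple}

open Classical in
/-- The Hecke conjugate `x' = (-B - √D) / (2 A)` of a hyperbolic fixed point `x` with associated
form `Q_x = [A, B, C]` (and `x` itself, a value of no interest, for any other real number). -/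
def heckeConj (p : ℕ) (x : ℝ) : ℝ :=
  if h : ∃ Q : BQF p, IsFormOf Q x then (Classical.choose h).conjRoot else x

/-! ### Rational functions, principal parts -/

/-- The weight `2k` slash operator `(f ∣ M)(z) = (c z + d) ^ (-2k) f ((a z + b) / (c z + d))` on
rational functions. -/
def slash (k : ℕ) (f : RatFunc ℂ) (M : Matrix.SpecialLinearGroup (Fin 2) ℝ) : RatFunc ℂ :=
  let num : RatFunc ℂ := RatFunc.C ((M 0 0 : ℝ) : ℂ) * RatFunc.X + RatFunc.C ((M 0 1 : ℝ) : ℂ)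
  let den : RatFunc ℂ := RatFunc.C ((M 1 0 : ℝ) : ℂ) * RatFunc.X + RatFunc.C ((M 1 1 : ℝ) : ℂ)
  (den ^ (2 * k))⁻¹ * RatFunc.eval RatFunc.C (num / den) f

/-- `q` is a rational period function of weight `2k` for the Hecke group `G_p`. -/
structure IsRPF (p k : ℕ) (q : RatFunc ℂ) : Prop where
  relT : q + slash k q matT = 0
  relU : q + ∑ n ∈ Finset.Ico 1 p, slash k q (matU p ^ n) = 0

/-- `z` is a pole of the rational function `f`. -/
def IsPole (f : RatFunc ℂ) (z : ℂ) : Prop := f.denom.eval z = 0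

/-- `r` is the principal part of `f` at `α`: a polynomial without constant term in
`1 / (z - α)`, such that `f - r` has no pole at `α`. -/
def IsPrincipalPart (α : ℂ) (f r : RatFunc ℂ) : Prop :=
  (∃ P : Polynomial ℂ, P.coeff 0 = 0 ∧
    r = Polynomial.aeval ((RatFunc.X - RatFunc.C α)⁻¹ : RatFunc ℂ) P) ∧ ¬ IsPole (f - r) α

theorem X_sub_C_ne_zero (α : ℂ) : (RatFunc.X - RatFunc.C α : RatFunc ℂ) ≠ 0 := by
  have h : (RatFunc.X - RatFunc.C α : RatFunc ℂ)
      = algebraMap (Polynomial ℂ) (RatFunc ℂ) (Polynomial.X - Polynomial.C α) := by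
    simp
  rw [h]
  exact RatFunc.algebraMap_ne_zero (Polynomial.X_sub_C_ne_zero α)

theorem expand_principal (α : ℂ) (m : ℕ) (n : Polynomial ℂ) :
    ∃ P s : Polynomial ℂ, P.coeff 0 = 0 ∧
      algebraMap (Polynomial ℂ) (RatFunc ℂ) n * ((RatFunc.X - RatFunc.C α)⁻¹) ^ m
        = Polynomial.aeval ((RatFunc.X - RatFunc.C α)⁻¹ : RatFunc ℂ) P
          + algebraMap (Polynomial ℂ) (RatFunc ℂ) s := by
  induction m generalizing n with
  | zero => exact ⟨0, n, by simp, by simp⟩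
  | succ m ih =>
    obtain ⟨n₁, hn₁⟩ : Polynomial.X - Polynomial.C α ∣ n - Polynomial.C (n.eval α) :=
      Polynomial.X_sub_C_dvd_sub_C_eval
    obtain ⟨P, s, hP, h⟩ := ih n₁
    refine ⟨P + Polynomial.C (n.eval α) * Polynomial.X ^ (m + 1), s, by simp [hP], ?_⟩
    have hw := X_sub_C_ne_zero α
    have hn : n = Polynomial.C (n.eval α) + (Polynomial.X - Polynomial.C α) * n₁ := by
      rw [← hn₁]; ring
    have hn' : algebraMap (Polynomial ℂ) (RatFunc ℂ) n = RatFunc.C (n.eval α)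
        + (RatFunc.X - RatFunc.C α) * algebraMap (Polynomial ℂ) (RatFunc ℂ) n₁ := by
      conv_lhs => rw [hn]
      simp
    have hC : algebraMap ℂ (RatFunc ℂ) (n.eval α) = RatFunc.C (n.eval α) := rfl
    rw [hn', map_add, map_mul, map_pow, Polynomial.aeval_X, Polynomial.aeval_C, hC,
      add_right_comm, ← h, pow_succ]
    field_simp
    ring

theorem exists_isPrincipalPart (α : ℂ) (f : RatFunc ℂ) : ∃ r, IsPrincipalPart α f r := by
  obtain ⟨e, he, hne⟩ := Polynomial.exists_eq_pow_rootMultiplicity_mul_and_not_dvd f.denom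
    (RatFunc.denom_ne_zero f) α
  set m := f.denom.rootMultiplicity α
  have hcop : IsCoprime ((Polynomial.X - Polynomial.C α) ^ m) e :=
    ((Polynomial.irreducible_X_sub_C α).coprime_iff_not_dvd.2 hne).pow_left
  obtain ⟨u, v, huv⟩ := hcop
  obtain ⟨P, s, hP, h⟩ := expand_principal α m (f.num * v)
  have he0 : e ≠ 0 := fun h0 => hne (h0 ▸ dvd_zero _)
  have hee : algebraMap (Polynomial ℂ) (RatFunc ℂ) e ≠ 0 := RatFunc.algebraMap_ne_zero he0
  have hw := X_sub_C_ne_zero α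
  refine ⟨_, ⟨P, hP, rfl⟩, ?_⟩
  have hf : f = algebraMap (Polynomial ℂ) (RatFunc ℂ) f.num
      / ((RatFunc.X - RatFunc.C α) ^ m * algebraMap (Polynomial ℂ) (RatFunc ℂ) e) := by
    conv_lhs => rw [← RatFunc.num_div_denom f, he]
    simp
  have huv' : algebraMap (Polynomial ℂ) (RatFunc ℂ) u * (RatFunc.X - RatFunc.C α) ^ m
      + algebraMap (Polynomial ℂ) (RatFunc ℂ) v * algebraMap (Polynomial ℂ) (RatFunc ℂ) e = 1 := by
    have := congrArg (algebraMap (Polynomial ℂ) (RatFunc ℂ)) huv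
    simpa using this
  have key : f - Polynomial.aeval ((RatFunc.X - RatFunc.C α)⁻¹ : RatFunc ℂ) P
      = algebraMap (Polynomial ℂ) (RatFunc ℂ) (s * e + f.num * u)
        / algebraMap (Polynomial ℂ) (RatFunc ℂ) e := by
    have h1 : Polynomial.aeval ((RatFunc.X - RatFunc.C α)⁻¹ : RatFunc ℂ) P
        = algebraMap (Polynomial ℂ) (RatFunc ℂ) (f.num * v) * ((RatFunc.X - RatFunc.C α)⁻¹) ^ m
          - algebraMap (Polynomial ℂ) (RatFunc ℂ) s := by
      rw [h]; ring
    rw [h1]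
    generalize f.num = n at hf ⊢
    rw [hf, map_add, map_mul, map_mul, map_mul]
    have hwm : (RatFunc.X - RatFunc.C α : RatFunc ℂ) ^ m ≠ 0 := pow_ne_zero _ hw
    rw [inv_pow]
    field_simp
    linear_combination (-algebraMap (Polynomial ℂ) (RatFunc ℂ) n) * huv'
  intro hpole
  rw [key] at hpole
  apply hne
  rw [Polynomial.dvd_iff_isRoot]
  exact Polynomial.eval_eq_zero_of_dvd_of_eval_eq_zero (RatFunc.denom_div_dvd _ _) hpole

/-- The principal part `PP_α[f]` of the rational function `f` at `α`. -/
def principalPart (α : ℂ) (f : RatFunc ℂ) : RatFunc ℂ :=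
  Classical.choose (exists_isPrincipalPart α f)

theorem principalPart_spec (α : ℂ) (f : RatFunc ℂ) : IsPrincipalPart α f (principalPart α f) :=
  Classical.choose_spec (exists_isPrincipalPart α f)

theorem IsPrincipalPart.unique {α : ℂ} {f r₁ r₂ : RatFunc ℂ} (h₁ : IsPrincipalPart α f r₁)
    (h₂ : IsPrincipalPart α f r₂) : r₁ = r₂ := by
  obtain ⟨⟨P₁, hP₁, rfl⟩, h₁⟩ := h₁
  obtain ⟨⟨P₂, hP₂, rfl⟩, h₂⟩ := h₂
  set w : RatFunc ℂ := (RatFunc.X - RatFunc.C α)⁻¹ with hwdef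
  have hw := X_sub_C_ne_zero α
  set P := P₁ - P₂ with hPdef
  have hP0 : P.coeff 0 = 0 := by simp [hPdef, hP₁, hP₂]
  have hsub : Polynomial.aeval w P
      = (f - Polynomial.aeval w P₂) - (f - Polynomial.aeval w P₁) := by
    simp [hPdef]
  set g₁ := f - Polynomial.aeval w P₁
  set g₂ := f - Polynomial.aeval w P₂
  suffices hPz : P = 0 by
    have : P₁ = P₂ := sub_eq_zero.1 hPz
    rw [this]
  by_contra hne
  have hdeg : P.natDegree ≠ 0 := by
    intro h
    apply hne
    rw [Polynomial.eq_C_of_natDegree_eq_zero h, hP0, map_zero]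
  let am := algebraMap (Polynomial ℂ) (RatFunc ℂ)
  have hrev : Polynomial.aeval w P * (RatFunc.X - RatFunc.C α) ^ P.natDegree
      = am (P.reverse.comp (Polynomial.X - Polynomial.C α)) := by
    let wi : Invertible w := ⟨RatFunc.X - RatFunc.C α, by simp [hwdef, hw], by simp [hwdef, hw]⟩
    have h2 := Polynomial.eval₂_reverse_mul_pow (algebraMap ℂ (RatFunc ℂ)) w P
    have hI : (⅟w : RatFunc ℂ) = RatFunc.X - RatFunc.C α := rfl
    rw [hI] at h2
    have h3 : am (P.reverse.comp (Polynomial.X - Polynomial.C α))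
        = Polynomial.eval₂ (algebraMap ℂ (RatFunc ℂ)) (RatFunc.X - RatFunc.C α) P.reverse := by
      rw [Polynomial.comp, Polynomial.hom_eval₂]
      congr 1
      simp [am]
    rw [h3, Polynomial.aeval_def, ← h2, mul_assoc, ← mul_pow]
    simp [hwdef, hw]
  have hd₁ : am g₁.denom ≠ 0 := RatFunc.algebraMap_ne_zero (RatFunc.denom_ne_zero _)
  have hd₂ : am g₂.denom ≠ 0 := RatFunc.algebraMap_ne_zero (RatFunc.denom_ne_zero _)
  have hg₁ : g₁ = am g₁.num / am g₁.denom := (RatFunc.num_div_denom g₁).symm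
  have hg₂ : g₂ = am g₂.num / am g₂.denom := (RatFunc.num_div_denom g₂).symm
  have hpoly : am (P.reverse.comp (Polynomial.X - Polynomial.C α) * (g₁.denom * g₂.denom))
      = am ((g₂.num * g₁.denom - g₁.num * g₂.denom)
          * (Polynomial.X - Polynomial.C α) ^ P.natDegree) := by
    have hX : am (Polynomial.X - Polynomial.C α) = RatFunc.X - RatFunc.C α := by simp [am]
    rw [map_mul, ← hrev, hsub, map_mul, map_mul, map_pow, hX, map_sub, map_mul, map_mul]
    have e₁ : am g₁.num = g₁ * am g₁.denom := by
      rw [eq_comm, ← eq_div_iff hd₁]; exact hg₁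
    have e₂ : am g₂.num = g₂ * am g₂.denom := by
      rw [eq_comm, ← eq_div_iff hd₂]; exact hg₂
    rw [e₁, e₂]
    ring
  have hpoly' := congrArg (Polynomial.eval α) (RatFunc.algebraMap_injective ℂ hpoly)
  simp only [Polynomial.eval_mul, Polynomial.eval_pow, Polynomial.eval_sub, Polynomial.eval_X,
    Polynomial.eval_C, sub_self, zero_pow hdeg, mul_zero, Polynomial.eval_comp,
    mul_eq_zero] at hpoly'
  rcases hpoly' with h | h | h
  · rw [← Polynomial.coeff_zero_eq_eval_zero, Polynomial.coeff_zero_reverse] at h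
    exact hne (Polynomial.leadingCoeff_eq_zero.1 h)
  · exact h₁ h
  · exact h₂ h

/-- `q_{k,x} = PP_x[(x - x') ^ k / ((z - x) ^ k (z - x') ^ k)]`, where `x'` is the Hecke conjugate
of `x`. -/
def qPart (p k : ℕ) (x : ℝ) : RatFunc ℂ :=
  let x' : ℝ := heckeConj p x
  principalPart (x : ℂ)
    (RatFunc.C (((x : ℂ) - (x' : ℂ)) ^ k) /
      ((RatFunc.X - RatFunc.C (x : ℂ)) ^ k * (RatFunc.X - RatFunc.C (x' : ℂ)) ^ k))

/-- `q_{k,0} = a₀ (1 - z ^ (-2k))` if `2k ≠ 2`, and `a₀ (1 - z ^ (-2)) + b₁ z ^ (-1)` if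
`2k = 2`. -/
def qZero (k : ℕ) (a₀ b₁ : ℂ) : RatFunc ℂ :=
  if 2 * k ≠ 2 then RatFunc.C a₀ * (1 - (RatFunc.X ^ (2 * k))⁻¹)
  else RatFunc.C a₀ * (1 - (RatFunc.X ^ 2)⁻¹) + RatFunc.C b₁ * RatFunc.X⁻¹

end HeckeRPF

end

/-!
The proof follows the poles of `q` under the group. Put `R_n = U ^ n T` for `0 < n < p`; up to
sign, these are matrices with nonnegative entries, and they map the positive half-line onto
disjoint intervals (`posR_disjoint`). The two relations of a rational period function combine to
`q = ∑ q ∣ R_n` (`IsRPF.eq_sum`).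

*Poles.* All poles are real, since a nonreal pole could be moved ever farther from the fixed point
of `U` (`IsRPF.im_eq_zero`). If `x > 0` is a pole, so is some `R_n x`; by disjointness the
resulting map `σ` of the finite set of positive poles is injective, so a permutation
(`IsRPF.exists_poleDynamics`). Each positive pole is thus periodic, that is, fixed by a product of
the `R_n`, a positive word, which is hyperbolic with a negative second fixed point.

*Classes.* Every element of the group is, up to sign, `w W⁻ʲ` or `T w W⁻ʲ` with a positive word
`w`, for any fixed nonempty positive word `W` (`hasForm_of_mem`). With the uniqueness of positive
expansions (`word_prefix`) this shows that the stabilizer of a positive pole is generated by a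
shortest word that fixes it (`isStabilizerGenerator_word`), and that `Z_𝒜`, for the class `𝒜` of a
pole `x`, is exactly the orbit of `x` under `σ` (`PoleDynamics.mem_simpleNumbers`). Hence the
positive poles are a finite union of sets `Z_𝒜`. The numbers of `Z_{-𝒜}` are the `-1 / x'` with
`x ∈ Z_𝒜`, with conjugates `-1 / x` (`mem_simpleNumbers_negClass`).

*Principal parts outside the origin.* Only one term of `q = ∑ q ∣ R_n` is singular at a given
positive pole, so `q` and `q ∣ W` have the same singular part at `x` when `W` is the periodic word
of `x`. Since `φ = ((x - x') / ((z - x) (z - x'))) ^ k` is invariant under `W`, and the multiplier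
of `W` at `x` is not a root of unity, the singular part of `q` at `x` is that of a multiple `c φ`
(`exists_coefficient`). The constant `c` is the same along the orbit
(`PoleDynamics.regularAt_iterate`), and `q ∣ T = -q` carries it to the negative poles
(`PoleDynamics.regularAt_neg_inv`).

*The origin.* The singular part of `q` at `0` is invariant under the parabolic element `T U`, which
bounds the order of the pole by `2k` (`PoleDynamics.regularAt_X_pow_mul`). What is left of `q`
after subtraction of its principal parts outside the origin is `z ^ (-2k)` times a polynomial of
degree at most `2k`, whose extreme coefficients are opposite because of `q ∣ T = -q`
(`eq_add_laurent`); this gives the term `q_{k,0}` and the powers of `1 / z`.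
-/

noncomputable section

namespace HeckeRPF

/-! ### Local values of rational functions -/

/-- The rational function `f` has no pole at `z`, and its value there is `v`. -/
def HasVal (f : RatFunc ℂ) (z v : ℂ) : Prop :=
  ∃ n d : Polynomial ℂ, d.eval z ≠ 0 ∧
    f = algebraMap (Polynomial ℂ) (RatFunc ℂ) n / algebraMap (Polynomial ℂ) (RatFunc ℂ) d ∧
    n.eval z / d.eval z = v

/-- The rational function `f` has no pole at `z`. -/
def RegularAt (f : RatFunc ℂ) (z : ℂ) : Prop := ∃ v, HasVal f z v

theorem algebraMap_ne_zero_of_eval {d : Polynomial ℂ} {z : ℂ} (h : d.eval z ≠ 0) :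
    algebraMap (Polynomial ℂ) (RatFunc ℂ) d ≠ 0 :=
  RatFunc.algebraMap_ne_zero fun h0 => h (by simp [h0])

theorem isPole_iff {f : RatFunc ℂ} {z : ℂ} : IsPole f z ↔ ¬ RegularAt f z := by
  constructor
  · rintro h ⟨v, n, d, hd, rfl, -⟩
    exact hd (Polynomial.eval_eq_zero_of_dvd_of_eval_eq_zero (RatFunc.denom_div_dvd n d) h)
  · intro h
    by_contra h'
    exact h ⟨_, f.num, f.denom, h', (RatFunc.num_div_denom f).symm, rfl⟩

theorem not_isPole_iff {f : RatFunc ℂ} {z : ℂ} : ¬ IsPole f z ↔ RegularAt f z := by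
  rw [isPole_iff, not_not]

theorem HasVal.regularAt {f : RatFunc ℂ} {z v : ℂ} (h : HasVal f z v) : RegularAt f z := ⟨v, h⟩

theorem hasVal_algebraMap (P : Polynomial ℂ) (z : ℂ) :
    HasVal (algebraMap (Polynomial ℂ) (RatFunc ℂ) P) z (P.eval z) :=
  ⟨P, 1, by simp, by simp, by simp⟩

theorem hasVal_C (c z : ℂ) : HasVal (RatFunc.C c) z c := by
  simpa using hasVal_algebraMap (Polynomial.C c) z

theorem hasVal_X (z : ℂ) : HasVal RatFunc.X z z := by
  simpa using hasVal_algebraMap Polynomial.X z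

theorem hasVal_zero (z : ℂ) : HasVal 0 z 0 := by
  simpa using hasVal_C 0 z

theorem hasVal_one (z : ℂ) : HasVal 1 z 1 := by
  simpa using hasVal_C 1 z

theorem HasVal.add {f g : RatFunc ℂ} {z v w : ℂ} (hf : HasVal f z v) (hg : HasVal g z w) :
    HasVal (f + g) z (v + w) := by
  obtain ⟨n, d, hd, rfl, rfl⟩ := hf
  obtain ⟨n', d', hd', rfl, rfl⟩ := hg
  have h := algebraMap_ne_zero_of_eval hd
  have h' := algebraMap_ne_zero_of_eval hd'
  refine ⟨n * d' + d * n', d * d', by simp [hd, hd'], ?_, ?_⟩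
  · rw [div_add_div _ _ h h']; simp
  · rw [div_add_div _ _ hd hd']; simp

theorem HasVal.mul {f g : RatFunc ℂ} {z v w : ℂ} (hf : HasVal f z v) (hg : HasVal g z w) :
    HasVal (f * g) z (v * w) := by
  obtain ⟨n, d, hd, rfl, rfl⟩ := hf
  obtain ⟨n', d', hd', rfl, rfl⟩ := hg
  refine ⟨n * n', d * d', by simp [hd, hd'], ?_, ?_⟩
  · rw [div_mul_div_comm]; simp
  · rw [div_mul_div_comm]; simp

theorem HasVal.inv {f : RatFunc ℂ} {z v : ℂ} (hf : HasVal f z v) (hv : v ≠ 0) :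
    HasVal f⁻¹ z v⁻¹ := by
  obtain ⟨n, d, hd, rfl, rfl⟩ := hf
  exact ⟨d, n, fun h => hv (by simp [h]), by rw [inv_div], by rw [inv_div]⟩

theorem HasVal.neg {f : RatFunc ℂ} {z v : ℂ} (hf : HasVal f z v) : HasVal (-f) z (-v) := by
  simpa using (hasVal_C (-1) z).mul hf

theorem HasVal.sub {f g : RatFunc ℂ} {z v w : ℂ} (hf : HasVal f z v) (hg : HasVal g z w) :
    HasVal (f - g) z (v - w) := by
  simpa [sub_eq_add_neg] using hf.add hg.neg

theorem HasVal.div {f g : RatFunc ℂ} {z v w : ℂ} (hf : HasVal f z v) (hg : HasVal g z w)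
    (hw : w ≠ 0) : HasVal (f / g) z (v / w) := by
  simpa [div_eq_mul_inv] using hf.mul (hg.inv hw)

theorem HasVal.pow {f : RatFunc ℂ} {z v : ℂ} (hf : HasVal f z v) (n : ℕ) :
    HasVal (f ^ n) z (v ^ n) := by
  induction n with
  | zero => simpa using hasVal_one z
  | succ n ih => simpa [pow_succ] using ih.mul hf

theorem HasVal.zpow {f : RatFunc ℂ} {z v : ℂ} (hf : HasVal f z v) (hv : v ≠ 0) (n : ℤ) :
    HasVal (f ^ n) z (v ^ n) := by
  cases n with
  | ofNat n => simpa using hf.pow n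
  | negSucc n => simpa [zpow_negSucc] using (hf.pow (n + 1)).inv (pow_ne_zero _ hv)

theorem HasVal.aeval {f : RatFunc ℂ} {z v : ℂ} (hf : HasVal f z v) (P : Polynomial ℂ) :
    HasVal (Polynomial.aeval f P) z (P.eval v) := by
  induction P using Polynomial.induction_on' with
  | add P Q hP hQ => simpa using hP.add hQ
  | monomial n a =>
    have h : algebraMap ℂ (RatFunc ℂ) a = RatFunc.C a := rfl
    simpa [Polynomial.aeval_monomial, h] using (hasVal_C a z).mul (hf.pow n)

theorem HasVal.unique {f : RatFunc ℂ} {z v w : ℂ} (hf : HasVal f z v) (hg : HasVal f z w) :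
    v = w := by
  have h := hf.sub hg
  rw [sub_self] at h
  obtain ⟨n, d, hd, h0, hv⟩ := h
  have hd' := algebraMap_ne_zero_of_eval hd
  have hn : algebraMap (Polynomial ℂ) (RatFunc ℂ) n = 0 := by
    rcases div_eq_zero_iff.1 h0.symm with h | h
    · exact h
    · exact absurd h hd'
  have : n = 0 := by
    by_contra hne
    exact RatFunc.algebraMap_ne_zero hne hn
  rw [this] at hv
  simp at hv
  exact (sub_eq_zero.1 hv.symm)

theorem HasVal.ne_zero {f : RatFunc ℂ} {z v : ℂ} (hf : HasVal f z v) (hv : v ≠ 0) : f ≠ 0 := by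
  rintro rfl
  exact hv (hf.unique (hasVal_zero z))

theorem RegularAt.add {f g : RatFunc ℂ} {z : ℂ} (hf : RegularAt f z) (hg : RegularAt g z) :
    RegularAt (f + g) z := (hf.choose_spec.add hg.choose_spec).regularAt

theorem RegularAt.neg {f : RatFunc ℂ} {z : ℂ} (hf : RegularAt f z) :
    RegularAt (-f) z := hf.choose_spec.neg.regularAt

theorem RegularAt.sub {f g : RatFunc ℂ} {z : ℂ} (hf : RegularAt f z) (hg : RegularAt g z) :
    RegularAt (f - g) z := (hf.choose_spec.sub hg.choose_spec).regularAt

theorem RegularAt.mul {f g : RatFunc ℂ} {z : ℂ} (hf : RegularAt f z) (hg : RegularAt g z) :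
    RegularAt (f * g) z := (hf.choose_spec.mul hg.choose_spec).regularAt

theorem RegularAt.pow {f : RatFunc ℂ} {z : ℂ} (hf : RegularAt f z) (n : ℕ) :
    RegularAt (f ^ n) z := (hf.choose_spec.pow n).regularAt

theorem regularAt_C (c z : ℂ) : RegularAt (RatFunc.C c) z := (hasVal_C c z).regularAt

theorem regularAt_sum {ι : Type*} (s : Finset ι) (f : ι → RatFunc ℂ) (z : ℂ)
    (h : ∀ i ∈ s, RegularAt (f i) z) : RegularAt (∑ i ∈ s, f i) z := by
  classical
  induction s using Finset.induction_on with
  | empty => simpa using (hasVal_zero z).regularAt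
  | insert a s ha ih =>
    rw [Finset.sum_insert ha]
    exact (h _ (by simp)).add (ih fun i hi => h i (by simp [hi]))

theorem hasVal_X_sub_C (z w : ℂ) : HasVal (RatFunc.X - RatFunc.C w) z (z - w) :=
  (hasVal_X z).sub (hasVal_C w z)

/-- A rational function without poles is a polynomial. -/
theorem exists_polynomial_of_regularAt {f : RatFunc ℂ} (h : ∀ z, RegularAt f z) :
    ∃ P : Polynomial ℂ, f = algebraMap (Polynomial ℂ) (RatFunc ℂ) P := by
  have hd : f.denom.natDegree = 0 := by
    by_contra hne
    obtain ⟨z, hz⟩ := IsAlgClosed.exists_root f.denom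
      (fun h0 => hne (Polynomial.natDegree_eq_of_degree_eq_some h0))
    exact isPole_iff.1 (show IsPole f z from hz) (h z)
  have h1 : f.denom = 1 := (RatFunc.monic_denom f).natDegree_eq_zero.1 hd
  refine ⟨f.num, ?_⟩
  conv_lhs => rw [← RatFunc.num_div_denom f, h1]
  simp

/-- The order of a nonzero rational function at a point. -/
theorem exists_order {f : RatFunc ℂ} (hf : f ≠ 0) (z : ℂ) :
    ∃ (m : ℤ) (g : RatFunc ℂ) (v : ℂ), v ≠ 0 ∧ HasVal g z v ∧
      f = (RatFunc.X - RatFunc.C z) ^ m * g := by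
  have key : ∀ P : Polynomial ℂ, P ≠ 0 → ∃ (m : ℕ) (g : RatFunc ℂ) (v : ℂ), v ≠ 0 ∧ HasVal g z v ∧
      algebraMap (Polynomial ℂ) (RatFunc ℂ) P = (RatFunc.X - RatFunc.C z) ^ m * g := by
    intro P hP
    obtain ⟨e, he, hne⟩ := Polynomial.exists_eq_pow_rootMultiplicity_mul_and_not_dvd P hP z
    refine ⟨P.rootMultiplicity z, algebraMap _ _ e, e.eval z, ?_, hasVal_algebraMap _ _, ?_⟩
    · intro h
      exact hne (Polynomial.dvd_iff_isRoot.2 h)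
    · conv_lhs => rw [he]
      simp
  obtain ⟨m, g, v, hv, hg, h⟩ := key f.num (RatFunc.num_ne_zero hf)
  obtain ⟨m', g', v', hv', hg', h'⟩ := key f.denom (RatFunc.denom_ne_zero f)
  refine ⟨m - m', g / g', v / v', div_ne_zero hv hv', hg.div hg' hv', ?_⟩
  have hX := X_sub_C_ne_zero z
  rw [← RatFunc.num_div_denom f, h, h', zpow_sub₀ hX, zpow_natCast, zpow_natCast,
    mul_div_mul_comm]

/-- If `(z - α) ^ m g` is regular at `α` and `g(α) ≠ 0`, then `m ≥ 0`. -/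
theorem order_nonneg {z : ℂ} {m : ℤ} {g : RatFunc ℂ} {v : ℂ} (hv : v ≠ 0) (hg : HasVal g z v)
    (h : RegularAt ((RatFunc.X - RatFunc.C z) ^ m * g) z) : 0 ≤ m := by
  by_contra hm
  obtain ⟨w, hw⟩ := h
  obtain ⟨n, rfl⟩ : ∃ n : ℕ, m = -(n + 1 : ℕ) := ⟨(-m - 1).toNat, by omega⟩
  have h1 := ((hasVal_X_sub_C z z).pow (n + 1)).mul hw
  have hX := pow_ne_zero (n + 1) (X_sub_C_ne_zero z)
  rw [zpow_neg, zpow_natCast, mul_inv_cancel_left₀ hX] at h1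
  have := hg.unique h1
  simp at this
  exact hv this

/-! ### The action of matrices on rational functions -/

/-- The numerator `a z + b` of a linear fractional transformation. -/
def mnum (M : Matrix.SpecialLinearGroup (Fin 2) ℝ) : RatFunc ℂ :=
  RatFunc.C ((M 0 0 : ℝ) : ℂ) * RatFunc.X + RatFunc.C ((M 0 1 : ℝ) : ℂ)

/-- The denominator `c z + d` of a linear fractional transformation. -/
def mden (M : Matrix.SpecialLinearGroup (Fin 2) ℝ) : RatFunc ℂ :=
  RatFunc.C ((M 1 0 : ℝ) : ℂ) * RatFunc.X + RatFunc.C ((M 1 1 : ℝ) : ℂ)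

theorem det_eq (M : Matrix.SpecialLinearGroup (Fin 2) ℝ) :
    M 0 0 * M 1 1 - M 0 1 * M 1 0 = 1 := by
  have := M.det_coe
  rwa [Matrix.det_fin_two] at this

theorem linear_eq_zero {a b : ℂ} (h : RatFunc.C a * RatFunc.X + RatFunc.C b = (0 : RatFunc ℂ)) :
    a = 0 ∧ b = 0 := by
  have h' : algebraMap (Polynomial ℂ) (RatFunc ℂ)
      (Polynomial.C a * Polynomial.X + Polynomial.C b) = algebraMap _ _ 0 := by
    simpa using h
  have h2 := RatFunc.algebraMap_injective ℂ h'
  constructor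
  · simpa using congrArg (fun P => Polynomial.coeff P 1) h2
  · simpa using congrArg (fun P => Polynomial.coeff P 0) h2

theorem mden_ne_zero (M : Matrix.SpecialLinearGroup (Fin 2) ℝ) : mden M ≠ 0 := by
  intro h
  obtain ⟨h1, h2⟩ := linear_eq_zero h
  have := det_eq M
  rw [Complex.ofReal_eq_zero] at h1 h2
  rw [h1, h2] at this
  simp at this

theorem moeb_transcendental (M : Matrix.SpecialLinearGroup (Fin 2) ℝ) :
    Transcendental ℂ (mnum M / mden M) := by
  apply RatFunc.transcendental_of_ne_C
  rintro ⟨c, hc⟩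
  rw [div_eq_iff (mden_ne_zero M)] at hc
  have h : RatFunc.C (((M 0 0 : ℝ) : ℂ) - c * (M 1 0 : ℝ)) * RatFunc.X
      + RatFunc.C (((M 0 1 : ℝ) : ℂ) - c * (M 1 1 : ℝ)) = (0 : RatFunc ℂ) := by
    simp only [map_sub, map_mul]
    unfold mnum mden at hc
    linear_combination hc
  obtain ⟨h1, h2⟩ := linear_eq_zero h
  have := congrArg (fun x : ℝ => (x : ℂ)) (det_eq M)
  simp only [Complex.ofReal_sub, Complex.ofReal_mul, Complex.ofReal_one] at this
  rw [sub_eq_zero.1 h1, sub_eq_zero.1 h2] at this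
  ring_nf at this
  simp at this

/-- The substitution `f ↦ f((a z + b) / (c z + d))` as a homomorphism of the field of rational
functions. -/
def moebHom (M : Matrix.SpecialLinearGroup (Fin 2) ℝ) : RatFunc ℂ →+* RatFunc ℂ :=
  RatFunc.liftRingHom (Polynomial.aeval (mnum M / mden M) : Polynomial ℂ →ₐ[ℂ] RatFunc ℂ).toRingHom
    (nonZeroDivisors_le_comap_nonZeroDivisors_of_injective _
      (transcendental_iff_injective.1 (moeb_transcendental M)))

theorem moebHom_algebraMap (M : Matrix.SpecialLinearGroup (Fin 2) ℝ) (P : Polynomial ℂ) :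
    moebHom M (algebraMap (Polynomial ℂ) (RatFunc ℂ) P) = Polynomial.aeval (mnum M / mden M) P := by
  unfold moebHom
  rw [RatFunc.liftRingHom_algebraMap]
  rfl

@[simp]
theorem moebHom_X (M : Matrix.SpecialLinearGroup (Fin 2) ℝ) :
    moebHom M RatFunc.X = mnum M / mden M := by
  rw [← RatFunc.algebraMap_X, moebHom_algebraMap, Polynomial.aeval_X]

@[simp]
theorem moebHom_C (M : Matrix.SpecialLinearGroup (Fin 2) ℝ) (c : ℂ) :
    moebHom M (RatFunc.C c) = RatFunc.C c := by
  rw [← RatFunc.algebraMap_C, moebHom_algebraMap, Polynomial.aeval_C]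
  rfl

theorem slash_eq (k : ℕ) (f : RatFunc ℂ) (M : Matrix.SpecialLinearGroup (Fin 2) ℝ) :
    slash k f M = (mden M ^ (2 * k))⁻¹ * moebHom M f := by
  change (mden M ^ (2 * k))⁻¹ * RatFunc.eval RatFunc.C (mnum M / mden M) f = _
  congr 1
  conv_rhs => rw [← RatFunc.num_div_denom f]
  rw [map_div₀, moebHom_algebraMap, moebHom_algebraMap]
  rfl

theorem ringHom_ext_ratFunc {φ ψ : RatFunc ℂ →+* RatFunc ℂ}
    (hC : ∀ c, φ (RatFunc.C c) = ψ (RatFunc.C c)) (hX : φ RatFunc.X = ψ RatFunc.X) : φ = ψ := by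
  have h : φ.comp (algebraMap (Polynomial ℂ) (RatFunc ℂ))
      = ψ.comp (algebraMap (Polynomial ℂ) (RatFunc ℂ)) := by
    apply Polynomial.ringHom_ext
    · intro c; simpa using hC c
    · simpa using hX
  ext f
  rw [← RatFunc.num_div_denom f, map_div₀, map_div₀]
  have h' := fun P => RingHom.congr_fun h P
  simp only [RingHom.comp_apply] at h'
  rw [h', h']

theorem mul_apply_two (M N : Matrix.SpecialLinearGroup (Fin 2) ℝ) (i j : Fin 2) :
    (M * N) i j = M i 0 * N 0 j + M i 1 * N 1 j := by
  rw [Matrix.SpecialLinearGroup.coe_mul, Matrix.mul_apply, Fin.sum_univ_two]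

theorem moebHom_mden (M N : Matrix.SpecialLinearGroup (Fin 2) ℝ) :
    moebHom N (mden M) = mden (M * N) / mden N := by
  have h := mden_ne_zero N
  rw [eq_div_iff h]
  conv_lhs => rw [mden]
  simp only [map_add, map_mul, moebHom_C, moebHom_X]
  rw [add_mul, mul_assoc, div_mul_cancel₀ _ h]
  simp only [mden, mnum, mul_apply_two, Complex.ofReal_add, Complex.ofReal_mul, map_add, map_mul]
  ring

theorem moebHom_mnum (M N : Matrix.SpecialLinearGroup (Fin 2) ℝ) :
    moebHom N (mnum M) = mnum (M * N) / mden N := by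
  have h := mden_ne_zero N
  rw [eq_div_iff h]
  conv_lhs => rw [mnum]
  simp only [map_add, map_mul, moebHom_C, moebHom_X]
  rw [add_mul, mul_assoc, div_mul_cancel₀ _ h]
  simp only [mden, mnum, mul_apply_two, Complex.ofReal_add, Complex.ofReal_mul, map_add, map_mul]
  ring

theorem moebHom_moebHom (M N : Matrix.SpecialLinearGroup (Fin 2) ℝ) (f : RatFunc ℂ) :
    moebHom N (moebHom M f) = moebHom (M * N) f := by
  have h : (moebHom N).comp (moebHom M) = moebHom (M * N) := by
    apply ringHom_ext_ratFunc
    · intro c; simp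
    · have h := mden_ne_zero N
      have h' := mden_ne_zero (M * N)
      simp only [RingHom.comp_apply, moebHom_X, map_div₀, moebHom_mden, moebHom_mnum]
      field_simp
  exact RingHom.congr_fun h f

theorem slash_slash (k : ℕ) (f : RatFunc ℂ) (M N : Matrix.SpecialLinearGroup (Fin 2) ℝ) :
    slash k (slash k f M) N = slash k f (M * N) := by
  rw [slash_eq, slash_eq, slash_eq, map_mul, map_inv₀, map_pow, moebHom_mden, moebHom_moebHom,
    ← mul_assoc]
  congr 1
  have h := mden_ne_zero N
  rw [← mul_inv, ← mul_pow, mul_div_cancel₀ _ h]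

theorem slash_add (k : ℕ) (f g : RatFunc ℂ) (M : Matrix.SpecialLinearGroup (Fin 2) ℝ) :
    slash k (f + g) M = slash k f M + slash k g M := by
  simp only [slash_eq, map_add, mul_add]

theorem slash_neg (k : ℕ) (f : RatFunc ℂ) (M : Matrix.SpecialLinearGroup (Fin 2) ℝ) :
    slash k (-f) M = -slash k f M := by
  simp only [slash_eq, map_neg, mul_neg]

theorem slash_sub (k : ℕ) (f g : RatFunc ℂ) (M : Matrix.SpecialLinearGroup (Fin 2) ℝ) :
    slash k (f - g) M = slash k f M - slash k g M := by
  simp only [slash_eq, map_sub, mul_sub]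

theorem slash_C_mul (k : ℕ) (c : ℂ) (f : RatFunc ℂ) (M : Matrix.SpecialLinearGroup (Fin 2) ℝ) :
    slash k (RatFunc.C c * f) M = RatFunc.C c * slash k f M := by
  simp only [slash_eq, map_mul, moebHom_C]
  ring

theorem mden_neg (M : Matrix.SpecialLinearGroup (Fin 2) ℝ) : mden (-M) = -mden M := by
  simp [mden]; ring

theorem mnum_neg (M : Matrix.SpecialLinearGroup (Fin 2) ℝ) : mnum (-M) = -mnum M := by
  simp [mnum]; ring

theorem moebHom_neg (M : Matrix.SpecialLinearGroup (Fin 2) ℝ) : moebHom (-M) = moebHom M :=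
  ringHom_ext_ratFunc (by simp) (by
    rw [moebHom_X, moebHom_X, mden_neg, mnum_neg]; exact neg_div_neg_eq _ _)

theorem slash_neg_matrix (k : ℕ) (f : RatFunc ℂ) (M : Matrix.SpecialLinearGroup (Fin 2) ℝ) :
    slash k f (-M) = slash k f M := by
  rw [slash_eq, slash_eq, mden_neg, moebHom_neg, (even_two_mul k).neg_pow]

theorem slash_one (k : ℕ) (f : RatFunc ℂ) : slash k f 1 = f := by
  have h1 : mden 1 = 1 := by simp [mden]
  have h2 : mnum 1 = RatFunc.X := by simp [mnum]
  have h : moebHom 1 = RingHom.id _ := ringHom_ext_ratFunc (by simp) (by simp [h1, h2])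
  rw [slash_eq, h, h1]
  simp

/-- The linear fractional transformation `V` maps the finite complex number `z` to the finite
complex number `w`. -/
def SendsC (V : Matrix.SpecialLinearGroup (Fin 2) ℝ) (z w : ℂ) : Prop :=
  (V 1 0 : ℂ) * z + V 1 1 ≠ 0 ∧ (V 0 0 : ℂ) * z + V 0 1 = w * (V 1 0 * z + V 1 1)

theorem hasVal_mden (V : Matrix.SpecialLinearGroup (Fin 2) ℝ) (z : ℂ) :
    HasVal (mden V) z ((V 1 0 : ℂ) * z + V 1 1) :=
  ((hasVal_C _ z).mul (hasVal_X z)).add (hasVal_C _ z)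

theorem hasVal_mnum (V : Matrix.SpecialLinearGroup (Fin 2) ℝ) (z : ℂ) :
    HasVal (mnum V) z ((V 0 0 : ℂ) * z + V 0 1) :=
  ((hasVal_C _ z).mul (hasVal_X z)).add (hasVal_C _ z)

theorem HasVal.moebHom {f : RatFunc ℂ} {z w v : ℂ} {V : Matrix.SpecialLinearGroup (Fin 2) ℝ}
    (hf : HasVal f w v) (hV : SendsC V z w) : HasVal (moebHom V f) z v := by
  obtain ⟨n, d, hd, rfl, rfl⟩ := hf
  have h1 : HasVal (mnum V / mden V) z w := by
    have := (hasVal_mnum V z).div (hasVal_mden V z) hV.1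
    rwa [hV.2, mul_div_cancel_right₀ _ hV.1] at this
  rw [map_div₀, moebHom_algebraMap, moebHom_algebraMap]
  exact (h1.aeval n).div (h1.aeval d) hd

theorem RegularAt.moebHom {f : RatFunc ℂ} {z w : ℂ} {V : Matrix.SpecialLinearGroup (Fin 2) ℝ}
    (hf : RegularAt f w) (hV : SendsC V z w) : RegularAt (moebHom V f) z :=
  (hf.choose_spec.moebHom hV).regularAt

theorem RegularAt.slash {k : ℕ} {f : RatFunc ℂ} {z w : ℂ}
    {V : Matrix.SpecialLinearGroup (Fin 2) ℝ}
    (hf : RegularAt f w) (hV : SendsC V z w) : RegularAt (slash k f V) z := by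
  rw [slash_eq]
  exact (((hasVal_mden V z).pow _).inv (pow_ne_zero _ hV.1)).regularAt.mul (hf.moebHom hV)

/-- `(V z - V a) (c z + d) (c a + d) = z - a`. -/
theorem moebHom_X_sub_C {V : Matrix.SpecialLinearGroup (Fin 2) ℝ} {a b : ℂ} (h : SendsC V a b) :
    moebHom V (RatFunc.X - RatFunc.C b)
      = (RatFunc.X - RatFunc.C a) * (mden V * RatFunc.C ((V 1 0 : ℂ) * a + V 1 1))⁻¹ := by
  have hV := mden_ne_zero V
  have hc : RatFunc.C ((V 1 0 : ℂ) * a + V 1 1) ≠ (0 : RatFunc ℂ) := by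
    rw [Ne, map_eq_zero]; exact h.1
  rw [eq_mul_inv_iff_mul_eq₀ (mul_ne_zero hV hc), map_sub, moebHom_X, moebHom_C, sub_mul,
    ← mul_assoc, div_mul_cancel₀ _ hV]
  have h2 := congrArg (RatFunc.C (K := ℂ)) h.2
  have hdet := congrArg (fun x : ℝ => RatFunc.C (x : ℂ)) (det_eq V)
  simp only [Complex.ofReal_sub, Complex.ofReal_mul, Complex.ofReal_one, map_sub, map_mul,
    map_one, map_add] at h2 hdet ⊢
  unfold mnum mden
  linear_combination (RatFunc.C ((V 1 0 : ℝ) : ℂ) * RatFunc.X + RatFunc.C ((V 1 1 : ℝ) : ℂ)) * h2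
    + (RatFunc.X - RatFunc.C a) * hdet

/-- The function `((a - b) / ((z - a) (z - b))) ^ k`. -/
def phi (k : ℕ) (a b : ℂ) : RatFunc ℂ :=
  RatFunc.C ((a - b) ^ k) / ((RatFunc.X - RatFunc.C a) ^ k * (RatFunc.X - RatFunc.C b) ^ k)

theorem phi_slash {k : ℕ} {V : Matrix.SpecialLinearGroup (Fin 2) ℝ} {a b a' b' : ℂ}
    (ha : SendsC V a a') (hb : SendsC V b b') : slash k (phi k a' b') V = phi k a b := by
  have e : a - b = (a' - b') * (((V 1 0 : ℂ) * a + V 1 1) * ((V 1 0 : ℂ) * b + V 1 1)) := by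
    have hdet := congrArg (fun x : ℝ => (x : ℂ)) (det_eq V)
    simp only [Complex.ofReal_sub, Complex.ofReal_mul, Complex.ofReal_one] at hdet
    linear_combination (-(a - b)) * hdet + ((V 1 0 : ℂ) * b + V 1 1) * ha.2
      - ((V 1 0 : ℂ) * a + V 1 1) * hb.2
  have e' : RatFunc.C ((a - b) ^ k) = RatFunc.C ((a' - b') ^ k)
      * (RatFunc.C ((V 1 0 : ℂ) * a + V 1 1) * RatFunc.C ((V 1 0 : ℂ) * b + V 1 1)) ^ k := by
    rw [e, mul_pow]
    simp only [map_mul, map_pow]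
  have hV := mden_ne_zero V
  have h1 : RatFunc.C ((V 1 0 : ℂ) * a + V 1 1) ≠ (0 : RatFunc ℂ) := by
    rw [Ne, map_eq_zero]; exact ha.1
  have h2 : RatFunc.C ((V 1 0 : ℂ) * b + V 1 1) ≠ (0 : RatFunc ℂ) := by
    rw [Ne, map_eq_zero]; exact hb.1
  have h3 := X_sub_C_ne_zero a
  have h4 := X_sub_C_ne_zero b
  rw [slash_eq, phi, phi, map_div₀, map_mul, map_pow (moebHom V), map_pow (moebHom V), moebHom_C,
    moebHom_X_sub_C ha, moebHom_X_sub_C hb, e']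
  generalize RatFunc.C ((V 1 0 : ℂ) * a + V 1 1) = A at *
  generalize RatFunc.C ((V 1 0 : ℂ) * b + V 1 1) = B at *
  generalize RatFunc.C ((a' - b') ^ k) = D at *
  generalize RatFunc.X - RatFunc.C a = x at *
  generalize RatFunc.X - RatFunc.C b = y at *
  generalize mden V = v at *
  have hxy : x * (v * A)⁻¹ * (y * (v * B)⁻¹) = x * y / (v ^ 2 * (A * B)) := by
    field_simp
  rw [← mul_pow, hxy, div_pow, mul_pow (v ^ 2), pow_mul, ← mul_pow x]
  have hv := pow_ne_zero k (pow_ne_zero 2 hV)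
  have hx := pow_ne_zero k (mul_ne_zero h3 h4)
  have hA := pow_ne_zero k (mul_ne_zero h1 h2)
  rw [div_div_eq_mul_div]
  generalize (v ^ 2) ^ k = u at *
  field_simp

/-! ### Linear fractional transformations of the real line -/

/-- The linear fractional transformation `V` maps the finite real number `x` to the finite real
number `y`. -/
def Sends (V : Matrix.SpecialLinearGroup (Fin 2) ℝ) (x y : ℝ) : Prop :=
  V 1 0 * x + V 1 1 ≠ 0 ∧ V 0 0 * x + V 0 1 = y * (V 1 0 * x + V 1 1)

section

variable {M N V : Matrix.SpecialLinearGroup (Fin 2) ℝ} {x y z : ℝ}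

theorem Sends.toC (h : Sends V x y) : SendsC V x y :=
  ⟨by exact_mod_cast h.1, by exact_mod_cast h.2⟩

theorem neg_apply_SL (M : Matrix.SpecialLinearGroup (Fin 2) ℝ) (i j : Fin 2) :
    (-M) i j = -(M i j) := rfl

theorem inv_apply_SL (M : Matrix.SpecialLinearGroup (Fin 2) ℝ) :
    M⁻¹ 0 0 = M 1 1 ∧ M⁻¹ 0 1 = -M 0 1 ∧ M⁻¹ 1 0 = -M 1 0 ∧ M⁻¹ 1 1 = M 0 0 := by
  rw [Matrix.SpecialLinearGroup.SL2_inv_expl]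
  simp

theorem Sends.neg (h : Sends V x y) : Sends (-V) x y := by
  obtain ⟨h1, h2⟩ := h
  simp only [Sends, neg_apply_SL]
  refine ⟨fun h => h1 (by linarith), by linarith⟩

theorem sends_neg_iff : Sends (-V) x y ↔ Sends V x y :=
  ⟨fun h => by simpa using h.neg, Sends.neg⟩

theorem Sends.comp (hM : Sends M y z) (hN : Sends N x y) : Sends (M * N) x z := by
  obtain ⟨h1, h2⟩ := hM
  obtain ⟨h3, h4⟩ := hN
  have e : (M * N) 1 0 * x + (M * N) 1 1 = (M 1 0 * y + M 1 1) * (N 1 0 * x + N 1 1) := by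
    simp only [mul_apply_two]
    linear_combination M 1 0 * h4
  refine ⟨by rw [e]; exact mul_ne_zero h1 h3, ?_⟩
  rw [e]
  simp only [mul_apply_two]
  linear_combination M 0 0 * h4 + (N 1 0 * x + N 1 1) * h2

theorem Sends.inv (h : Sends V x y) : Sends V⁻¹ y x := by
  obtain ⟨h1, h2⟩ := h
  obtain ⟨e1, e2, e3, e4⟩ := inv_apply_SL V
  have hd := det_eq V
  have key : (V⁻¹ 1 0 * y + V⁻¹ 1 1) * (V 1 0 * x + V 1 1) = 1 := by
    rw [e3, e4]
    linear_combination hd + V 1 0 * h2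
  have h0 : V⁻¹ 1 0 * y + V⁻¹ 1 1 ≠ 0 := left_ne_zero_of_mul_eq_one key
  refine ⟨h0, mul_right_cancel₀ h1 ?_⟩
  rw [mul_assoc, key, e1, e2]
  linear_combination x * hd - V 1 1 * h2

theorem sends_one : Sends 1 x x := by simp [Sends]

theorem Sends.unique (h : Sends V x y) (h' : Sends V x z) : y = z :=
  mul_right_cancel₀ h.1 (h.2.symm.trans h'.2)

theorem Sends.injective (h : Sends V x z) (h' : Sends V y z) : x = y := h.inv.unique h'.inv

theorem fixes_iff : Fixes M x ↔ Sends M x x := by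
  refine ⟨fun h => ⟨fun h0 => ?_, h⟩, fun h => h.2⟩
  have h1 : M 0 0 * x + M 0 1 = 0 := by rw [h, h0, mul_zero]
  have hd := det_eq M
  have : (1 : ℝ) = 0 := by linear_combination M 0 0 * h0 - M 1 0 * h1 - hd
  exact one_ne_zero this

theorem Sends.pow (h : Sends M x x) (n : ℕ) : Sends (M ^ n) x x := by
  induction n with
  | zero => simpa using sends_one
  | succ n ih => rw [pow_succ]; exact ih.comp h

/-- A matrix that commutes with `M` fixes the fixed points of `M`. -/
theorem fixes_of_commute (hM : M 1 0 ≠ 0) (h : Commute M N) (hx : Fixes M x) : Fixes N x := by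
  have e := h.eq
  have e00 : (M * N) 0 0 = (N * M) 0 0 := by rw [e]
  have e10 : (M * N) 1 0 = (N * M) 1 0 := by rw [e]
  simp only [mul_apply_two] at e00 e10
  unfold Fixes at *
  apply mul_left_cancel₀ hM
  linear_combination N 1 0 * hx - e00 + x * e10

theorem commute_of_eq_pow {n : ℤ} (h : N = M ^ n ∨ N = -M ^ n) : Commute M N := by
  have h1 : Commute M (M ^ n) := (Commute.refl M).zpow_right n
  rcases h with rfl | rfl
  · exact h1
  · exact h1.neg_right

end

theorem matT_apply : matT 0 0 = 0 ∧ matT 0 1 = -1 ∧ matT 1 0 = 1 ∧ matT 1 1 = 0 := by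
  simp [matT]

theorem matT_mul_matT : matT * matT = -1 := by
  obtain ⟨h1, h2, h3, h4⟩ := matT_apply
  ext i j
  rw [mul_apply_two, neg_apply_SL]
  fin_cases i <;> fin_cases j <;> simp [h1, h2, h3, h4]

theorem matT_inv : matT⁻¹ = -matT := by
  rw [inv_eq_iff_mul_eq_one, mul_neg, matT_mul_matT, neg_neg]

theorem sends_matT {x : ℝ} (hx : x ≠ 0) : Sends matT x (-1 / x) := by
  obtain ⟨h1, h2, h3, h4⟩ := matT_apply
  simp only [Sends, h1, h2, h3, h4]
  exact ⟨by simpa using hx, by field_simp; ring⟩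

theorem sends_matT_iff {x y : ℝ} : Sends matT x y ↔ x * y = -1 := by
  obtain ⟨h1, h2, h3, h4⟩ := matT_apply
  simp only [Sends, h1, h2, h3, h4]
  constructor
  · rintro ⟨-, h⟩; linarith
  · intro h
    refine ⟨?_, by linarith⟩
    rintro h0
    have : x = 0 := by linarith
    simp [this] at h

theorem matU_apply (p : ℕ) :
    matU p 0 0 = lam p ∧ matU p 0 1 = -1 ∧ matU p 1 0 = 1 ∧ matU p 1 1 = 0 := by
  simp only [matU, mul_apply_two]
  simp [matS, matT]

/-! ### Positive words in the Hecke group -/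

/-- The ratio `sin (n π / p) / sin (π / p)`, a Chebyshev polynomial in `λ_p`; up to sign, these are
the entries of the powers of `U`. -/
def sinRatio (p n : ℕ) : ℝ := Real.sin (n * (Real.pi / p)) / Real.sin (Real.pi / p)

section Hecke

variable {p : ℕ}

theorem sin_pos_of_three_le (hp : 3 ≤ p) : 0 < Real.sin (Real.pi / p) := by
  have hp' : (3 : ℝ) ≤ p := by exact_mod_cast hp
  apply Real.sin_pos_of_pos_of_lt_pi
  · have := Real.pi_pos; positivity
  · rw [div_lt_iff₀ (by linarith)]
    nlinarith [Real.pi_pos]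

theorem one_le_lam (hp : 3 ≤ p) : 1 ≤ lam p := by
  have hp' : (3 : ℝ) ≤ p := by exact_mod_cast hp
  have h : Real.cos (Real.pi / 3) ≤ Real.cos (Real.pi / p) := by
    apply Real.cos_le_cos_of_nonneg_of_le_pi
    · have := Real.pi_pos; positivity
    · linarith [Real.pi_pos]
    · exact div_le_div_of_nonneg_left Real.pi_pos.le (by norm_num) hp'
  rw [Real.cos_pi_div_three] at h
  unfold lam
  linarith

theorem sinRatio_zero : sinRatio p 0 = 0 := by simp [sinRatio]

theorem sinRatio_one (hp : 3 ≤ p) : sinRatio p 1 = 1 := by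
  simp [sinRatio, (sin_pos_of_three_le hp).ne']

theorem sinRatio_add_two (n : ℕ) :
    sinRatio p (n + 2) = lam p * sinRatio p (n + 1) - sinRatio p n := by
  unfold sinRatio lam
  set t := Real.pi / p
  have h : Real.sin (((n + 2 : ℕ) : ℝ) * t)
      = 2 * Real.cos t * Real.sin (((n + 1 : ℕ) : ℝ) * t) - Real.sin (n * t) := by
    have e1 : ((n + 2 : ℕ) : ℝ) * t = ((n + 1 : ℕ) : ℝ) * t + t := by push_cast; ring
    have e2 : (n : ℝ) * t = ((n + 1 : ℕ) : ℝ) * t - t := by push_cast; ring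
    rw [e1, e2, Real.sin_add, Real.sin_sub]
    ring
  rw [h]
  ring

theorem sinRatio_self (hp : 3 ≤ p) : sinRatio p p = 0 := by
  have : (p : ℝ) ≠ 0 := by positivity
  unfold sinRatio
  rw [mul_div_cancel₀ _ this, Real.sin_pi, zero_div]

theorem sinRatio_sub (hp : 3 ≤ p) {n : ℕ} (hn : n ≤ p) : sinRatio p (p - n) = sinRatio p n := by
  have : (p : ℝ) ≠ 0 := by positivity
  unfold sinRatio
  congr 1
  rw [Nat.cast_sub hn, sub_mul, mul_div_cancel₀ _ this, Real.sin_pi_sub]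

theorem one_le_sinRatio (hp : 3 ≤ p) {n : ℕ} (h1 : 1 ≤ n) (h2 : n < p) : 1 ≤ sinRatio p n := by
  have hs := sin_pos_of_three_le hp
  have hp0 : (0 : ℝ) < p := by positivity
  have hpi := Real.pi_pos
  have ht : 0 < Real.pi / p := by positivity
  have aux : ∀ m : ℕ, 1 ≤ m → 2 * m ≤ p → 1 ≤ sinRatio p m := by
    intro m hm1 hm2
    unfold sinRatio
    rw [le_div_iff₀ hs, one_mul]
    have hm1' : (1 : ℝ) ≤ m := by exact_mod_cast hm1
    have hm2' : (2 : ℝ) * m ≤ p := by exact_mod_cast hm2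
    apply Real.sin_le_sin_of_le_of_le_pi_div_two
    · linarith
    · rw [mul_div_assoc', div_le_div_iff₀ hp0 (by norm_num)]
      nlinarith
    · nlinarith
  by_cases h : 2 * n ≤ p
  · exact aux n h1 h
  · rw [← sinRatio_sub hp h2.le]
    exact aux (p - n) (by omega) (by omega)

theorem sinRatio_nonneg (hp : 3 ≤ p) {n : ℕ} (h2 : n ≤ p) : 0 ≤ sinRatio p n := by
  rcases Nat.eq_zero_or_pos n with rfl | h
  · rw [sinRatio_zero]
  · rcases h2.eq_or_lt with rfl | h'
    · rw [sinRatio_self hp]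
    · linarith [one_le_sinRatio hp h h']

theorem matU_pow_apply (hp : 3 ≤ p) (n : ℕ) :
    (matU p ^ (n + 1)) 0 0 = sinRatio p (n + 2) ∧ (matU p ^ (n + 1)) 0 1 = -sinRatio p (n + 1) ∧
      (matU p ^ (n + 1)) 1 0 = sinRatio p (n + 1) ∧ (matU p ^ (n + 1)) 1 1 = -sinRatio p n := by
  obtain ⟨h1, h2, h3, h4⟩ := matU_apply p
  induction n with
  | zero =>
    simp only [zero_add, pow_one]
    have := sinRatio_add_two (p := p) 0
    simp only [zero_add] at this
    rw [this, sinRatio_one hp, sinRatio_zero, h1, h2, h3, h4]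
    simp
  | succ n ih =>
    obtain ⟨i1, i2, i3, i4⟩ := ih
    rw [pow_succ]
    simp only [mul_apply_two, h1, h2, h3, h4, i1, i2, i3, i4]
    have e1 := sinRatio_add_two (p := p) n
    have e2 := sinRatio_add_two (p := p) (n + 1)
    refine ⟨?_, ?_, ?_, ?_⟩ <;> linarith

theorem matU_pow_p (hp : 3 ≤ p) : matU p ^ p = -1 := by
  obtain ⟨m, rfl⟩ : ∃ m, p = m + 1 := ⟨p - 1, by omega⟩
  obtain ⟨h1, h2, h3, h4⟩ := matU_pow_apply hp m
  have e0 := sinRatio_self hp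
  have e1 : sinRatio (m + 1) m = 1 := by
    have := sinRatio_sub hp (n := 1) (by omega)
    rwa [sinRatio_one hp] at this
  have e2 := sinRatio_add_two (p := m + 1) m
  rw [e0, e1] at e2
  ext i j
  fin_cases i <;> fin_cases j
  · change (matU (m + 1) ^ (m + 1)) 0 0 = -1; rw [h1, e2]; ring
  · change (matU (m + 1) ^ (m + 1)) 0 1 = -0; rw [h2, e0]
  · change (matU (m + 1) ^ (m + 1)) 1 0 = -0; rw [h3, e0]; simp
  · change (matU (m + 1) ^ (m + 1)) 1 1 = -1; rw [h4, e1]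

/-- The matrix `-U ^ n T`; the sign makes its entries nonnegative for `1 ≤ n < p`. -/
def posR (p n : ℕ) : Matrix.SpecialLinearGroup (Fin 2) ℝ := -(matU p ^ n * matT)

theorem posR_apply (hp : 3 ≤ p) (n : ℕ) :
    posR p (n + 1) 0 0 = sinRatio p (n + 1) ∧ posR p (n + 1) 0 1 = sinRatio p (n + 2) ∧
      posR p (n + 1) 1 0 = sinRatio p n ∧ posR p (n + 1) 1 1 = sinRatio p (n + 1) := by
  obtain ⟨h1, h2, h3, h4⟩ := matU_pow_apply hp n
  obtain ⟨t1, t2, t3, t4⟩ := matT_apply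
  simp only [posR, neg_apply_SL, mul_apply_two, h1, h2, h3, h4, t1, t2, t3, t4]
  refine ⟨?_, ?_, ?_, ?_⟩ <;> ring

theorem matU_pow_eq (n : ℕ) : matU p ^ n = posR p n * matT := by
  rw [posR, neg_mul, mul_assoc, matT_mul_matT]; simp

/-- Matrices with nonnegative entries whose diagonal entries are at least `1`. -/
structure NonnegMat (M : Matrix.SpecialLinearGroup (Fin 2) ℝ) : Prop where
  h00 : 1 ≤ M 0 0
  h11 : 1 ≤ M 1 1
  h01 : 0 ≤ M 0 1
  h10 : 0 ≤ M 1 0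

theorem nonnegMat_posR (hp : 3 ≤ p) {n : ℕ} (h1 : 1 ≤ n) (h2 : n < p) :
    NonnegMat (posR p n) ∧ 0 < posR p n 0 1 + posR p n 1 0 := by
  obtain ⟨m, rfl⟩ : ∃ m, n = m + 1 := ⟨n - 1, by omega⟩
  obtain ⟨e1, e2, e3, e4⟩ := posR_apply hp m
  have h := one_le_sinRatio hp h1 h2
  refine ⟨⟨by rw [e1]; exact h, by rw [e4]; exact h, ?_, ?_⟩, ?_⟩
  · rw [e2]; exact sinRatio_nonneg hp (by omega)
  · rw [e3]; exact sinRatio_nonneg hp (by omega)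
  · rw [e2, e3, sinRatio_add_two]
    nlinarith [one_le_lam hp]

/-- The second part keeps the off-diagonal entries of a nonempty positive word from vanishing
together. -/
theorem NonnegMat.mul {M N : Matrix.SpecialLinearGroup (Fin 2) ℝ} (hM : NonnegMat M)
    (hN : NonnegMat N) : NonnegMat (M * N) ∧
      M 0 1 + M 1 0 + (N 0 1 + N 1 0) ≤ (M * N) 0 1 + (M * N) 1 0 := by
  obtain ⟨a1, a2, a3, a4⟩ := hM
  obtain ⟨b1, b2, b3, b4⟩ := hN
  refine ⟨⟨?_, ?_, ?_, ?_⟩, ?_⟩ <;> simp only [mul_apply_two] <;>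
    nlinarith [mul_nonneg a3 b4, mul_nonneg a4 b3,
      mul_nonneg (sub_nonneg.2 a1) (sub_nonneg.2 b1),
      mul_nonneg (sub_nonneg.2 a2) (sub_nonneg.2 b2),
      mul_nonneg (sub_nonneg.2 a1) b3, mul_nonneg a3 (sub_nonneg.2 b2),
      mul_nonneg a4 (sub_nonneg.2 b1), mul_nonneg (sub_nonneg.2 a2) b4]

theorem NonnegMat.exists_sends {M : Matrix.SpecialLinearGroup (Fin 2) ℝ} (hM : NonnegMat M)
    {x : ℝ} (hx : 0 < x) : ∃ y, 0 < y ∧ Sends M x y := by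
  have h1 : 0 < M 1 0 * x + M 1 1 := by nlinarith [hM.h10, hM.h11, mul_nonneg hM.h10 hx.le]
  have h2 : 0 < M 0 0 * x + M 0 1 := by nlinarith [hM.h00, hM.h01]
  exact ⟨_, div_pos h2 h1, h1.ne', (div_mul_cancel₀ _ h1.ne').symm⟩

theorem NonnegMat.pos {M : Matrix.SpecialLinearGroup (Fin 2) ℝ} (hM : NonnegMat M)
    {x y : ℝ} (hx : 0 < x) (h : Sends M x y) : 0 < y := by
  obtain ⟨z, hz, h'⟩ := hM.exists_sends hx
  rwa [h.unique h']

theorem NonnegMat.neg_of_sends {M : Matrix.SpecialLinearGroup (Fin 2) ℝ}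
    (hM : NonnegMat M) {x y : ℝ} (h : Sends M x y) (hy : y < 0) : x < 0 := by
  by_contra hx
  have h1 : 0 ≤ M 1 0 * x := mul_nonneg hM.h10 (not_lt.1 hx)
  have h2 : 0 ≤ M 0 0 * x := mul_nonneg (zero_le_one.trans hM.h00) (not_lt.1 hx)
  have h3 := h.2
  nlinarith [hM.h11, hM.h01]

/-- The product of the matrices `-U ^ n T`, `n` running through a list. -/
def word (p : ℕ) (l : List ℕ) : Matrix.SpecialLinearGroup (Fin 2) ℝ := (l.map (posR p)).prod

/-- A list of exponents that lie strictly between `0` and `p`. -/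
def Valid (p : ℕ) (l : List ℕ) : Prop := ∀ n ∈ l, 1 ≤ n ∧ n < p

@[simp] theorem word_nil : word p [] = 1 := rfl

theorem word_cons (n : ℕ) (l : List ℕ) : word p (n :: l) = posR p n * word p l := by
  simp [word]

theorem word_append (l l' : List ℕ) : word p (l ++ l') = word p l * word p l' := by
  simp [word]

theorem valid_cons {n : ℕ} {l : List ℕ} : Valid p (n :: l) ↔ (1 ≤ n ∧ n < p) ∧ Valid p l := by
  simp [Valid]

theorem valid_append {l l' : List ℕ} : Valid p (l ++ l') ↔ Valid p l ∧ Valid p l' := by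
  simp only [Valid, List.mem_append]
  exact ⟨fun h => ⟨fun n hn => h n (Or.inl hn), fun n hn => h n (Or.inr hn)⟩,
    fun h n hn => hn.elim (h.1 n) (h.2 n)⟩

theorem nonnegMat_one : NonnegMat 1 := ⟨by simp, by simp, by simp, by simp⟩

theorem nonnegMat_word (hp : 3 ≤ p) {l : List ℕ} (hl : Valid p l) :
    NonnegMat (word p l) ∧ (l ≠ [] → 0 < word p l 0 1 + word p l 1 0) := by
  induction l with
  | nil => exact ⟨nonnegMat_one, fun h => absurd rfl h⟩
  | cons n l ih =>
    rw [valid_cons] at hl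
    obtain ⟨i1, -⟩ := ih hl.2
    obtain ⟨r1, r2⟩ := nonnegMat_posR hp hl.1.1 hl.1.2
    obtain ⟨m1, m2⟩ := r1.mul i1
    rw [word_cons]
    exact ⟨m1, fun _ => by linarith [i1.h01, i1.h10]⟩

/-- The images of the positive half-line under the transformations `U ^ n T`, `0 < n < p`, are
disjoint. -/
theorem posR_disjoint (hp : 3 ≤ p) {m n : ℕ} (hm : 1 ≤ m ∧ m < p) (hn : 1 ≤ n ∧ n < p) {x y z : ℝ}
    (hx : 0 < x) (hy : 0 < y) (h1 : Sends (posR p m) x z) (h2 : Sends (posR p n) y z) :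
    m = n ∧ x = y := by
  have aux : ∀ {m n : ℕ}, 1 ≤ m → n < p → m < n → ∀ {x y : ℝ}, 0 < x → 0 < y →
      Sends (posR p m) x z → Sends (posR p n) y z → False := by
    intro m n hm hn hmn x y hx hy h1 h2
    have h3 := h1.inv.comp h2
    have e : (posR p m)⁻¹ * posR p n = matT⁻¹ * (-posR p (n - m)) := by
      obtain ⟨d, rfl⟩ : ∃ d, n = m + d := ⟨n - m, by omega⟩
      rw [inv_mul_eq_iff_eq_mul, posR, posR, posR, pow_add, Nat.add_sub_cancel_left]
      simp [mul_assoc]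
    rw [e] at h3
    obtain ⟨w, hw, h4⟩ := (nonnegMat_posR hp (n := n - m) (by omega) (by omega)).1.exists_sends hy
    have h5 := (sends_matT hx.ne').comp h3
    rw [mul_inv_cancel_left, sends_neg_iff] at h5
    have h6 : -1 / x < 0 := div_neg_of_neg_of_pos (by norm_num) hx
    linarith [h4.unique h5]
  rcases lt_trichotomy m n with h | h | h
  · exact (aux hm.1 hn.2 h hx hy h1 h2).elim
  · subst h
    exact ⟨rfl, h1.injective h2⟩
  · exact (aux hn.1 hm.2 h hy hx h2 h1).elim

/-- At most one of the transformations `U ^ n T`, `0 < n < p`, maps a given number to a negative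
one. -/
theorem posR_neg_unique (hp : 3 ≤ p) {m n : ℕ} (hm : m < p) (hn : n < p)
    {x y z : ℝ} (hy : y < 0) (hz : z < 0) (h1 : Sends (posR p m) x y) (h2 : Sends (posR p n) x z) :
    m = n := by
  have aux : ∀ {m n : ℕ}, n < p → m < n → ∀ {y z : ℝ}, y < 0 → z < 0 →
      Sends (posR p m) x y → Sends (posR p n) x z → False := by
    intro m n hn hmn y z hy hz h1 h2
    have h3 := h2.comp h1.inv
    have e : posR p n * (posR p m)⁻¹ = posR p (n - m) * matT := by
      obtain ⟨d, rfl⟩ : ∃ d, n = d + m := ⟨n - m, by omega⟩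
      rw [← matU_pow_eq, mul_inv_eq_iff_eq_mul, posR, posR, pow_add, Nat.add_sub_cancel]
      simp [mul_assoc]
    rw [e] at h3
    have h4 := h3.comp (sends_matT hy.ne).inv
    rw [mul_inv_cancel_right] at h4
    have := (nonnegMat_posR hp (n := n - m) (by omega) (by omega)).1.pos
      (div_pos_of_neg_of_neg (by norm_num) hy) h4
    linarith
  rcases lt_trichotomy m n with h | h | h
  · exact (aux hn h hy hz h1 h2).elim
  · exact h
  · exact (aux hm h hz hy h2 h1).elim

/-- The positive expansion of a number is determined: of two words that reach the same number, the
shorter one is a prefix of the longer one. -/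
theorem word_prefix (hp : 3 ≤ p) {l l' : List ℕ} (hl : Valid p l) (hl' : Valid p l') {x y z : ℝ}
    (hx : 0 < x) (hy : 0 < y) (h1 : Sends (word p l) x z) (h2 : Sends (word p l') y z)
    (hlen : l.length ≤ l'.length) :
    ∃ r, l' = l ++ r ∧ Sends (word p r) y x := by
  induction l generalizing l' z with
  | nil =>
    have : x = z := sends_one.unique h1
    exact ⟨l', rfl, this ▸ h2⟩
  | cons n l ih =>
    cases l' with
    | nil => simp at hlen
    | cons n' l' =>
      rw [valid_cons] at hl hl'
      rw [word_cons] at h1 h2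
      obtain ⟨u, hu, hu'⟩ := (nonnegMat_word hp hl.2).1.exists_sends hx
      obtain ⟨v, hv, hv'⟩ := (nonnegMat_word hp hl'.2).1.exists_sends hy
      have h3 := h1.comp hu'.inv
      have h4 := h2.comp hv'.inv
      rw [mul_inv_cancel_right] at h3 h4
      obtain ⟨rfl, rfl⟩ := posR_disjoint hp hl.1 hl'.1 hu hv h3 h4
      obtain ⟨r, rfl, hr⟩ := ih hl.2 hl'.2 hu' hv' (by simpa using hlen)
      exact ⟨r, rfl, hr⟩

theorem matT_mem : matT ∈ heckeGroup p := Subgroup.subset_closure (by simp)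

theorem matS_mem : matS p ∈ heckeGroup p := Subgroup.subset_closure (by simp)

theorem neg_one_mem : (-1 : Matrix.SpecialLinearGroup (Fin 2) ℝ) ∈ heckeGroup p := by
  rw [← matT_mul_matT]; exact mul_mem matT_mem matT_mem

theorem neg_mem_heckeGroup {V : Matrix.SpecialLinearGroup (Fin 2) ℝ} (h : V ∈ heckeGroup p) :
    -V ∈ heckeGroup p := by
  rw [← neg_one_mul]; exact mul_mem neg_one_mem h

theorem matU_mem : matU p ∈ heckeGroup p := mul_mem matS_mem matT_mem

theorem posR_mem (n : ℕ) : posR p n ∈ heckeGroup p :=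
  neg_mem_heckeGroup (mul_mem (pow_mem matU_mem n) matT_mem)

theorem word_mem (l : List ℕ) : word p l ∈ heckeGroup p := by
  induction l with
  | nil => exact one_mem _
  | cons n l ih => rw [word_cons]; exact mul_mem (posR_mem n) ih

/-- The matrices `± w W⁻ʲ` and `± T w W⁻ʲ`, where `w` is a positive word and `W` the word of a
fixed list `l`. -/
def HasForm (p : ℕ) (l : List ℕ) (V : Matrix.SpecialLinearGroup (Fin 2) ℝ) : Prop :=
  ∃ (w : List ℕ) (j : ℕ), Valid p w ∧
    ((V = word p w * (word p l ^ j)⁻¹ ∨ V = -(word p w * (word p l ^ j)⁻¹)) ∨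
      (V = matT * (word p w * (word p l ^ j)⁻¹) ∨ V = -(matT * (word p w * (word p l ^ j)⁻¹))))

theorem HasForm.neg {l : List ℕ} {V : Matrix.SpecialLinearGroup (Fin 2) ℝ} (h : HasForm p l V) :
    HasForm p l (-V) := by
  obtain ⟨w, j, hw, h⟩ := h
  refine ⟨w, j, hw, ?_⟩
  rcases h with (rfl | rfl) | (rfl | rfl) <;> simp

theorem HasForm.matT_mul {l : List ℕ} {V : Matrix.SpecialLinearGroup (Fin 2) ℝ}
    (h : HasForm p l V) : HasForm p l (matT * V) := by
  obtain ⟨w, j, hw, h⟩ := h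
  refine ⟨w, j, hw, ?_⟩
  rcases h with (rfl | rfl) | (rfl | rfl) <;> simp [← mul_assoc, matT_mul_matT]

theorem matU_mul_posR (n : ℕ) : matU p * posR p n = posR p (n + 1) := by
  rw [posR, posR, pow_succ']
  simp [mul_assoc]

theorem matU_mul_matT : matU p * matT = -posR p 1 := by simp [posR]

theorem posR_p (hp : 3 ≤ p) : posR p p = matT := by simp [posR, matU_pow_p hp]

theorem HasForm.matU_mul (hp : 3 ≤ p) {l : List ℕ} (hl : Valid p l) (hne : l ≠ [])
    {V : Matrix.SpecialLinearGroup (Fin 2) ℝ} (h : HasForm p l V) : HasForm p l (matU p * V) := by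
  have cons : ∀ (n : ℕ) (w : List ℕ) (j : ℕ), Valid p (n :: w) →
      HasForm p l (matU p * (word p (n :: w) * (word p l ^ j)⁻¹)) := by
    intro n w j hw
    rw [valid_cons] at hw
    rw [word_cons, ← mul_assoc, ← mul_assoc, matU_mul_posR]
    by_cases hn : n + 1 = p
    · rw [hn, posR_p hp]
      exact ⟨w, j, hw.2, by simp [mul_assoc]⟩
    · exact ⟨(n + 1) :: w, j, valid_cons.2 ⟨⟨by omega, by omega⟩, hw.2⟩, by simp [word_cons]⟩
  have main : ∀ (w : List ℕ) (j : ℕ), Valid p w →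
      HasForm p l (matU p * (word p w * (word p l ^ j)⁻¹)) := by
    intro w j hw
    cases w with
    | cons n w => exact cons n w j hw
    | nil =>
      -- the empty word is replaced by `W`, at the cost of raising `j`
      obtain ⟨n, w, rfl⟩ := List.exists_cons_of_ne_nil hne
      have := cons n w (j + 1) hl
      rwa [pow_succ, mul_inv_rev, mul_inv_cancel_left,
        ← one_mul (word p (n :: w) ^ j)⁻¹, ← word_nil] at this
  obtain ⟨w, j, hw, h⟩ := h
  have cons1 : HasForm p l (matU p * (matT * (word p w * (word p l ^ j)⁻¹))) := by
    rw [← mul_assoc, matU_mul_matT]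
    exact ⟨1 :: w, j, valid_cons.2 ⟨⟨le_rfl, by omega⟩, hw⟩, by simp [word_cons, mul_assoc]⟩
  rcases h with (rfl | rfl) | (rfl | rfl)
  · exact main w j hw
  · rw [mul_neg]; exact (main w j hw).neg
  · exact cons1
  · rw [mul_neg]; exact cons1.neg

/-- Every element of the Hecke group is, up to sign, of the form `w W⁻ʲ` or `T w W⁻ʲ`: the set of
these matrices is stable under left multiplication by `T` and `U`. -/
theorem hasForm_of_mem (hp : 3 ≤ p) {l : List ℕ} (hl : Valid p l) (hne : l ≠ [])
    {V : Matrix.SpecialLinearGroup (Fin 2) ℝ} (hV : V ∈ heckeGroup p) : HasForm p l V := by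
  have hpow : ∀ (n : ℕ) {V : Matrix.SpecialLinearGroup (Fin 2) ℝ}, HasForm p l V →
      HasForm p l (matU p ^ n * V) := by
    intro n V h
    induction n with
    | zero => simpa using h
    | succ n ih => rw [pow_succ', mul_assoc]; exact ih.matU_mul hp hl hne
  have hS : matS p = -(matU p * matT) := by
    rw [matU, mul_assoc, matT_mul_matT]; simp
  have hSinv : (matS p)⁻¹ = -(matT * matU p ^ (p - 1)) := by
    rw [inv_eq_iff_mul_eq_one, hS, neg_mul_neg, mul_assoc, ← mul_assoc matT, matT_mul_matT,
      neg_one_mul, mul_neg, ← pow_succ', Nat.sub_add_cancel (by omega), matU_pow_p hp, neg_neg]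
  unfold heckeGroup at hV
  induction hV using Subgroup.closure_induction_left with
  | one => exact ⟨[], 0, by simp [Valid], by simp⟩
  | mul_left x hx y _ ih =>
    rcases hx with rfl | rfl
    · rw [hS, neg_mul, mul_assoc]
      exact (ih.matT_mul.matU_mul hp hl hne).neg
    · exact ih.matT_mul
  | inv_mul_cancel x hx y _ ih =>
    rcases hx with rfl | rfl
    · rw [hSinv, neg_mul, mul_assoc]
      exact (hpow _ ih).matT_mul.neg
    · rw [matT_inv, neg_mul]
      exact ih.matT_mul.neg

/-! ### Fixed points of positive words -/

/-- The positive number `x` is fixed by the word of the nonempty list `l`. -/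
structure FixedBy (p : ℕ) (l : List ℕ) (x : ℝ) : Prop where
  valid : Valid p l
  ne_nil : l ≠ []
  pos : 0 < x
  sends : Sends (word p l) x x

/-- A nonempty positive word that fixes a positive number is hyperbolic, with positive off-diagonal
entries `b` and `c`; its other fixed point is then negative, as the product of the two fixed points
is `-b / c`. -/
theorem FixedBy.hyperbolic (hp : 3 ≤ p) {l : List ℕ} {x : ℝ} (h : FixedBy p l x) :
    0 < word p l 1 0 ∧ 0 < word p l 0 1 ∧ 2 < word p l 0 0 + word p l 1 1 := by
  obtain ⟨⟨h00, h11, h01, h10⟩, hpos⟩ := nonnegMat_word hp h.valid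
  have hpos := hpos h.ne_nil
  have hx := h.pos
  have hs := h.sends.2
  have hd := det_eq (word p l)
  have hc : 0 < word p l 1 0 := by
    rcases h10.eq_or_lt with h0 | h0
    · rw [← h0] at hd hs hpos
      have h1 : word p l 0 0 = 1 := by nlinarith
      have h2 : word p l 1 1 = 1 := by nlinarith
      rw [h1, h2] at hs
      linarith
    · exact h0
  have hb : 0 < word p l 0 1 := by
    rcases h01.eq_or_lt with h0 | h0
    · rw [← h0] at hd hs hpos
      have h1 : word p l 0 0 = 1 := by nlinarith
      have h2 : word p l 1 1 = 1 := by nlinarith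
      rw [h1, h2] at hs
      nlinarith [mul_pos hc (mul_pos hx hx)]
    · exact h0
  refine ⟨hc, hb, ?_⟩
  have := mul_pos hb hc
  nlinarith [sq_nonneg (word p l 0 0 - word p l 1 1)]

theorem exists_minimal_fixedBy {x : ℝ} (h : ∃ l, FixedBy p l x) :
    ∃ l, FixedBy p l x ∧ ∀ l', FixedBy p l' x → l.length ≤ l'.length := by
  classical
  have h' : ∃ n, ∃ l, FixedBy p l x ∧ l.length = n := h.imp' List.length fun l hl => ⟨l, hl, rfl⟩
  obtain ⟨l, hl, hn⟩ := Nat.find_spec h'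
  exact ⟨l, hl, fun l' hl' => hn ▸ Nat.find_min' h' ⟨l', hl', rfl⟩⟩

/-- By unique expansion, every word that fixes `x` is a power of the shortest one. -/
theorem word_eq_pow (hp : 3 ≤ p) {x : ℝ} {l : List ℕ} (hl : FixedBy p l x)
    (hmin : ∀ l', FixedBy p l' x → l.length ≤ l'.length) (w : List ℕ) (hw : Valid p w)
    (h : Sends (word p w) x x) : ∃ n : ℕ, word p w = word p l ^ n := by
  induction hn : w.length using Nat.strong_induction_on generalizing w with
  | _ n ih =>
    subst hn
    by_cases hne : w = []
    · exact ⟨0, by simp [hne]⟩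
    · obtain ⟨r, rfl, hr⟩ := word_prefix hp hl.valid hw hl.pos hl.pos hl.sends h
        (hmin w ⟨hw, hne, hl.pos, h⟩)
      have := List.length_pos_iff.2 hl.ne_nil
      obtain ⟨n, hn⟩ := ih r.length (by simp; omega) r (valid_append.1 hw).2 hr rfl
      exact ⟨n + 1, by rw [word_append, hn, pow_succ']⟩

/-- The word of a shortest list that fixes `x` generates the stabilizer of `x`. -/
theorem isStabilizerGenerator_word (hp : 3 ≤ p) {x : ℝ} {l : List ℕ} (hl : FixedBy p l x)
    (hmin : ∀ l', FixedBy p l' x → l.length ≤ l'.length) :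
    IsStabilizerGenerator p (word p l) x := by
  refine ⟨word_mem l, (hl.hyperbolic hp).2.2.trans_le (le_abs_self _), fixes_iff.2 hl.sends, ?_⟩
  intro N hN hx
  rw [fixes_iff] at hx
  obtain ⟨w, j, hw, h⟩ := hasForm_of_mem hp hl.valid hl.ne_nil hN
  have hj := hl.sends.pow j
  obtain ⟨y, hy, hy'⟩ := (nonnegMat_word hp hw).1.exists_sends hl.pos
  have h1 := hy'.comp hj.inv
  have key : y = x → ∃ n : ℕ, word p w = word p l ^ n := by
    rintro rfl
    exact word_eq_pow hp hl hmin w hw hy'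
  have hneg : Sends matT y (-1 / y) := sends_matT hy.ne'
  have hneg' : -1 / y < 0 := div_neg_of_neg_of_pos (by norm_num) hy
  have hx0 := hl.pos
  rcases h with (rfl | rfl) | (rfl | rfl)
  · obtain ⟨n, hn⟩ := key (h1.unique hx)
    exact ⟨n - j, Or.inl (by rw [hn, zpow_sub, zpow_natCast, zpow_natCast])⟩
  · obtain ⟨n, hn⟩ := key (h1.neg.unique hx)
    exact ⟨n - j, Or.inr (by rw [hn, zpow_sub, zpow_natCast, zpow_natCast])⟩
  · linarith [(hneg.comp h1).unique hx]
  · linarith [(hneg.comp h1).neg.unique hx]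

theorem exists_isStabilizerGenerator (hp : 3 ≤ p) {x : ℝ} (h : ∃ l, FixedBy p l x) :
    ∃ l, FixedBy p l x ∧ IsStabilizerGenerator p (word p l) x := by
  obtain ⟨l, hl, hmin⟩ := exists_minimal_fixedBy h
  exact ⟨l, hl, isStabilizerGenerator_word hp hl hmin⟩

theorem posR_sub (hp : 3 ≤ p) {n : ℕ} (hn : n ≤ p) :
    posR p (p - n) = matT * (posR p n)⁻¹ * matT⁻¹ := by
  have h : matU p ^ (p - n) = -(matU p ^ n)⁻¹ := by
    rw [← neg_one_mul, eq_mul_inv_iff_mul_eq, ← pow_add, Nat.sub_add_cancel hn, matU_pow_p hp]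
  rw [posR, posR, h, inv_neg, mul_inv_rev, neg_mul, neg_neg, mul_neg, neg_mul, mul_inv_cancel_left,
    matT_inv, mul_neg, neg_neg]

/-- Reversing a list and replacing each exponent `n` by `p - n` inverts its word up to conjugation
by `T`. -/
theorem word_reverse (hp : 3 ≤ p) {l : List ℕ} (hl : Valid p l) :
    word p (l.reverse.map (p - ·)) = matT * (word p l)⁻¹ * matT⁻¹ := by
  induction l with
  | nil => simp
  | cons n l ih =>
    rw [valid_cons] at hl
    rw [List.reverse_cons, List.map_append, word_append, ih hl.2, List.map_singleton, word_cons,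
      word_nil, mul_one, posR_sub hp hl.1.2.le, word_cons, mul_inv_rev]
    group

/-- If `y < 0` is the other fixed point of the word, then `z = -1 / y` is fixed by the reversed
word. -/
theorem FixedBy.reverse (hp : 3 ≤ p) {l : List ℕ} {x y z : ℝ} (hl : FixedBy p l x)
    (hy : y < 0) (hl' : Sends (word p l) y y) (hz : Sends matT y z) :
    FixedBy p (l.reverse.map (p - ·)) z := by
  refine ⟨?_, by simpa using hl.ne_nil, ?_, ?_⟩
  · intro n hn
    simp only [List.mem_map, List.mem_reverse] at hn
    obtain ⟨m, hm, rfl⟩ := hn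
    have := hl.valid m hm
    omega
  · have := sends_matT_iff.1 hz
    nlinarith
  · rw [word_reverse hp hl.valid]
    exact (hz.comp hl'.inv).comp hz.inv

end Hecke

/-! ### Stabilizers of hyperbolic fixed points -/

section Stabilizers

variable {p : ℕ} {M N V : Matrix.SpecialLinearGroup (Fin 2) ℝ} {x y z : ℝ}

/-- The denominator `c x + d`; if `M` fixes `x`, this is the eigenvalue of `M` at `(x, 1)`. -/
def jac (M : Matrix.SpecialLinearGroup (Fin 2) ℝ) (x : ℝ) : ℝ := M 1 0 * x + M 1 1

theorem jac_mul (h : Sends N x y) : jac (M * N) x = jac M y * jac N x := by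
  unfold jac
  simp only [mul_apply_two]
  linear_combination M 1 0 * h.2

theorem jac_one : jac 1 x = 1 := by simp [jac]

theorem jac_neg : jac (-M) x = -jac M x := by
  simp only [jac, neg_apply_SL]; ring

theorem jac_inv (h : Sends M x y) : jac M⁻¹ y * jac M x = 1 := by
  rw [← jac_mul h, inv_mul_cancel, jac_one]

theorem jac_pow (h : Sends M x x) (n : ℕ) : jac (M ^ n) x = jac M x ^ n := by
  induction n with
  | zero => simp [jac_one]
  | succ n ih => rw [pow_succ, jac_mul h, ih, pow_succ]

theorem jac_zpow (h : Sends M x x) (n : ℤ) : jac (M ^ n) x = jac M x ^ n := by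
  cases n with
  | ofNat n => simpa using jac_pow h n
  | negSucc n =>
    rw [zpow_negSucc, zpow_negSucc, ← jac_pow h]
    exact eq_inv_of_mul_eq_one_left (jac_inv (h.pow _))

theorem jac_charpoly (h : Sends M x x) :
    jac M x ^ 2 - (M 0 0 + M 1 1) * jac M x + 1 = 0 := by
  have hd := det_eq M
  have h2 := h.2
  unfold jac
  linear_combination M 1 0 * h2 * (-1) - hd

theorem trace_eq (h : Sends M x x) : M 0 0 + M 1 1 = jac M x + (jac M x)⁻¹ := by
  have h0 : jac M x ≠ 0 := h.1
  have := jac_charpoly h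
  field_simp
  linarith

theorem abs_jac_ne_one (h : Sends M x x) (hM : 2 < |M 0 0 + M 1 1|) : |jac M x| ≠ 1 := by
  intro h1
  have ht := trace_eq h
  rcases (abs_eq zero_le_one).1 h1 with h2 | h2 <;> rw [ht, h2] at hM <;> norm_num at hM

theorem IsStabilizerGenerator.sends (h : IsStabilizerGenerator p M x) : Sends M x x :=
  fixes_iff.1 h.fixes

/-- The eigenvalue normalization singles out one of the generators `±M`, `±M⁻¹`. -/
theorem IsStabilizerGenerator.unique (h : IsStabilizerGenerator p M x)
    (h' : IsStabilizerGenerator p N x) (h1 : 1 < jac M x) (h2 : 1 < jac N x) : M = N := by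
  obtain ⟨n, hn⟩ := h.generates N h'.mem h'.fixes
  obtain ⟨m, hm⟩ := h'.generates M h.mem h.fixes
  have e1 : jac N x = jac M x ^ n := by
    rcases hn with hn | hn
    · rw [hn, jac_zpow h.sends]
    · rw [hn, jac_neg, jac_zpow h.sends] at h2
      have : 0 < jac M x ^ n := zpow_pos (by linarith) n
      linarith
  have e2 : jac M x = jac N x ^ m := by
    rcases hm with hm | hm
    · rw [← jac_zpow h'.sends, ← hm]
    · rw [hm, jac_neg, jac_zpow h'.sends] at h1
      have : 0 < jac N x ^ m := zpow_pos (by linarith) m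
      linarith
  have hn0 : 0 < n := by
    by_contra hc
    have := zpow_le_one_of_nonpos₀ h1.le (not_lt.1 hc)
    linarith
  have hnm : n * m = 1 := by
    rw [e1, ← zpow_mul] at e2
    have e3 : jac M x ^ (1 : ℤ) = jac M x ^ (n * m) := by simpa using e2
    exact (zpow_right_injective₀ (by linarith) h1.ne' e3).symm
  have hn1 : n = 1 := by
    rcases Int.eq_one_or_neg_one_of_mul_eq_one hnm with h | h <;> omega
  rw [hn1, zpow_one] at hn
  rcases hn with hn | hn
  · exact hn.symm
  · rw [hn, jac_neg] at h2
    linarith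

theorem IsStabilizerGenerator.neg (h : IsStabilizerGenerator p M x) :
    IsStabilizerGenerator p (-M) x := by
  refine ⟨neg_mem_heckeGroup h.mem, ?_, fixes_iff.2 h.sends.neg, ?_⟩
  · rw [neg_apply_SL, neg_apply_SL, ← neg_add, abs_neg]; exact h.hyperbolic
  · intro N hN hx
    obtain ⟨n, hn⟩ := h.generates N hN hx
    refine ⟨n, ?_⟩
    rcases Int.even_or_odd n with he | ho
    · rwa [he.neg_zpow]
    · rw [ho.neg_zpow, neg_neg]; exact hn.symm

theorem IsStabilizerGenerator.inv (h : IsStabilizerGenerator p M x) :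
    IsStabilizerGenerator p M⁻¹ x := by
  refine ⟨inv_mem h.mem, ?_, fixes_iff.2 h.sends.inv, ?_⟩
  · obtain ⟨e1, -, -, e4⟩ := inv_apply_SL M
    rw [e1, e4, add_comm]; exact h.hyperbolic
  · intro N hN hx
    obtain ⟨n, hn⟩ := h.generates N hN hx
    exact ⟨-n, by simpa using hn⟩

theorem trace_conj (M V : Matrix.SpecialLinearGroup (Fin 2) ℝ) :
    (V * M * V⁻¹) 0 0 + (V * M * V⁻¹) 1 1 = M 0 0 + M 1 1 := by
  obtain ⟨e1, e2, e3, e4⟩ := inv_apply_SL V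
  have hd := det_eq V
  simp only [mul_apply_two, e1, e2, e3, e4]
  linear_combination (M 0 0 + M 1 1) * hd

theorem IsStabilizerGenerator.conj (h : IsStabilizerGenerator p M x) (hV : V ∈ heckeGroup p)
    (hxy : Sends V x y) : IsStabilizerGenerator p (V * M * V⁻¹) y := by
  refine ⟨mul_mem (mul_mem hV h.mem) (inv_mem hV), ?_,
    fixes_iff.2 ((hxy.comp h.sends).comp hxy.inv), ?_⟩
  · rw [trace_conj]; exact h.hyperbolic
  · intro N hN hy
    obtain ⟨n, hn⟩ := h.generates (V⁻¹ * N * V) (mul_mem (mul_mem (inv_mem hV) hN) hV)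
      (fixes_iff.2 ((hxy.inv.comp (fixes_iff.1 hy)).comp hxy))
    refine ⟨n, ?_⟩
    have e : N = V * (V⁻¹ * N * V) * V⁻¹ := by group
    rw [conj_zpow]
    rcases hn with hn | hn
    · left; rw [e, hn]
    · right; rw [e, hn]; simp

/-- The matrix `M` generates the stabilizer of `x`, its other fixed point is `x'`, and `M` is
normalized so that its eigenvalue at `(x, 1)` exceeds `1`. -/
structure FixedPair (p : ℕ) (M : Matrix.SpecialLinearGroup (Fin 2) ℝ) (x x' : ℝ) : Prop where
  gen : IsStabilizerGenerator p M x
  sends' : Sends M x' x'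
  ne : x ≠ x'
  one_lt : 1 < jac M x

theorem FixedPair.c_ne_zero {x' : ℝ} (h : FixedPair p M x x') : M 1 0 ≠ 0 := by
  intro h0
  have h1 := h.gen.sends.2
  have h2 := h.sends'.2
  have hd := det_eq M
  have hj := h.one_lt
  unfold jac at hj
  rw [h0] at h1 h2 hd hj
  have h3 : (M 0 0 - M 1 1) * (x - x') = 0 := by linear_combination h1 - h2
  have h4 : M 0 0 - M 1 1 = 0 := (mul_eq_zero.1 h3).resolve_right (sub_ne_zero.2 h.ne)
  nlinarith

theorem FixedPair.conj {x' y' : ℝ} (h : FixedPair p M x x') (hV : V ∈ heckeGroup p)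
    (hxy : Sends V x y) (hxy' : Sends V x' y') : FixedPair p (V * M * V⁻¹) y y' := by
  refine ⟨h.gen.conj hV hxy, (hxy'.comp h.sends').comp hxy'.inv, ?_, ?_⟩
  · rintro rfl
    exact h.ne (hxy.injective hxy')
  · rw [jac_mul hxy.inv, jac_mul h.gen.sends, mul_right_comm, mul_comm (jac V x), jac_inv hxy,
      one_mul]
    exact h.one_lt

theorem FixedPair.vieta {x' : ℝ} (h : FixedPair p M x x') :
    M 1 0 * (x + x') = M 0 0 - M 1 1 ∧ M 1 0 * (x * x') = -M 0 1 := by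
  have h1 := h.gen.sends.2
  have h2 := h.sends'.2
  have hne := sub_ne_zero.2 h.ne
  have e1 : M 1 0 * (x + x') = M 0 0 - M 1 1 := by
    apply mul_right_cancel₀ hne
    linear_combination h2 - h1
  exact ⟨e1, by linear_combination x * e1 + h1⟩

theorem FixedPair.jac_mul_jac {x' : ℝ} (h : FixedPair p M x x') : jac M x * jac M x' = 1 := by
  obtain ⟨h1, h2⟩ := h.vieta
  have hd := det_eq M
  unfold jac
  linear_combination hd + M 1 0 * h2 + M 1 1 * h1

theorem FixedPair.unique {x' y' : ℝ} (h : FixedPair p M x x') (h' : FixedPair p N x y') :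
    M = N ∧ x' = y' := by
  obtain rfl := h.gen.unique h'.gen h.one_lt h'.one_lt
  refine ⟨rfl, ?_⟩
  have h1 := h.vieta.1
  have h2 := h'.vieta.1
  have := mul_left_cancel₀ h.c_ne_zero (h1.trans h2.symm)
  linarith

/-- An element of the Hecke group that fixes `x` also fixes `x'`. -/
theorem FixedPair.sends_of_sends {x' : ℝ} (h : FixedPair p M x x') (hN : N ∈ heckeGroup p)
    (hx : Sends N x x) : Sends N x' x' := by
  obtain ⟨n, hn⟩ := h.gen.generates N hN (fixes_iff.2 hx)
  exact fixes_iff.1 (fixes_of_commute h.c_ne_zero (commute_of_eq_pow hn) (fixes_iff.2 h.sends'))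

theorem FixedBy.exists_fixedPair (hp : 3 ≤ p) (h : ∃ l, FixedBy p l x) :
    ∃ M x', FixedPair p M x x' ∧ x' < 0 := by
  obtain ⟨l, hl, hg⟩ := exists_isStabilizerGenerator hp h
  obtain ⟨hc, hb, ht⟩ := hl.hyperbolic hp
  have hm := (nonnegMat_word hp hl.valid).1
  have hx := hl.pos
  set M := word p l with hM
  have hx' : -M 0 1 / (M 1 0 * x) < 0 := div_neg_of_neg_of_pos (by linarith) (mul_pos hc hx)
  refine ⟨M, -M 0 1 / (M 1 0 * x), ⟨hg, fixes_iff.1 ?_, by linarith, ?_⟩, hx'⟩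
  · have h1 := hl.sends.2
    rw [← hM] at h1
    unfold Fixes
    field_simp
    linear_combination (-1 : ℝ) * h1
  · unfold jac
    nlinarith [hm.h11, mul_pos hc hx]

/-- The orbit of `x` avoids the point at infinity: up to sign, `V` is a positive word after a power
of the word that fixes `x`, possibly followed by `T`. -/
theorem orbit_finite_of_fixedBy (hp : 3 ≤ p) (h : ∃ l, FixedBy p l x) (hV : V ∈ heckeGroup p) :
    ∃ y, Sends V x y := by
  obtain ⟨l, hl⟩ := h
  obtain ⟨w, j, hw, h⟩ := hasForm_of_mem hp hl.valid hl.ne_nil hV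
  obtain ⟨y, hy, hy'⟩ := (nonnegMat_word hp hw).1.exists_sends hl.pos
  have h1 := hy'.comp (hl.sends.pow j).inv
  have h2 := (sends_matT hy.ne').comp h1
  rcases h with (rfl | rfl) | (rfl | rfl)
  · exact ⟨_, h1⟩
  · exact ⟨_, h1.neg⟩
  · exact ⟨_, h2⟩
  · exact ⟨_, h2.neg⟩

theorem FixedBy.reverse_of_fixedPair (hp : 3 ≤ p) {x' : ℝ} (h : ∃ l, FixedBy p l x)
    (hM : FixedPair p M x x') : ∃ l, FixedBy p l (-1 / x') := by
  obtain ⟨l, hl⟩ := h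
  have h1 := hM.sends_of_sends (word_mem l) hl.sends
  have hx' : x' < 0 := by
    obtain ⟨N, y', hN, hy'⟩ := FixedBy.exists_fixedPair hp ⟨l, hl⟩
    rwa [(hM.unique hN).2]
  exact ⟨_, hl.reverse hp hx' h1 (sends_matT hx'.ne)⟩

theorem orbit_finite_of_fixedPair (hp : 3 ≤ p) {x' : ℝ} (h : ∃ l, FixedBy p l x)
    (hM : FixedPair p M x x') (hV : V ∈ heckeGroup p) :
    ∃ y y', Sends V x y ∧ Sends V x' y' := by
  obtain ⟨y, hy⟩ := orbit_finite_of_fixedBy hp h hV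
  have hr := FixedBy.reverse_of_fixedPair hp h hM
  have hx' : x' ≠ 0 := by
    obtain ⟨l, hl⟩ := hr
    rintro rfl
    have := hl.pos
    simp at this
  obtain ⟨y', hy'⟩ := orbit_finite_of_fixedBy hp hr (mul_mem hV (inv_mem matT_mem))
  have := hy'.comp (sends_matT hx')
  rw [inv_mul_cancel_right] at this
  exact ⟨y, y', hy, this⟩

/-- The stabilizers of `x` and of `x'` are the same. -/
theorem FixedPair.swap (hp : 3 ≤ p) {x' : ℝ} (h : ∃ l, FixedBy p l x)
    (hM : FixedPair p M x x') : FixedPair p M⁻¹ x' x := by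
  obtain ⟨l, -, hg⟩ := exists_isStabilizerGenerator hp (FixedBy.reverse_of_fixedPair hp h hM)
  have hx' : x' ≠ 0 := by
    rintro rfl
    have := hg.sends
    obtain ⟨l, hl⟩ := FixedBy.reverse_of_fixedPair hp h hM
    have := hl.pos
    simp at this
  have hg' := hg.conj (inv_mem matT_mem) (sends_matT hx').inv
  set N' := matT⁻¹ * word p l * matT⁻¹⁻¹
  have hgen : IsStabilizerGenerator p M x' := by
    refine ⟨hM.gen.mem, hM.gen.hyperbolic, fixes_iff.2 hM.sends', ?_⟩
    intro N hN hNx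
    obtain ⟨i, hi⟩ := hg'.generates M hM.gen.mem (fixes_iff.2 hM.sends')
    obtain ⟨j, hj⟩ := hg'.generates N hN hNx
    have c1 : Commute M N' := (commute_of_eq_pow hi).symm
    have c2 : Commute M N := by
      rcases hj with rfl | rfl
      · exact c1.zpow_right j
      · exact (c1.zpow_right j).neg_right
    exact hM.gen.generates N hN (fixes_of_commute hM.c_ne_zero c2 hM.gen.fixes)
  refine ⟨hgen.inv, hM.gen.sends.inv, hM.ne.symm, ?_⟩
  have h1 := jac_inv hM.sends'
  have h2 := hM.jac_mul_jac
  have h0 : jac M x' ≠ 0 := right_ne_zero_of_mul_eq_one h2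
  rw [mul_right_cancel₀ h0 (h1.trans h2.symm)]
  exact hM.one_lt

end Stabilizers

/-! ### The form associated with a hyperbolic fixed point -/

section Forms

variable {p : ℕ} {M N V : Matrix.SpecialLinearGroup (Fin 2) ℝ} {x y z x' y' : ℝ}

theorem apply_mem_lamRing (hM : M ∈ heckeGroup p) : ∀ i j, M i j ∈ LamRing p := by
  unfold heckeGroup at hM
  have hlam : lam p ∈ LamRing p := Algebra.subset_adjoin (by simp)
  induction hM using Subgroup.closure_induction with
  | mem x hx =>
    intro i j
    rcases hx with rfl | rfl
    · fin_cases i <;> fin_cases j <;> simp [matS, hlam]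
    · fin_cases i <;> fin_cases j <;> simp [matT]
  | one => intro i j; fin_cases i <;> fin_cases j <;> simp
  | mul x y _ _ hx hy =>
    intro i j
    rw [mul_apply_two]
    exact add_mem (mul_mem (hx _ _) (hy _ _)) (mul_mem (hx _ _) (hy _ _))
  | inv x _ hx =>
    obtain ⟨e1, e2, e3, e4⟩ := inv_apply_SL x
    intro i j
    fin_cases i <;> fin_cases j
    · exact e1 ▸ hx _ _
    · exact e2 ▸ neg_mem (hx _ _)
    · exact e3 ▸ neg_mem (hx _ _)
    · exact e4 ▸ hx _ _

/-- The ideal `(c, d - a, -b)` of the matrix `M = (a, b; c, d)`; a generator that does not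
lie in `ℤ[λ_p]` is left out. -/
def coefIdeal (p : ℕ) (M : Matrix.SpecialLinearGroup (Fin 2) ℝ) : Ideal (LamRing p) :=
  Ideal.span {u : LamRing p | (u : ℝ) = M 1 0 ∨ (u : ℝ) = M 1 1 - M 0 0 ∨ (u : ℝ) = -M 0 1}

theorem coefIdeal_eq {u v w : LamRing p} (hu : (u : ℝ) = M 1 0) (hv : (v : ℝ) = M 1 1 - M 0 0)
    (hw : (w : ℝ) = -M 0 1) :
    Ideal.span {u} ⊔ Ideal.span {v} ⊔ Ideal.span {w} = coefIdeal p M := by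
  rw [coefIdeal, ← Ideal.span_union, ← Ideal.span_union]
  congr 1
  ext t
  simp only [Set.mem_union, Set.mem_singleton_iff, Set.mem_ofPred_eq, ← hu, ← hv, ← hw,
    Subtype.coe_inj, or_assoc]

theorem mem_coefIdeal {t : LamRing p} (α β γ u v w : LamRing p) (hu : (u : ℝ) = M 1 0)
    (hv : (v : ℝ) = M 1 1 - M 0 0) (hw : (w : ℝ) = -M 0 1)
    (ht : (t : ℝ) = α * M 1 0 + β * (M 1 1 - M 0 0) + γ * (-M 0 1)) : t ∈ coefIdeal p M := by
  have e : t = α * u + β * v + γ * w := by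
    apply Subtype.ext
    push_cast
    rw [ht, hu, hv, hw]
  rw [e]
  refine add_mem (add_mem ?_ ?_) ?_ <;> refine Ideal.mul_mem_left _ _ (Ideal.subset_span ?_)
  · exact Or.inl hu
  · exact Or.inr (Or.inl hv)
  · exact Or.inr (Or.inr hw)

theorem exists_coefs (hM : M ∈ heckeGroup p) : ∃ u v w : LamRing p,
    (u : ℝ) = M 1 0 ∧ (v : ℝ) = M 1 1 - M 0 0 ∧ (w : ℝ) = -M 0 1 := by
  have h := apply_mem_lamRing hM
  exact ⟨⟨_, h 1 0⟩, ⟨_, sub_mem (h 1 1) (h 0 0)⟩, ⟨_, neg_mem (h 0 1)⟩, rfl, rfl, rfl⟩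

theorem coefIdeal_neg : coefIdeal p (-M) = coefIdeal p M := by
  have aux : ∀ M : Matrix.SpecialLinearGroup (Fin 2) ℝ, coefIdeal p (-M) ≤ coefIdeal p M := by
    intro M
    refine Ideal.span_le.2 fun t ht => ?_
    rw [SetLike.mem_coe, ← neg_neg t]
    refine neg_mem (Ideal.subset_span ?_)
    simp only [Set.mem_ofPred_eq, neg_apply_SL] at ht ⊢
    push_cast
    rcases ht with h | h | h
    · left; linarith
    · right; left; linarith
    · right; right; linarith
  refine le_antisymm (aux M) ?_
  have := aux (-M)
  rwa [neg_neg] at this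

theorem coefIdeal_inv : coefIdeal p M⁻¹ = coefIdeal p M := by
  obtain ⟨e1, e2, e3, e4⟩ := inv_apply_SL M
  rw [← coefIdeal_neg]
  unfold coefIdeal
  simp only [neg_apply_SL, e1, e2, e3, e4, neg_neg]
  congr 1
  ext t
  simp only [Set.mem_ofPred_eq]
  rw [show -M 0 0 - -M 1 1 = M 1 1 - M 0 0 by ring]

theorem coefIdeal_conj (hM : M ∈ heckeGroup p) (hV : V ∈ heckeGroup p) :
    coefIdeal p (V * M * V⁻¹) = coefIdeal p M := by
  have aux : ∀ {M V : Matrix.SpecialLinearGroup (Fin 2) ℝ}, M ∈ heckeGroup p → V ∈ heckeGroup p →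
      coefIdeal p (V * M * V⁻¹) ≤ coefIdeal p M := by
    intro M V hM hV
    obtain ⟨u, v, w, hu, hv, hw⟩ := exists_coefs hM
    have hm := apply_mem_lamRing hV
    obtain ⟨a, ha⟩ : ∃ a : LamRing p, (a : ℝ) = V 0 0 := ⟨⟨_, hm 0 0⟩, rfl⟩
    obtain ⟨b, hb⟩ : ∃ a : LamRing p, (a : ℝ) = V 0 1 := ⟨⟨_, hm 0 1⟩, rfl⟩
    obtain ⟨c, hc⟩ : ∃ a : LamRing p, (a : ℝ) = V 1 0 := ⟨⟨_, hm 1 0⟩, rfl⟩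
    obtain ⟨d, hd⟩ : ∃ a : LamRing p, (a : ℝ) = V 1 1 := ⟨⟨_, hm 1 1⟩, rfl⟩
    obtain ⟨e1, e2, e3, e4⟩ := inv_apply_SL V
    refine Ideal.span_le.2 fun t ht => ?_
    rw [SetLike.mem_coe]
    simp only [Set.mem_ofPred_eq, mul_apply_two, e1, e2, e3, e4] at ht
    rcases ht with ht | ht | ht
    · refine mem_coefIdeal (d ^ 2) (-(c * d)) (c ^ 2) u v w hu hv hw (ht.trans ?_)
      push_cast
      rw [hc, hd]
      ring
    · refine mem_coefIdeal (-(b * d + b * d)) (a * d + b * c) (-(a * c + a * c)) u v w hu hv hw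
        (ht.trans ?_)
      push_cast
      rw [ha, hb, hc, hd]
      ring
    · refine mem_coefIdeal (b ^ 2) (-(a * b)) (a ^ 2) u v w hu hv hw (ht.trans ?_)
      push_cast
      rw [ha, hb]
      ring
  refine le_antisymm (aux hM hV) ?_
  have := aux (mul_mem (mul_mem hV hM) (inv_mem hV)) (inv_mem hV)
  have e : V⁻¹ * (V * M * V⁻¹) * V⁻¹⁻¹ = M := by group
  rwa [e] at this

theorem normFactor_pos (I : Ideal (LamRing p)) : 0 < normFactor p I := by
  unfold normFactor
  split_ifs with h
  · exact (Classical.choose_spec h.2).1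
  · exact one_pos

/-- `Q` is the form associated with `x`, and `x'` is the Hecke conjugate of `x`. The choice of sign
in the definition of the form is absorbed in the normalization of the generator `M`. -/
def IsFormPair (Q : BQF p) (x x' : ℝ) : Prop :=
  ∃ M, FixedPair p M x x' ∧ (Q.A : ℝ) * normFactor p (coefIdeal p M) = M 1 0 ∧
    (Q.B : ℝ) * normFactor p (coefIdeal p M) = M 1 1 - M 0 0 ∧
    (Q.C : ℝ) * normFactor p (coefIdeal p M) = -M 0 1

theorem IsFormPair.vieta {Q : BQF p} (h : IsFormPair Q x x') :
    (Q.A : ℝ) ≠ 0 ∧ (Q.A : ℝ) * (x + x') = -Q.B ∧ (Q.A : ℝ) * (x * x') = Q.C ∧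
      0 < (Q.A : ℝ) * (x - x') := by
  obtain ⟨M, hM, h1, h2, h3⟩ := h
  have hg := normFactor_pos (coefIdeal p M)
  set g := normFactor p (coefIdeal p M)
  obtain ⟨v1, v2⟩ := hM.vieta
  have hj := hM.jac_mul_jac
  refine ⟨?_, ?_, ?_, ?_⟩
  · intro h0
    rw [h0, zero_mul] at h1
    exact hM.c_ne_zero h1.symm
  · apply mul_right_cancel₀ hg.ne'
    linear_combination (x + x') * h1 + v1 + h2
  · apply mul_right_cancel₀ hg.ne'
    linear_combination (x * x') * h1 + v2 - h3
  · -- `c (x - x')` is the difference of the eigenvalues of `M`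
    have e : (Q.A : ℝ) * (x - x') * g = jac M x - jac M x' := by
      unfold jac
      linear_combination (x - x') * h1
    have h4 := hM.one_lt
    have h5 : 0 < jac M x - jac M x' := by nlinarith
    rw [← e] at h5
    exact (pos_iff_pos_of_mul_pos h5).2 hg

theorem IsFormPair.conjRoot_eq {Q : BQF p} (h : IsFormPair Q x x') : Q.conjRoot = x' := by
  obtain ⟨h0, h1, h2, h3⟩ := h.vieta
  have hD : Q.disc = ((Q.A : ℝ) * (x - x')) ^ 2 := by
    unfold BQF.disc
    linear_combination ((Q.B : ℝ) - (Q.A : ℝ) * (x + x')) * h1 + 4 * (Q.A : ℝ) * h2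
  unfold BQF.conjRoot
  rw [hD, Real.sqrt_sq h3.le, div_eq_iff (by simpa using h0)]
  linear_combination -h1

theorem IsFormPair.isSimple_iff {Q : BQF p} (h : IsFormPair Q x x') :
    Q.IsSimple ↔ x' < 0 ∧ 0 < x := by
  obtain ⟨h0, h1, h2, h3⟩ := h.vieta
  unfold BQF.IsSimple
  constructor
  · rintro ⟨hA, hC⟩
    have h4 : x' < x := by
      have := (pos_iff_pos_of_mul_pos h3).1 hA
      linarith
    have h5 : x * x' < 0 := by
      by_contra hc
      have := mul_nonneg hA.le (not_lt.1 hc)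
      linarith
    rcases mul_neg_iff.1 h5 with h | h
    · exact ⟨h.2, h.1⟩
    · exfalso; linarith
  · rintro ⟨hx', hx⟩
    have hA : 0 < (Q.A : ℝ) := (pos_iff_pos_of_mul_pos h3).2 (by linarith)
    exact ⟨hA, by rw [← h2]; exact mul_neg_of_pos_of_neg hA (mul_neg_of_pos_of_neg hx hx')⟩

/-- A form determines the number it is associated with. -/
theorem IsFormPair.first_root_unique {Q : BQF p} (h : IsFormPair Q x x')
    (h' : IsFormPair Q y y') : x = y := by
  have e : x' = y' := h.conjRoot_eq.symm.trans h'.conjRoot_eq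
  obtain ⟨h0, h1, -⟩ := h.vieta
  obtain ⟨-, h2, -⟩ := h'.vieta
  have := mul_left_cancel₀ h0 (h1.trans h2.symm)
  linarith

/-- Dividing `[c, d - a, -b]` by the normalizing factor of `(c, d - a, -b)` gives a form, primitive
if `ℤ[λ_p]` is a principal ideal domain. -/
theorem FixedPair.exists_isFormPair (h : FixedPair p M x x') : ∃ Q : BQF p, IsFormPair Q x x' := by
  obtain ⟨u, v, w, hu, hv, hw⟩ := exists_coefs h.gen.mem
  have hI := coefIdeal_eq hu hv hw
  set g := normFactor p (coefIdeal p M) with hg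
  have hgpos : 0 < g := normFactor_pos _
  have hD : 0 < (v : ℝ) ^ 2 - 4 * u * w := by
    obtain ⟨v1, v2⟩ := h.vieta
    have e : (v : ℝ) ^ 2 - 4 * u * w = (M 1 0 * (x - x')) ^ 2 := by
      rw [hu, hv, hw]
      linear_combination (M 0 0 - M 1 1 + M 1 0 * (x + x')) * v1 * (-1) + 4 * M 1 0 * v2
    rw [e]
    exact sq_pos_iff.2 (mul_ne_zero h.c_ne_zero (sub_ne_zero.2 h.ne))
  have hu0 : u ≠ 0 := by
    rintro rfl
    exact h.c_ne_zero (by rw [← hu]; simp)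
  by_cases hP : IsPrincipalIdealRing (LamRing p)
  · -- a generator of the ideal, made positive by a change of sign
    obtain ⟨g₁, hg₁⟩ : ∃ g₁ : LamRing p, coefIdeal p M = Ideal.span {g₁} :=
      (hP.principal (coefIdeal p M)).principal
    have hg10 : g₁ ≠ 0 := by
      rintro rfl
      rw [Ideal.span_singleton_zero] at hg₁
      have : u ∈ coefIdeal p M := Ideal.subset_span (Or.inl hu)
      rw [hg₁] at this
      exact hu0 (by simpa using this)
    have hex : ∃ g : LamRing p, 0 < (g : ℝ) ∧ coefIdeal p M = Ideal.span {g} := by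
      rcases lt_or_gt_of_ne (show (g₁ : ℝ) ≠ 0 by simpa using hg10) with hlt | hgt
      · exact ⟨-g₁, by push_cast; linarith, by rw [Ideal.span_singleton_neg, hg₁]⟩
      · exact ⟨g₁, hgt, hg₁⟩
    obtain ⟨G, hG, hGI⟩ : ∃ G : LamRing p, (G : ℝ) = g ∧ coefIdeal p M = Ideal.span {G} := by
      have hh : IsPrincipalIdealRing (LamRing p) ∧
          ∃ g : LamRing p, 0 < (g : ℝ) ∧ coefIdeal p M = Ideal.span {g} := ⟨hP, hex⟩
      refine ⟨Classical.choose hh.2, ?_, (Classical.choose_spec hh.2).2⟩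
      rw [hg]
      unfold normFactor
      rw [dif_pos hh]
    have hdvd : ∀ t ∈ coefIdeal p M, ∃ s, t = G * s := by
      intro t ht
      rw [hGI] at ht
      exact Ideal.mem_span_singleton.1 ht
    obtain ⟨a, ha⟩ := hdvd u (Ideal.subset_span (Or.inl hu))
    obtain ⟨b, hb⟩ := hdvd v (Ideal.subset_span (Or.inr (Or.inl hv)))
    obtain ⟨c, hc⟩ := hdvd w (Ideal.subset_span (Or.inr (Or.inr hw)))
    have hG0 : G ≠ 0 := by
      rintro rfl
      rw [← hG] at hgpos
      simp at hgpos
    have hprim : Ideal.span {a} ⊔ Ideal.span {b} ⊔ Ideal.span {c} = (⊤ : Ideal (LamRing p)) := by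
      have h1 : Ideal.span {G} * (Ideal.span {a} ⊔ Ideal.span {b} ⊔ Ideal.span {c})
          = Ideal.span {G} * ⊤ := by
        rw [Ideal.mul_sup, Ideal.mul_sup, Ideal.span_singleton_mul_span_singleton,
          Ideal.span_singleton_mul_span_singleton, Ideal.span_singleton_mul_span_singleton,
          ← ha, ← hb, ← hc, hI, hGI, Ideal.mul_top]
      exact (Ideal.span_singleton_mul_right_inj hG0).1 h1
    have ha' : (u : ℝ) = g * a := by rw [ha, ← hG]; push_cast; rfl
    have hb' : (v : ℝ) = g * b := by rw [hb, ← hG]; push_cast; rfl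
    have hc' : (w : ℝ) = g * c := by rw [hc, ← hG]; push_cast; rfl
    refine ⟨⟨a, b, c, ?_, fun _ => hprim⟩, M, h, ?_, ?_, ?_⟩
    · rw [ha', hb', hc'] at hD
      have : 0 < g ^ 2 * ((b : ℝ) ^ 2 - 4 * a * c) := by linarith
      exact (pos_iff_pos_of_mul_pos this).1 (by positivity)
    · change (a : ℝ) * g = _
      linarith
    · change (b : ℝ) * g = _
      linarith
    · change (c : ℝ) * g = _
      linarith
  · have hg1 : g = 1 := by
      rw [hg]
      unfold normFactor
      rw [dif_neg fun hh => hP hh.1]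
    refine ⟨⟨u, v, w, hD, fun hh => absurd hh hP⟩, M, h, ?_, ?_, ?_⟩
    · rw [← hg, hg1, mul_one, hu]
    · rw [← hg, hg1, mul_one, hv]
    · rw [← hg, hg1, mul_one, hw]

theorem IsFormPair.unique {Q Q' : BQF p} (h : IsFormPair Q x x') (h' : IsFormPair Q' x y') :
    Q = Q' ∧ x' = y' := by
  obtain ⟨M, hM, h1, h2, h3⟩ := h
  obtain ⟨N, hN, k1, k2, k3⟩ := h'
  obtain ⟨rfl, rfl⟩ := hM.unique hN
  have hg := (normFactor_pos (coefIdeal p M)).ne'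
  refine ⟨BQF.ext (Subtype.ext ?_) (Subtype.ext ?_) (Subtype.ext ?_), rfl⟩
  · exact mul_right_cancel₀ hg (h1.trans k1.symm)
  · exact mul_right_cancel₀ hg (h2.trans k2.symm)
  · exact mul_right_cancel₀ hg (h3.trans k3.symm)

theorem IsFormPair.isFormOf {Q : BQF p} (h : IsFormPair Q x x') : IsFormOf Q x := by
  obtain ⟨M, hM, h1, h2, h3⟩ := h
  obtain ⟨u, v, w, hu, hv, hw⟩ := exists_coefs hM.gen.mem
  refine ⟨M, hM.gen, u, v, w, hu, hv, hw, ?_⟩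
  rw [coefIdeal_eq hu hv hw]
  have hg := (normFactor_pos (coefIdeal p M)).ne'
  set g := normFactor p (coefIdeal p M)
  left
  have hj := hM.one_lt
  have hj0 : 0 < jac M x := by linarith
  have hinv : (jac M x)⁻¹ < 1 := inv_lt_one_of_one_lt₀ hj
  have hs : √((M 0 0 + M 1 1) ^ 2 - 4) = jac M x - (jac M x)⁻¹ := by
    rw [Real.sqrt_eq_iff_eq_sq _ (by linarith), trace_eq hM.gen.sends]
    · field_simp
      ring
    · rw [trace_eq hM.gen.sends]
      have : (jac M x + (jac M x)⁻¹) ^ 2 - 4 = (jac M x - (jac M x)⁻¹) ^ 2 := by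
        field_simp
        ring
      rw [this]
      positivity
  have hc := hM.c_ne_zero
  refine ⟨?_, ?_, ?_, ?_⟩
  · rw [hs, eq_div_iff (by simpa using hc)]
    have ht := trace_eq hM.gen.sends
    unfold jac at *
    linarith
  · rw [hu, ← h1]; field_simp
  · rw [hv, ← h2]; field_simp
  · rw [hw, ← h3]; field_simp

theorem exists_isFormPair_of_generator {Q : BQF p} (hM : IsStabilizerGenerator p M x)
    (hc : M 1 0 ≠ 0) (hj : 1 < jac M x)
    (hA : (Q.A : ℝ) * normFactor p (coefIdeal p M) = M 1 0)
    (hB : (Q.B : ℝ) * normFactor p (coefIdeal p M) = M 1 1 - M 0 0)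
    (hC : (Q.C : ℝ) * normFactor p (coefIdeal p M) = -M 0 1) : ∃ x', IsFormPair Q x x' := by
  refine ⟨(M 0 0 - M 1 1) / M 1 0 - x, M, ⟨hM, fixes_iff.1 ?_, ?_, hj⟩, hA, hB, hC⟩
  · have h := hM.sends.2
    unfold Fixes
    field_simp
    linear_combination M 1 0 * h
  · intro h
    have ht := trace_eq hM.sends
    have hinv : (jac M x)⁻¹ < 1 := inv_lt_one_of_one_lt₀ hj
    have h1 : x + x = (M 0 0 - M 1 1) / M 1 0 := by linarith
    rw [eq_div_iff hc] at h1
    unfold jac at *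
    linarith

/-- A matrix with `c = 0` does not generate the stabilizer of `0`, which contains a parabolic
element. -/
theorem IsStabilizerGenerator.c_ne_zero_of_zero (hp : 3 ≤ p) (hM : IsStabilizerGenerator p M 0) :
    M 1 0 ≠ 0 := by
  intro hc
  have hs : Sends (posR p (p - 1)) 0 0 := by
    obtain ⟨m, rfl⟩ : ∃ m, p = m + 2 := ⟨p - 2, by omega⟩
    obtain ⟨e1, e2, e3, e4⟩ := posR_apply hp m
    have h0 := one_le_sinRatio hp (n := m + 1) (by omega) (by omega)
    simp only [Sends, show m + 2 - 1 = m + 1 by omega, e1, e2, e3, e4,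
      sinRatio_self hp]
    exact ⟨by intro h; linarith, by ring⟩
  have hr : posR p (p - 1) 1 0 ≠ 0 := by
    obtain ⟨m, rfl⟩ : ∃ m, p = m + 2 := ⟨p - 2, by omega⟩
    obtain ⟨e1, e2, e3, e4⟩ := posR_apply hp m
    have h0 := one_le_sinRatio hp (n := m) (by omega) (by omega)
    rw [show m + 2 - 1 = m + 1 by omega, e3]
    intro h; linarith
  obtain ⟨n, hn⟩ := hM.generates _ (posR_mem (p - 1)) (fixes_iff.2 hs)
  have e := congrArg (fun A : Matrix.SpecialLinearGroup (Fin 2) ℝ => A 1 0)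
    (commute_of_eq_pow hn).eq
  simp only [mul_apply_two, hc, zero_mul, mul_zero, add_zero, zero_add] at e
  have h1 : M 1 1 = M 0 0 := by
    apply mul_right_cancel₀ hr
    linarith
  have hd := det_eq M
  have hh := hM.hyperbolic
  rw [hc, h1] at hd
  rw [h1] at hh
  rcases abs_cases (M 0 0 + M 0 0) with ⟨h, -⟩ | ⟨h, -⟩ <;> nlinarith

/-- The form associated with `x` arises from the generator, among `±M` and `±M⁻¹`, whose eigenvalue
at `(x, 1)` exceeds `1`: which one it is depends on the sign of the trace of `M` and on the sign of
the square root in the formula for `x`. -/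
theorem IsFormOf.exists_isFormPair (hp : 3 ≤ p) {Q : BQF p} (h : IsFormOf Q x) :
    ∃ x', IsFormPair Q x x' := by
  obtain ⟨M, hM, u, v, w, hu, hv, hw, h⟩ := h
  rw [coefIdeal_eq hu hv hw] at h
  have hc : M 1 0 ≠ 0 := by
    intro hc
    -- division by `2 c = 0` makes `x` equal to `0`
    have hx : x = 0 := by rcases h with ⟨h, -⟩ | ⟨h, -⟩ <;> simpa [hc] using h
    subst hx
    exact hM.c_ne_zero_of_zero hp hc
  have hg := (normFactor_pos (coefIdeal p M)).ne'
  simp only at h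
  set g := normFactor p (coefIdeal p M)
  set s := √((M 0 0 + M 1 1) ^ 2 - 4) with hs
  have ht := hM.hyperbolic
  have ht2 : 0 < (M 0 0 + M 1 1) ^ 2 - 4 := by
    rcases abs_cases (M 0 0 + M 1 1) with ⟨h, -⟩ | ⟨h, -⟩ <;> nlinarith
  have hs2 : s ^ 2 = (M 0 0 + M 1 1) ^ 2 - 4 := Real.sq_sqrt ht2.le
  have hs0 : 0 < s := Real.sqrt_pos.2 ht2
  have hj0 : jac M x ≠ 0 := hM.sends.1
  have hji : jac M⁻¹ x = (jac M x)⁻¹ := eq_inv_of_mul_eq_one_left (jac_inv hM.sends)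
  obtain ⟨e1, e2, e3, e4⟩ := inv_apply_SL M
  have ht' : 2 < M 0 0 + M 1 1 ∨ M 0 0 + M 1 1 < -2 := by
    rcases lt_abs.1 ht with h | h
    · exact Or.inl h
    · right; linarith
  rcases h with ⟨hx, hA, hB, hC⟩ | ⟨hx, hA, hB, hC⟩
  · have hj : 2 * jac M x = M 0 0 + M 1 1 + s := by
      rw [eq_div_iff (by simpa using hc)] at hx
      unfold jac
      linarith
    replace hA : (Q.A : ℝ) * normFactor p (coefIdeal p M) = (M 1 0) := by
      change _ * g = _
      rw [hA, hu]; field_simp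
    replace hB : (Q.B : ℝ) * normFactor p (coefIdeal p M) = (M 1 1 - M 0 0) := by
      change _ * g = _
      rw [hB, hv]; field_simp
    replace hC : (Q.C : ℝ) * normFactor p (coefIdeal p M) = (-M 0 1) := by
      change _ * g = _
      rw [hC, hw]; field_simp
    rcases ht' with ht' | ht'
    · exact exists_isFormPair_of_generator hM hc (by linarith)
        hA hB hC
    · have h1 : -jac M x < 1 := by nlinarith
      have h2 : 0 < -jac M x := by nlinarith
      refine exists_isFormPair_of_generator (M := -M⁻¹) hM.inv.neg ?_ ?_ ?_ ?_ ?_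
      · rw [neg_apply_SL, e3, neg_neg]; exact hc
      · rw [jac_neg, hji, ← inv_neg]
        exact (one_lt_inv₀ h2).2 h1
      · rw [coefIdeal_neg, coefIdeal_inv, neg_apply_SL, e3, hA]; ring
      · rw [coefIdeal_neg, coefIdeal_inv, neg_apply_SL, neg_apply_SL, e1, e4, hB]; ring
      · rw [coefIdeal_neg, coefIdeal_inv, neg_apply_SL, e2, hC]; ring
  · have hj : 2 * jac M x = M 0 0 + M 1 1 - s := by
      rw [eq_div_iff (by simpa using hc)] at hx
      unfold jac
      linarith
    replace hA : (Q.A : ℝ) * normFactor p (coefIdeal p M) = -(M 1 0) := by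
      change _ * g = _
      rw [hA, hu]; field_simp
    replace hB : (Q.B : ℝ) * normFactor p (coefIdeal p M) = -(M 1 1 - M 0 0) := by
      change _ * g = _
      rw [hB, hv]; field_simp
    replace hC : (Q.C : ℝ) * normFactor p (coefIdeal p M) = -(-M 0 1) := by
      change _ * g = _
      rw [hC, hw]; field_simp
    rcases ht' with ht' | ht'
    · have h1 : jac M x < 1 := by nlinarith
      have h2 : 0 < jac M x := by nlinarith
      refine exists_isFormPair_of_generator (M := M⁻¹) hM.inv ?_ ?_ ?_ ?_ ?_
      · rw [e3]; exact neg_ne_zero.2 hc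
      · rw [hji]
        exact (one_lt_inv₀ h2).2 h1
      · rw [coefIdeal_inv, e3, hA]
      · rw [coefIdeal_inv, e1, e4, hB]; ring
      · rw [coefIdeal_inv, e2, hC]
    · refine exists_isFormPair_of_generator (M := -M) hM.neg ?_ ?_ ?_ ?_ ?_
      · rw [neg_apply_SL]; exact neg_ne_zero.2 hc
      · rw [jac_neg]; linarith
      · rw [coefIdeal_neg, neg_apply_SL, hA]
      · rw [coefIdeal_neg, neg_apply_SL, neg_apply_SL, hB]; ring
      · rw [coefIdeal_neg, neg_apply_SL, hC]

theorem IsFormPair.heckeConj_eq (hp : 3 ≤ p) {Q : BQF p} (h : IsFormPair Q x x') :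
    heckeConj p x = x' := by
  have hex : ∃ Q : BQF p, IsFormOf Q x := ⟨Q, h.isFormOf⟩
  unfold heckeConj
  rw [dif_pos hex]
  obtain ⟨y, hy⟩ := (Classical.choose_spec hex).exists_isFormPair hp
  rw [hy.conjRoot_eq, (hy.unique h).2]

/-! ### Equivalence of forms -/

/-- `Q'(V(u, v)) = Q(u, v)`: the form `Q'` is the image of `Q` under `V`, so that the roots of `Q'`
are the images of the roots of `Q`. -/
def Carries (V : Matrix.SpecialLinearGroup (Fin 2) ℝ) (Q Q' : BQF p) : Prop :=
  ∀ u v : ℝ, Q'.val (V 0 0 * u + V 0 1 * v) (V 1 0 * u + V 1 1 * v) = Q.val u v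

theorem BQF.ext_of_val {Q Q' : BQF p} (h : ∀ u v, Q.val u v = Q'.val u v) : Q = Q' := by
  have h1 := h 1 0
  have h2 := h 0 1
  have h3 := h 1 1
  simp only [BQF.val] at h1 h2 h3
  refine BQF.ext (Subtype.ext ?_) (Subtype.ext ?_) (Subtype.ext ?_) <;> linarith

theorem BQF.val_neg (Q : BQF p) (u v : ℝ) : (-Q).val u v = -Q.val u v := by
  change ((-Q.A : LamRing p) : ℝ) * u ^ 2 + ((-Q.B : LamRing p) : ℝ) * u * v
    + ((-Q.C : LamRing p) : ℝ) * v ^ 2 = _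
  unfold BQF.val
  push_cast
  ring

theorem BQF.neg_neg (Q : BQF p) : -(-Q) = Q :=
  BQF.ext_of_val fun u v => by rw [BQF.val_neg, BQF.val_neg, _root_.neg_neg]

theorem Carries.neg {Q Q' : BQF p} (h : Carries V Q Q') : Carries V (-Q) (-Q') := by
  intro u v
  rw [BQF.val_neg, BQF.val_neg, h]

theorem Carries.inv {Q Q' : BQF p} (h : Carries V Q Q') : Carries V⁻¹ Q' Q := by
  intro u v
  obtain ⟨e1, e2, e3, e4⟩ := inv_apply_SL V
  have hd := det_eq V
  rw [e1, e2, e3, e4, ← h]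
  congr 1
  · linear_combination u * hd
  · linear_combination v * hd

theorem Carries.comp {Q Q' Q'' : BQF p} (h : Carries V Q' Q'') (h' : Carries N Q Q') :
    Carries (V * N) Q Q'' := by
  intro u v
  rw [← h', ← h]
  simp only [mul_apply_two]
  congr 1 <;> ring

theorem Carries.unique {Q Q₁ Q₂ : BQF p} (h₁ : Carries V Q Q₁) (h₂ : Carries V Q Q₂) :
    Q₁ = Q₂ :=
  BQF.ext_of_val fun u v => by rw [← h₁.inv u v, ← h₂.inv u v]

theorem equivalent_iff {Q Q' : BQF p} :
    BQF.Equivalent Q Q' ↔ ∃ V ∈ heckeGroup p, Carries V Q Q' := by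
  constructor
  · rintro ⟨V, hV, h⟩
    refine ⟨V⁻¹, inv_mem hV, Carries.inv ?_⟩
    exact fun u v => (h u v).symm
  · rintro ⟨V, hV, h⟩
    exact ⟨V⁻¹, inv_mem hV, fun u v => (h.inv u v).symm⟩

theorem BQF.eqvClass_eq {Q Q' : BQF p} (h : Q' ∈ Q.eqvClass) : Q'.eqvClass = Q.eqvClass := by
  obtain ⟨V, hV, h⟩ := equivalent_iff.1 h
  ext Q''
  change Q'.Equivalent Q'' ↔ Q.Equivalent Q''
  rw [equivalent_iff, equivalent_iff]
  constructor
  · rintro ⟨N, hN, h'⟩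
    exact ⟨N * V, mul_mem hN hV, h'.comp h⟩
  · rintro ⟨N, hN, h'⟩
    exact ⟨N * V⁻¹, mul_mem hN (inv_mem hV), h'.comp h.inv⟩

/-- The association of forms with numbers is equivariant. -/
theorem IsFormPair.carry {Q : BQF p} (h : IsFormPair Q x x') (hV : V ∈ heckeGroup p)
    (hxy : Sends V x y) (hxy' : Sends V x' y') :
    ∃ Q' : BQF p, IsFormPair Q' y y' ∧ Carries V Q Q' := by
  obtain ⟨M, hM, h1, h2, h3⟩ := h
  have hM' := hM.conj hV hxy hxy'
  obtain ⟨Q', hQ'⟩ := hM'.exists_isFormPair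
  refine ⟨Q', hQ', fun u v => ?_⟩
  obtain ⟨M', hM'', k1, k2, k3⟩ := hQ'
  obtain ⟨rfl, -⟩ := hM''.unique hM'
  rw [coefIdeal_conj hM.gen.mem hV] at k1 k2 k3
  have hg := (normFactor_pos (coefIdeal p M)).ne'
  set g := normFactor p (coefIdeal p M)
  apply mul_right_cancel₀ hg
  have hd := det_eq V
  obtain ⟨e1, e2, e3, e4⟩ := inv_apply_SL V
  simp only [mul_apply_two, e1, e2, e3, e4] at k1 k2 k3
  unfold BQF.val
  set X := V 0 0 * u + V 0 1 * v with hX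
  set Y := V 1 0 * u + V 1 1 * v with hY
  have e5 : (Q'.A * X ^ 2 + Q'.B * X * Y + Q'.C * Y ^ 2) * g
      = (Q'.A * g) * X ^ 2 + (Q'.B * g) * X * Y + (Q'.C * g) * Y ^ 2 := by ring
  have e6 : (Q.A * u ^ 2 + Q.B * u * v + Q.C * v ^ 2) * g
      = (Q.A * g) * u ^ 2 + (Q.B * g) * u * v + (Q.C * g) * v ^ 2 := by ring
  rw [e5, e6, k1, k2, k3, h1, h2, h3, hX, hY]
  linear_combination (V 0 0 * V 1 1 - V 0 1 * V 1 0 + 1)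
    * (M 1 0 * u ^ 2 + (M 1 1 - M 0 0) * u * v - M 0 1 * v ^ 2) * hd

/-- The form associated with the conjugate of `x` is the negative of the form of `x`. -/
theorem IsFormPair.swap (hp : 3 ≤ p) {Q : BQF p} (hx : ∃ l, FixedBy p l x)
    (h : IsFormPair Q x x') : IsFormPair (-Q) x' x := by
  obtain ⟨M, hM, h1, h2, h3⟩ := h
  obtain ⟨e1, e2, e3, e4⟩ := inv_apply_SL M
  refine ⟨M⁻¹, hM.swap hp hx, ?_, ?_, ?_⟩
  · rw [coefIdeal_inv, e3, ← h1]
    change ((-Q.A : LamRing p) : ℝ) * _ = _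
    push_cast; ring
  · rw [coefIdeal_inv, e1, e4, ← neg_sub, ← h2]
    change ((-Q.B : LamRing p) : ℝ) * _ = _
    push_cast; ring
  · rw [coefIdeal_inv, e2, neg_neg, ← neg_eq_iff_eq_neg.2 h3]
    change ((-Q.C : LamRing p) : ℝ) * _ = _
    push_cast; ring

theorem exists_isFormPair_of_fixedBy (hp : 3 ≤ p) (hx : ∃ l, FixedBy p l x) :
    ∃ (Q : BQF p) (x' : ℝ), IsFormPair Q x x' ∧ x' < 0 := by
  obtain ⟨M, x', hM, hx'⟩ := FixedBy.exists_fixedPair hp hx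
  obtain ⟨Q, hQ⟩ := hM.exists_isFormPair
  exact ⟨Q, x', hQ, hx'⟩

/-- All forms equivalent to the form of a positive number fixed by a word are forms of numbers. -/
theorem exists_isFormPair_of_mem_eqvClass (hp : 3 ≤ p) {Q Q' : BQF p} (hx : ∃ l, FixedBy p l x)
    (h : IsFormPair Q x x') (hQ' : Q' ∈ Q.eqvClass) :
    ∃ V ∈ heckeGroup p, ∃ y y', Sends V x y ∧ Sends V x' y' ∧ IsFormPair Q' y y' ∧
      Carries V Q Q' := by
  obtain ⟨V, hV, hVQ⟩ := equivalent_iff.1 hQ'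
  obtain ⟨M, hM, -⟩ := id h
  obtain ⟨y, y', hy, hy'⟩ := orbit_finite_of_fixedPair hp hx hM hV
  obtain ⟨Q'', h'', hV''⟩ := h.carry hV hy hy'
  exact ⟨V, hV, y, y', hy, hy', (hV''.unique hVQ) ▸ h'', hVQ⟩

/-- `Z_𝒜` consists of the images of `x` under the elements of the Hecke group that separate `x`
from `x'` by the origin, with `x` on the positive side. -/
theorem mem_simpleNumbers_iff (hp : 3 ≤ p) {Q : BQF p} (hx : ∃ l, FixedBy p l x)
    (h : IsFormPair Q x x') :
    y ∈ simpleNumbers Q.eqvClass ↔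
      ∃ V ∈ heckeGroup p, ∃ y', Sends V x y ∧ Sends V x' y' ∧ y' < 0 ∧ 0 < y := by
  constructor
  · rintro ⟨Q', hQ', hmem, hs⟩
    obtain ⟨V, hV, z, z', hz, hz', hform, -⟩ := exists_isFormPair_of_mem_eqvClass hp hx h hmem
    obtain ⟨y', hy'⟩ := hQ'.exists_isFormPair hp
    obtain rfl := hform.first_root_unique hy'
    exact ⟨V, hV, z', hz, hz', hform.isSimple_iff.1 hs⟩
  · rintro ⟨V, hV, y', hy, hy', hs⟩
    obtain ⟨Q', hQ', hVQ⟩ := h.carry hV hy hy'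
    exact ⟨Q', hQ'.isFormOf, equivalent_iff.2 ⟨V, hV, hVQ⟩, hQ'.isSimple_iff.2 hs⟩

/-- The numbers of `Z_{-𝒜}` are the numbers `-1 / x'` with `x` in `Z_𝒜`, and the conjugate of
`-1 / x'` is `-1 / x`. -/
theorem mem_simpleNumbers_negClass (hp : 3 ≤ p) {Q : BQF p} (hx : ∃ l, FixedBy p l x)
    (h : IsFormPair Q x x') :
    (∀ y ∈ simpleNumbers (negClass Q.eqvClass), ∃ z ∈ simpleNumbers Q.eqvClass,
      y = -1 / heckeConj p z) ∧
    ∀ z ∈ simpleNumbers Q.eqvClass, -1 / heckeConj p z ∈ simpleNumbers (negClass Q.eqvClass) ∧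
      heckeConj p (-1 / heckeConj p z) = -1 / z := by
  have hsw := h.swap hp hx
  constructor
  · rintro y ⟨Qy, hQy, ⟨Q', hQ', rfl⟩, hs⟩
    simp only at hQy hs
    obtain ⟨V, hV, z, z', hz, hz', hform, hVQ⟩ := exists_isFormPair_of_mem_eqvClass hp hx h hQ'
    obtain ⟨Q'', h'', hV''⟩ := hsw.carry hV hz' hz
    obtain rfl := hV''.unique hVQ.neg
    obtain ⟨y', hy'⟩ := hQy.exists_isFormPair hp
    obtain rfl := h''.first_root_unique hy'
    obtain ⟨hz0, hz0'⟩ := h''.isSimple_iff.1 hs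
    have h1 := (sends_matT hz0.ne).comp hz
    have h2 := (sends_matT hz0'.ne').comp hz'
    have h3 : 0 < -1 / z := div_pos_of_neg_of_neg (by norm_num) hz0
    have h4 : -1 / z' < 0 := div_neg_of_neg_of_pos (by norm_num) hz0'
    refine ⟨-1 / z, (mem_simpleNumbers_iff hp hx h).2
      ⟨_, mul_mem matT_mem hV, _, h1, h2, h4, h3⟩, ?_⟩
    obtain ⟨Q₃, hQ₃, -⟩ := h.carry (mul_mem matT_mem hV) h1 h2
    rw [hQ₃.heckeConj_eq hp]
    field_simp
  · intro z hz
    obtain ⟨V, hV, z', hz, hz', hz0', hz0⟩ := (mem_simpleNumbers_iff hp hx h).1 hz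
    obtain ⟨Q₃, hQ₃, -⟩ := h.carry hV hz hz'
    rw [hQ₃.heckeConj_eq hp]
    have hTV := mul_mem matT_mem hV
    have h1 := (sends_matT hz0.ne').comp hz
    have h2 := (sends_matT hz0'.ne).comp hz'
    have h3 : 0 < -1 / z' := div_pos_of_neg_of_neg (by norm_num) hz0'
    have h4 : -1 / z < 0 := div_neg_of_neg_of_pos (by norm_num) hz0
    obtain ⟨Q', hQ', hVQ⟩ := hsw.carry hTV h2 h1
    refine ⟨⟨Q', hQ'.isFormOf, ⟨-Q', ?_, Q'.neg_neg⟩, hQ'.isSimple_iff.2 ⟨h4, h3⟩⟩,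
      hQ'.heckeConj_eq hp⟩
    have := hVQ.neg
    rw [Q.neg_neg] at this
    exact equivalent_iff.2 ⟨_, hTV, this⟩

end Forms

/-! ### The poles of a rational period function -/

section Poles

theorem finite_poles (f : RatFunc ℂ) : {z : ℂ | IsPole f z}.Finite := by
  have h : {z : ℂ | IsPole f z} ⊆ (f.denom.roots.toFinset : Set ℂ) := by
    intro z hz
    simp only [Finset.mem_coe, Multiset.mem_toFinset]
    exact (Polynomial.mem_roots (RatFunc.denom_ne_zero f)).2 hz
  exact (Finset.finite_toSet _).subset h

variable {V N : Matrix.SpecialLinearGroup (Fin 2) ℝ} {z w u : ℂ}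

theorem exists_sendsC (V : Matrix.SpecialLinearGroup (Fin 2) ℝ) (hz : z.im ≠ 0) :
    ∃ w, SendsC V z w := by
  have h : (V 1 0 : ℂ) * z + V 1 1 ≠ 0 := by
    intro h
    have h1 := congrArg Complex.im h
    have h2 := congrArg Complex.re h
    simp at h1 h2
    have h3 : V 1 0 = 0 := h1.resolve_right hz
    have hd := det_eq V
    rw [h3] at h2 hd
    simp at h2
    rw [h2] at hd
    simp at hd
  exact ⟨_, h, (div_mul_cancel₀ _ h).symm⟩

theorem SendsC.comp (hM : SendsC V w u) (hN : SendsC N z w) : SendsC (V * N) z u := by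
  obtain ⟨h1, h2⟩ := hM
  obtain ⟨h3, h4⟩ := hN
  have e : ((V * N) 1 0 : ℂ) * z + (V * N) 1 1
      = ((V 1 0 : ℂ) * w + V 1 1) * ((N 1 0 : ℂ) * z + N 1 1) := by
    simp only [mul_apply_two]
    push_cast
    linear_combination (V 1 0 : ℂ) * h4
  refine ⟨by rw [e]; exact mul_ne_zero h1 h3, ?_⟩
  rw [e]
  simp only [mul_apply_two]
  push_cast
  linear_combination (V 0 0 : ℂ) * h4 + ((N 1 0 : ℂ) * z + N 1 1) * h2

theorem SendsC.unique {w' : ℂ} (h : SendsC V z w) (h' : SendsC V z w') : w = w' :=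
  mul_right_cancel₀ h.1 (h.2.symm.trans h'.2)

theorem SendsC.im_mul (h : SendsC V z w) :
    w.im * Complex.normSq ((V 1 0 : ℂ) * z + V 1 1) = z.im := by
  have hd := det_eq V
  have h1 := congrArg Complex.re h.2
  have h2 := congrArg Complex.im h.2
  simp at h1 h2
  rw [Complex.normSq_apply]
  simp
  linear_combination (-(V 1 0 * z.re + V 1 1)) * h2 + (V 1 0 * z.im) * h1 + z.im * hd

theorem SendsC.re_mul (h : SendsC V z w) :
    w.re * Complex.normSq ((V 1 0 : ℂ) * z + V 1 1)
      = V 0 0 * V 1 0 * Complex.normSq z + (V 0 0 * V 1 1 + V 0 1 * V 1 0) * z.re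
        + V 0 1 * V 1 1 := by
  have h1 := congrArg Complex.re h.2
  have h2 := congrArg Complex.im h.2
  simp at h1 h2
  rw [Complex.normSq_apply, Complex.normSq_apply]
  simp
  linear_combination (-(V 1 0 * z.re + V 1 1)) * h1 - (V 1 0 * z.im) * h2

theorem SendsC.normSq_mul (h : SendsC V z w) :
    Complex.normSq w * Complex.normSq ((V 1 0 : ℂ) * z + V 1 1)
      = Complex.normSq ((V 0 0 : ℂ) * z + V 0 1) := by
  rw [h.2, map_mul]

theorem SendsC.im_ne_zero (h : SendsC V z w) (hz : z.im ≠ 0) : w.im ≠ 0 := by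
  intro h0
  have := h.im_mul
  rw [h0, zero_mul] at this
  exact hz this.symm

variable {p k : ℕ} {q : RatFunc ℂ}

/-- The invariant form `|z| ^ 2 - λ Re z + 1` of the elliptic element `U`, divided by `|Im z|`; an
increasing function of the distance of `z` to the fixed point of `U`. -/
def ellHeight (p : ℕ) (z : ℂ) : ℝ := (Complex.normSq z - lam p * z.re + 1) / |z.im|

theorem ellHeight_matU (h : SendsC (matU p) z w) (hz : z.im ≠ 0) :
    ellHeight p w = ellHeight p z := by
  obtain ⟨e1, e2, e3, e4⟩ := matU_apply p
  have h1 := h.im_mul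
  have h2 := h.re_mul
  have h3 := h.normSq_mul
  simp only [e1, e2, e3, e4] at h1 h2 h3
  simp only [Complex.ofReal_one, Complex.ofReal_zero, one_mul, add_zero] at h1 h2 h3
  have hz0 : 0 < Complex.normSq z := Complex.normSq_pos.2 (by rintro rfl; simp at hz)
  have hw := h.im_ne_zero hz
  unfold ellHeight
  rw [div_eq_div_iff (abs_ne_zero.2 hw) (abs_ne_zero.2 hz), ← h1, abs_mul, abs_of_pos hz0]
  have h4 : Complex.normSq ((lam p : ℂ) * z + ((-1 : ℝ) : ℂ))
      = lam p ^ 2 * Complex.normSq z - 2 * lam p * z.re + 1 := by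
    rw [Complex.normSq_apply, Complex.normSq_apply]
    simp
    ring
  rw [h4] at h3
  linear_combination |w.im| * h3 - lam p * |w.im| * h2

theorem ellHeight_matU_pow (n : ℕ) (h : SendsC (matU p ^ n) z w) (hz : z.im ≠ 0) :
    ellHeight p w = ellHeight p z := by
  induction n generalizing w with
  | zero =>
    have h0 : SendsC (matU p ^ 0) z z := by simp [SendsC]
    rw [h.unique h0]
  | succ n ih =>
    obtain ⟨u, hu⟩ := exists_sendsC (matU p ^ n) hz
    obtain ⟨w', hw'⟩ := exists_sendsC (matU p) (hu.im_ne_zero hz)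
    have h' := hw'.comp hu
    rw [← pow_succ'] at h'
    rw [h.unique h', ellHeight_matU hw' (hu.im_ne_zero hz), ih hu]

theorem ellHeight_matT (hp : 3 ≤ p) (h : SendsC matT z w) (hz : z.im ≠ 0) (hre : 0 < z.re) :
    ellHeight p z < ellHeight p w := by
  obtain ⟨e1, e2, e3, e4⟩ := matT_apply
  have h1 := h.im_mul
  have h2 := h.re_mul
  have h3 := h.normSq_mul
  simp only [e1, e2, e3, e4] at h1 h2 h3
  simp only [Complex.ofReal_one, Complex.ofReal_zero, one_mul, add_zero, zero_mul, zero_add,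
    mul_one, mul_zero] at h1 h2 h3
  have hz0 : 0 < Complex.normSq z := Complex.normSq_pos.2 (by rintro rfl; simp at hz)
  have hw := h.im_ne_zero hz
  unfold ellHeight
  rw [div_lt_div_iff₀ (abs_pos.2 hz) (abs_pos.2 hw), ← h1, abs_mul, abs_of_pos hz0]
  have h4 : Complex.normSq ((-1 : ℝ) : ℂ) = 1 := by simp
  rw [h4] at h3
  have h5 : (Complex.normSq w - lam p * w.re + 1) * (|w.im| * Complex.normSq z)
      = |w.im| * (1 + lam p * z.re + Complex.normSq z) := by
    linear_combination |w.im| * h3 - lam p * |w.im| * h2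
  rw [h5, mul_comm]
  have := one_le_lam hp
  apply mul_lt_mul_of_pos_left _ (abs_pos.2 hw)
  nlinarith

theorem re_pos_of_matU_pow (hp : 3 ≤ p) {n : ℕ} (h1 : 1 ≤ n) (h2 : n < p)
    (h : SendsC (matU p ^ n) z w) (hz : z.im ≠ 0) (hre : z.re ≤ 0) : 0 < w.re := by
  obtain ⟨m, rfl⟩ : ∃ m, n = m + 1 := ⟨n - 1, by omega⟩
  obtain ⟨e1, e2, e3, e4⟩ := matU_pow_apply hp m
  have h3 := h.re_mul
  have hz0 : 0 < Complex.normSq z := Complex.normSq_pos.2 (by rintro rfl; simp at hz)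
  have hpos := Complex.normSq_pos.2 h.1
  have h4 : 0 < w.re * Complex.normSq (((matU p ^ (m + 1)) 1 0 : ℂ) * z
      + (matU p ^ (m + 1)) 1 1) := by
    rw [h3, e1, e2, e3, e4]
    have s1 := one_le_sinRatio hp h1 h2
    have s2 := sinRatio_nonneg hp (n := m) (by omega)
    have s3 := sinRatio_nonneg hp (n := m + 2) (by omega)
    have s4 := sinRatio_add_two (p := p) m
    have hl := one_le_lam hp
    have s5 : 0 < sinRatio p m + sinRatio p (m + 2) := by nlinarith
    have s6 : 0 < sinRatio p (m + 2) * Complex.normSq z + sinRatio p m := by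
      rcases s2.eq_or_lt with h | h
      · rw [← h] at s5 ⊢
        have : 0 < sinRatio p (m + 2) := by linarith
        positivity
      · positivity
    have s7 : 0 < sinRatio p (m + 1) * (sinRatio p (m + 2) * Complex.normSq z + sinRatio p m) :=
      mul_pos (by linarith) s6
    have s8 : 0 ≤ (sinRatio p (m + 2) * sinRatio p m + sinRatio p (m + 1) ^ 2) * (-z.re) :=
      mul_nonneg (by positivity) (by linarith)
    linarith
  exact (pos_iff_pos_of_mul_pos h4).2 hpos

theorem IsRPF.isPole_matT (hq : IsRPF p k q) (h : SendsC matT z w) (hz : IsPole q z) :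
    IsPole q w := by
  by_contra hw
  rw [not_isPole_iff] at hw
  have h1 : q = -slash k q matT := eq_neg_of_add_eq_zero_left hq.relT
  refine isPole_iff.1 hz ?_
  rw [h1]
  exact (hw.slash h).neg

theorem IsRPF.exists_isPole_matU (hq : IsRPF p k q)
    (h : ∀ n ∈ Finset.Ico 1 p, ∃ w, SendsC (matU p ^ n) z w) (hz : IsPole q z) :
    ∃ n ∈ Finset.Ico 1 p, ∃ w, SendsC (matU p ^ n) z w ∧ IsPole q w := by
  by_contra hc
  push Not at hc
  have h1 : q = -∑ n ∈ Finset.Ico 1 p, slash k q (matU p ^ n) :=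
    eq_neg_of_add_eq_zero_left hq.relU
  refine isPole_iff.1 hz ?_
  rw [h1]
  refine (regularAt_sum _ _ _ fun n hn => ?_).neg
  obtain ⟨w, hw⟩ := h n hn
  exact (not_isPole_iff.1 (hc n hn w hw)).slash hw

/-- All poles are real: a nonreal pole at maximal distance from the fixed point of `U` may be moved
to the right half-plane by a power of `U`, and `T` then increases the distance. -/
theorem IsRPF.im_eq_zero (hp : 3 ≤ p) (hq : IsRPF p k q) (hz : IsPole q z) : z.im = 0 := by
  by_contra hne
  have hfin : {z : ℂ | IsPole q z ∧ z.im ≠ 0}.Finite :=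
    (finite_poles q).subset fun z hz => hz.1
  obtain ⟨z₀, ⟨hz₀, him⟩, hmax⟩ := Set.exists_max_image _ (ellHeight p) hfin ⟨z, hz, hne⟩
  have key : ∀ w, IsPole q w → w.im ≠ 0 → 0 < w.re → ellHeight p w = ellHeight p z₀ → False := by
    intro w hw him hre he
    obtain ⟨u, hu⟩ := exists_sendsC matT him
    have h1 := hmax u ⟨hq.isPole_matT hu hw, hu.im_ne_zero him⟩
    have h2 := ellHeight_matT hp hu him hre
    linarith
  by_cases hre : 0 < z₀.re
  · exact key z₀ hz₀ him hre rfl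
  · obtain ⟨n, hn, w, hw, hpole⟩ := hq.exists_isPole_matU
      (fun n _ => exists_sendsC (matU p ^ n) him) hz₀
    rw [Finset.mem_Ico] at hn
    exact key w hpole (hw.im_ne_zero him)
      (re_pos_of_matU_pow hp hn.1 hn.2 hw him (not_lt.1 hre)) (ellHeight_matU_pow n hw him)

/-- Together, the two relations say that `q` is the sum of its images under the `U ^ n T`. -/
theorem IsRPF.eq_sum (hq : IsRPF p k q) : q = ∑ n ∈ Finset.Ico 1 p, slash k q (posR p n) := by
  have h1 : slash k q matT = -q := eq_neg_of_add_eq_zero_right hq.relT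
  have hsum : ∀ s : Finset ℕ, slash k (∑ n ∈ s, slash k q (matU p ^ n)) matT
      = ∑ n ∈ s, slash k q (posR p n) := by
    intro s
    rw [slash_eq, map_sum, Finset.mul_sum]
    refine Finset.sum_congr rfl fun n _ => ?_
    rw [← slash_eq, slash_slash, posR, slash_neg_matrix]
  have h2 := congrArg (fun f => slash k f matT) hq.relU
  simp only [slash_add, hsum, h1] at h2
  have h3 : slash k 0 matT = 0 := by rw [slash_eq, map_zero, mul_zero]
  rw [h3] at h2
  exact (neg_add_eq_zero.1 h2)

/-- The set of positive poles. -/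
def posPoles (q : RatFunc ℂ) : Set ℝ := {x : ℝ | 0 < x ∧ IsPole q (x : ℂ)}

theorem finite_posPoles (q : RatFunc ℂ) : (posPoles q).Finite := by
  have h := (finite_poles q).preimage (f := fun x : ℝ => (x : ℂ))
    (Complex.ofReal_injective.injOn)
  exact h.subset fun x hx => hx.2

/-- A pole of `q = ∑ q ∣ U ^ n T` at `x` comes from a pole of `q` at one of the points
`U ^ n T x`. -/
theorem IsRPF.exists_succ (hp : 3 ≤ p) (hq : IsRPF p k q) {x : ℝ} (hx : x ∈ posPoles q) :
    ∃ (n : ℕ) (y : ℝ), (1 ≤ n ∧ n < p) ∧ y ∈ posPoles q ∧ Sends (posR p n) x y := by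
  by_contra hc
  push Not at hc
  refine isPole_iff.1 hx.2 ?_
  rw [hq.eq_sum]
  refine regularAt_sum _ _ _ fun n hn => ?_
  rw [Finset.mem_Ico] at hn
  obtain ⟨y, hy, hy'⟩ := (nonnegMat_posR hp hn.1 hn.2).1.exists_sends hx.1
  have : ¬ IsPole q (y : ℂ) := fun h => hc n y hn ⟨hy, h⟩ hy'
  exact (not_isPole_iff.1 this).slash hy'.toC

/-- The positive poles are permuted by a map `σ` that moves `x` by the transformation
`U ^ n T` with `n = ν x`. -/
structure PoleDynamics (p k : ℕ) (q : RatFunc ℂ) (ν : ℝ → ℕ) (σ : ℝ → ℝ) : Prop where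
  rpf : IsRPF p k q
  valid : ∀ x ∈ posPoles q, 1 ≤ ν x ∧ ν x < p
  mapsTo : ∀ x ∈ posPoles q, σ x ∈ posPoles q
  sends : ∀ x ∈ posPoles q, Sends (posR p (ν x)) x (σ x)
  surj : ∀ y ∈ posPoles q, ∃ x ∈ posPoles q, σ x = y

/-- The chosen map on the finite set of positive poles is injective, because the images of the
positive half-line under the `U ^ n T` are disjoint; so it is a permutation. -/
theorem IsRPF.exists_poleDynamics (hp : 3 ≤ p) (hq : IsRPF p k q) :
    ∃ ν σ, PoleDynamics p k q ν σ := by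
  choose! ν σ h using fun x (hx : x ∈ posPoles q) => hq.exists_succ hp hx
  refine ⟨ν, σ, hq, fun x hx => (h x hx).1, fun x hx => (h x hx).2.1, fun x hx => (h x hx).2.2, ?_⟩
  have hinj : Set.InjOn σ (posPoles q) := by
    intro x hx y hy hxy
    have h1 := (h x hx).2.2
    have h2 := (h y hy).2.2
    rw [hxy] at h1
    exact (posR_disjoint hp (h x hx).1 (h y hy).1 hx.1 hy.1 h1 h2).2
  have hbij := ((finite_posPoles q).injOn_iff_bijOn_of_mapsTo fun x hx => (h x hx).2.1).1 hinj
  exact hbij.surjOn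

end Poles

/-! ### The dynamics on the positive poles -/

/-- The exponents met by the first `m` steps from `x`, the latest first. -/
def itinerary (ν : ℝ → ℕ) (σ : ℝ → ℝ) : ℕ → ℝ → List ℕ
  | 0, _ => []
  | m + 1, x => itinerary ν σ m (σ x) ++ [ν x]

theorem phi_slash_real {k : ℕ} {V : Matrix.SpecialLinearGroup (Fin 2) ℝ} {x x' y y' : ℝ}
    (h : Sends V x y) (h' : Sends V x' y') : slash k (phi k y y') V = phi k x x' :=
  phi_slash h.toC h'.toC

namespace PoleDynamics

variable {p k : ℕ} {q : RatFunc ℂ} {ν : ℝ → ℕ} {σ : ℝ → ℝ}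

theorem eq_of_sends (hp : 3 ≤ p) (H : PoleDynamics p k q ν σ) {x y : ℝ} {m : ℕ} (hx : 0 < x)
    (hm : 1 ≤ m ∧ m < p) (hy : y ∈ posPoles q) (h : Sends (posR p m) x y) :
    x ∈ posPoles q ∧ m = ν x := by
  obtain ⟨z, hz, rfl⟩ := H.surj y hy
  obtain ⟨h1, h2⟩ := posR_disjoint hp hm (H.valid z hz) hx hz.1 h (H.sends z hz)
  exact ⟨h2 ▸ hz, h2 ▸ h1⟩

theorem injOn (hp : 3 ≤ p) (H : PoleDynamics p k q ν σ) : Set.InjOn σ (posPoles q) := by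
  intro x hx y hy hxy
  have h1 := H.sends x hx
  rw [hxy] at h1
  exact (posR_disjoint hp (H.valid x hx) (H.valid y hy) hx.1 hy.1 h1 (H.sends y hy)).2

/-- Only one term of `q = ∑ q ∣ U ^ n T` has a pole at a positive pole `x`. -/
theorem regularAt_sub_posR (hp : 3 ≤ p) (H : PoleDynamics p k q ν σ) {x : ℝ}
    (hx : x ∈ posPoles q) : RegularAt (q - slash k q (posR p (ν x))) x := by
  have h := H.rpf.eq_sum
  rw [← Finset.add_sum_erase _ _ (Finset.mem_Ico.2 (H.valid x hx))] at h
  have h' : q - slash k q (posR p (ν x))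
      = ∑ n ∈ (Finset.Ico 1 p).erase (ν x), slash k q (posR p n) := by
    conv_lhs => lhs; rw [h]
    exact add_sub_cancel_left _ _
  rw [h']
  refine regularAt_sum _ _ _ fun n hn => ?_
  rw [Finset.mem_erase, Finset.mem_Ico] at hn
  obtain ⟨y, hy, hy'⟩ := (nonnegMat_posR hp hn.2.1 hn.2.2).1.exists_sends hx.1
  refine RegularAt.slash (not_isPole_iff.1 fun hpole => ?_) hy'.toC
  exact hn.1 (H.eq_of_sends hp hx.1 hn.2 ⟨hy, hpole⟩ hy').2

/-- Along the first `m` steps from `x`, the singular part of `q` at `x` is that of `q ∣ W`, where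
`W` is the word of the itinerary. -/
theorem iterate_spec (hp : 3 ≤ p) (H : PoleDynamics p k q ν σ) (m : ℕ) {x : ℝ}
    (hx : x ∈ posPoles q) :
    σ^[m] x ∈ posPoles q ∧ Valid p (itinerary ν σ m x) ∧
      Sends (word p (itinerary ν σ m x)) x (σ^[m] x) ∧
      RegularAt (q - slash k q (word p (itinerary ν σ m x))) x := by
  induction m generalizing x with
  | zero =>
    refine ⟨hx, by simp [Valid, itinerary], sends_one, ?_⟩
    rw [itinerary, word_nil, slash_one, sub_self]
    exact (hasVal_zero _).regularAt
  | succ m ih =>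
    obtain ⟨h1, h2, h3, h4⟩ := ih (H.mapsTo x hx)
    have hs := H.sends x hx
    have e : word p (itinerary ν σ (m + 1) x)
        = word p (itinerary ν σ m (σ x)) * posR p (ν x) := by
      rw [itinerary, word_append, word_cons, word_nil, mul_one]
    refine ⟨h1, ?_, ?_, ?_⟩
    · rw [itinerary, valid_append]
      exact ⟨h2, by simpa [Valid] using H.valid x hx⟩
    · rw [e]
      exact h3.comp hs
    · have h5 := (h4.slash (k := k) hs.toC).add (H.regularAt_sub_posR hp hx)
      rw [slash_sub, slash_slash, ← e] at h5
      convert h5 using 1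
      ring

theorem exists_period (hp : 3 ≤ p) (H : PoleDynamics p k q ν σ) {x : ℝ}
    (hx : x ∈ posPoles q) : ∃ m, σ^[m + 1] x = x := by
  obtain ⟨i, j, hij, h⟩ := (finite_posPoles q).exists_lt_map_eq_of_forall_mem
    (f := fun m : ℕ => σ^[m] x) (fun m => (H.iterate_spec hp m hx).1)
  have key : ∀ i d : ℕ, σ^[i] x = σ^[i + d] x → σ^[d] x = x := by
    intro i
    induction i with
    | zero => intro d hd; rw [zero_add] at hd; exact hd.symm
    | succ i ih =>
      intro d hd
      rw [Nat.add_right_comm, Function.iterate_succ_apply', Function.iterate_succ_apply'] at hd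
      exact ih d (H.injOn hp (H.iterate_spec hp _ hx).1 (H.iterate_spec hp _ hx).1 hd)
  refine ⟨j - i - 1, ?_⟩
  rw [show j - i - 1 + 1 = j - i by omega]
  exact key i _ (by rw [show i + (j - i) = j by omega]; exact h)

theorem exists_fixedBy (hp : 3 ≤ p) (H : PoleDynamics p k q ν σ) {x : ℝ}
    (hx : x ∈ posPoles q) :
    ∃ m, FixedBy p (itinerary ν σ (m + 1) x) x ∧
      RegularAt (q - slash k q (word p (itinerary ν σ (m + 1) x))) x := by
  obtain ⟨m, hm⟩ := H.exists_period hp hx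
  obtain ⟨-, h1, h2, h3⟩ := H.iterate_spec hp (m + 1) hx
  rw [hm] at h2
  exact ⟨m, ⟨h1, by simp [itinerary], hx.1, h2⟩, h3⟩

theorem fixedBy (hp : 3 ≤ p) (H : PoleDynamics p k q ν σ) {x : ℝ} (hx : x ∈ posPoles q) :
    ∃ l, FixedBy p l x :=
  let ⟨_, h, _⟩ := H.exists_fixedBy hp hx
  ⟨_, h⟩

theorem exists_isFormPair (hp : 3 ≤ p) (H : PoleDynamics p k q ν σ) {x : ℝ}
    (hx : x ∈ posPoles q) : ∃ Q : BQF p, IsFormPair Q x (heckeConj p x) ∧ heckeConj p x < 0 := by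
  obtain ⟨Q, x', hQ, hx'⟩ := exists_isFormPair_of_fixedBy hp (H.fixedBy hp hx)
  rw [hQ.heckeConj_eq hp]
  exact ⟨Q, hQ, hx'⟩

/-- On the orbit of a positive pole, the Hecke conjugate is equivariant. -/
theorem sends_conj (hp : 3 ≤ p) (H : PoleDynamics p k q ν σ) {x y : ℝ} (hx : x ∈ posPoles q)
    {V : Matrix.SpecialLinearGroup (Fin 2) ℝ} (hV : V ∈ heckeGroup p) (h : Sends V x y) :
    Sends V (heckeConj p x) (heckeConj p y) := by
  obtain ⟨Q, hQ, -⟩ := H.exists_isFormPair hp hx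
  obtain ⟨M, hM, -⟩ := id hQ
  obtain ⟨z, z', hz, hz'⟩ := orbit_finite_of_fixedPair hp (H.fixedBy hp hx) hM hV
  obtain rfl := h.unique hz
  obtain ⟨Q', hQ', -⟩ := hQ.carry hV hz hz'
  rwa [hQ'.heckeConj_eq hp]

/-- Among the `U ^ n T`, only the one with `n = ν x` keeps the conjugate of `x` negative: the
conjugate is fixed by the periodic word of `x`, whose first step `ν x` already keeps it negative,
and at most one of the `U ^ n T` does so. -/
theorem eq_of_posR_conj_neg (hp : 3 ≤ p) (H : PoleDynamics p k q ν σ) {x u : ℝ}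
    (hx : x ∈ posPoles q) {n : ℕ} (hn : 1 ≤ n ∧ n < p)
    (h : Sends (posR p n) (heckeConj p x) u) (hu : u < 0) : n = ν x := by
  obtain ⟨m, hl, -⟩ := H.exists_fixedBy hp hx
  obtain ⟨Q, hQ, hx'⟩ := H.exists_isFormPair hp hx
  obtain ⟨M, hM, -⟩ := id hQ
  have h1 := hM.sends_of_sends (word_mem _) hl.sends
  have h2 := H.sends_conj hp hx (posR_mem _) (H.sends x hx)
  have hv := hl.valid
  rw [itinerary, valid_append] at hv
  rw [itinerary, word_append, word_cons, word_nil, mul_one] at h1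
  have h3 := h1.comp h2.inv
  rw [mul_inv_cancel_right] at h3
  have h4 := (nonnegMat_word hp hv.1).1.neg_of_sends h3 hx'
  exact posR_neg_unique hp hn.2 (H.valid x hx).2 hu h4 h h2

/-- A positive word that keeps the conjugate of a positive pole negative follows the dynamics. -/
theorem eq_iterate_of_word (hp : 3 ≤ p) (H : PoleDynamics p k q ν σ) {w : List ℕ} {x y y' : ℝ}
    (hx : x ∈ posPoles q) (hw : Valid p w) (h : Sends (word p w) x y)
    (h' : Sends (word p w) (heckeConj p x) y') (hy' : y' < 0) : ∃ m, y = σ^[m] x := by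
  induction w using List.reverseRecOn generalizing x with
  | nil => exact ⟨0, (sends_one.unique h).symm⟩
  | append_singleton w n ih =>
    rw [valid_append] at hw
    have hn : 1 ≤ n ∧ n < p := hw.2 n (by simp)
    rw [word_append, word_cons, word_nil, mul_one] at h h'
    obtain ⟨u, hu, hu'⟩ := (nonnegMat_posR hp hn.1 hn.2).1.exists_sends hx.1
    have h1 := H.sends_conj hp hx (posR_mem _) hu'
    have h2 := h.comp hu'.inv
    have h3 := h'.comp h1.inv
    rw [mul_inv_cancel_right] at h2 h3
    have h4 := (nonnegMat_word hp hw.1).1.neg_of_sends h3 hy'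
    obtain rfl := H.eq_of_posR_conj_neg hp hx hn h1 h4
    obtain rfl := hu'.unique (H.sends x hx)
    obtain ⟨m, hm⟩ := ih (H.mapsTo x hx) hw.1 h2 h3
    exact ⟨m + 1, hm⟩

/-- The numbers `Z_𝒜` of the class of a positive pole `x` are the iterates of `x`. -/
theorem mem_simpleNumbers (hp : 3 ≤ p) (H : PoleDynamics p k q ν σ) {x : ℝ}
    (hx : x ∈ posPoles q) {Q : BQF p} (hQ : IsFormPair Q x (heckeConj p x)) {y : ℝ} :
    y ∈ simpleNumbers Q.eqvClass ↔ ∃ m, y = σ^[m] x := by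
  have hfix := H.fixedBy hp hx
  rw [mem_simpleNumbers_iff hp hfix hQ]
  constructor
  · rintro ⟨V, hV, y', hy, hy', hy0', hy0⟩
    obtain ⟨l, hl⟩ := hfix
    obtain ⟨w, j, hw, h⟩ := hasForm_of_mem hp hl.valid hl.ne_nil hV
    obtain ⟨z, hz, hz'⟩ := (nonnegMat_word hp hw).1.exists_sends hl.pos
    obtain ⟨M, hM, -⟩ := id hQ
    have hj := (hl.sends.pow j).inv
    have hj' := hM.sends_of_sends (inv_mem (pow_mem (word_mem l) j)) hj
    have h1 := hz'.comp hj
    have hzc := H.sends_conj hp hx (word_mem w) hz'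
    have h1' := hzc.comp hj'
    have key : z = y → heckeConj p z = y' → ∃ m, y = σ^[m] x := by
      rintro rfl rfl
      exact H.eq_iterate_of_word hp hx hw hz' hzc hy0'
    have hneg : -1 / z < 0 := div_neg_of_neg_of_pos (by norm_num) hz
    have hT := (sends_matT hz.ne').comp h1
    rcases h with (rfl | rfl) | (rfl | rfl)
    · exact key (h1.unique hy) (h1'.unique hy')
    · exact key (h1.neg.unique hy) (h1'.neg.unique hy')
    · linarith [hT.unique hy]
    · linarith [hT.neg.unique hy]
  · rintro ⟨m, rfl⟩
    obtain ⟨h1, h2, h3, -⟩ := H.iterate_spec hp m hx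
    obtain ⟨-, -, h4⟩ := H.exists_isFormPair hp h1
    exact ⟨_, word_mem _, _, h3, H.sends_conj hp hx (word_mem _) h3, h4, h1.1⟩

/-- The coefficient of the principal part of `q` is carried along the dynamics. -/
theorem regularAt_iterate (hp : 3 ≤ p) (H : PoleDynamics p k q ν σ) {c : ℂ} (m : ℕ) {x : ℝ}
    (hx : x ∈ posPoles q) (h : RegularAt (q - RatFunc.C c * phi k x (heckeConj p x)) x) :
    RegularAt (q - RatFunc.C c * phi k (σ^[m] x : ℝ) (heckeConj p (σ^[m] x))) (σ^[m] x : ℝ) := by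
  induction m with
  | zero => exact h
  | succ m ih =>
    rw [Function.iterate_succ_apply']
    have hy := (H.iterate_spec hp m hx).1
    set y := σ^[m] x
    have hs := H.sends y hy
    have hs' := H.sends_conj hp hy (posR_mem _) hs
    have h1 := RegularAt.slash (k := k) ih hs.inv.toC
    have h2 := RegularAt.slash (k := k) (H.regularAt_sub_posR hp hy) hs.inv.toC
    rw [slash_sub, slash_C_mul, phi_slash_real hs.inv hs'.inv] at h1
    rw [slash_sub, slash_slash, mul_inv_cancel, slash_one] at h2
    convert h1.sub h2 using 1
    ring

end PoleDynamics

/-! ### Invariant principal parts -/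

theorem phi_eq_order (k : ℕ) {a b : ℂ} (hab : a ≠ b) :
    ∃ ψ, HasVal ψ a 1 ∧ phi k a b = (RatFunc.X - RatFunc.C a) ^ (-(k : ℤ)) * ψ := by
  have h0 : (a - b) ^ k ≠ 0 := pow_ne_zero _ (sub_ne_zero.2 hab)
  refine ⟨RatFunc.C ((a - b) ^ k) / (RatFunc.X - RatFunc.C b) ^ k, ?_, ?_⟩
  · have := (hasVal_C ((a - b) ^ k) a).div ((hasVal_X_sub_C a b).pow k) h0
    rwa [div_self h0] at this
  · rw [phi, zpow_neg, zpow_natCast, inv_mul_eq_div, div_div, mul_comm]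

theorem regularAt_zpow_mul {z : ℂ} {m : ℤ} (hm : 0 ≤ m) {g : RatFunc ℂ} (hg : RegularAt g z) :
    RegularAt ((RatFunc.X - RatFunc.C z) ^ m * g) z := by
  lift m to ℕ using hm
  rw [zpow_natCast]
  exact ((hasVal_X_sub_C z z).pow m).regularAt.mul hg

/-- A hyperbolic substitution multiplies the local parameter at its fixed point by a number that is
not a root of unity. Hence if `h ∘ V - h` vanishes to order `k`, then `h` has order `0`, or order
at least `k`. -/
theorem order_of_invariant {k : ℕ} {V : Matrix.SpecialLinearGroup (Fin 2) ℝ} {x x' : ℝ}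
    (hV : Sends V x x) (hne : x ≠ x') (hj : |jac V x| ≠ 1) {m : ℤ} {g : RatFunc ℂ}
    {v : ℂ} (hv : v ≠ 0) (hg : HasVal g x v) (hm : m ≠ 0)
    (h : RegularAt (((RatFunc.X - RatFunc.C (x : ℂ)) ^ m * g
      - moebHom V ((RatFunc.X - RatFunc.C (x : ℂ)) ^ m * g)) * phi k x x') x) : (k : ℤ) ≤ m := by
  obtain ⟨ψ, hψ, he⟩ := phi_eq_order k (a := x) (b := x') (by exact_mod_cast hne)
  have hX := X_sub_C_ne_zero (x : ℂ)
  have hj0 : (jac V x : ℂ) ≠ 0 := by exact_mod_cast hV.1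
  have hjc : (V 1 0 : ℂ) * x + V 1 1 = (jac V x : ℂ) := by unfold jac; push_cast; rfl
  set e := (mden V * RatFunc.C ((V 1 0 : ℂ) * x + V 1 1))⁻¹ with hedef
  have hval : HasVal e x ((jac V x : ℂ) * jac V x)⁻¹ := by
    have h1 := ((hasVal_mden V x).mul (hasVal_C ((V 1 0 : ℂ) * x + V 1 1) x))
    rw [hjc] at h1
    rw [hedef, hjc]
    exact h1.inv (mul_ne_zero hj0 hj0)
  have hμ : ((jac V x : ℂ) * jac V x)⁻¹ ≠ 0 := inv_ne_zero (mul_ne_zero hj0 hj0)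
  have h1 := hg.sub ((hval.zpow hμ m).mul (hg.moebHom hV.toC))
  have hv' : v - ((jac V x : ℂ) * jac V x)⁻¹ ^ m * v ≠ 0 := by
    have hpow : (((jac V x) * jac V x)⁻¹ : ℝ) ^ m ≠ 1 := by
      intro h1
      have hpos : 0 < ((jac V x * jac V x)⁻¹ : ℝ) := inv_pos.2 (mul_self_pos.2 hV.1)
      have h2 : ((jac V x * jac V x)⁻¹ : ℝ) = 1 := by
        by_contra h2
        exact hm (zpow_right_injective₀ hpos h2 (h1.trans (zpow_zero _).symm))
      rw [inv_eq_one] at h2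
      rcases mul_self_eq_one_iff.1 h2 with h3 | h3 <;> exact hj (by rw [h3]; simp)
    have hpow' : ((jac V x : ℂ) * jac V x)⁻¹ ^ m ≠ 1 := by exact_mod_cast hpow
    rw [← one_sub_mul]
    exact mul_ne_zero (sub_ne_zero.2 hpow'.symm) hv
  have h2 : ((RatFunc.X - RatFunc.C (x : ℂ)) ^ m * g
      - moebHom V ((RatFunc.X - RatFunc.C (x : ℂ)) ^ m * g)) * phi k x x'
      = (RatFunc.X - RatFunc.C (x : ℂ)) ^ (m - k) * ((g - e ^ m * moebHom V g) * ψ) := by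
    rw [he, map_mul, map_zpow₀, moebHom_X_sub_C hV.toC, mul_zpow, sub_eq_add_neg m, zpow_add₀ hX]
    ring
  rw [h2] at h
  have := order_nonneg (mul_ne_zero hv' one_ne_zero) (h1.mul hψ) h
  omega

/-- If `q ∣ V` and `q` have the same singular part at the fixed point `x` of a hyperbolic `V`, then
this singular part is that of a multiple of `((x - x') / ((z - x) (z - x'))) ^ k`: the quotient of
`q` by this function is invariant modulo order `k`, hence constant modulo order `k`. -/
theorem exists_coefficient {k : ℕ} {q : RatFunc ℂ} {V : Matrix.SpecialLinearGroup (Fin 2) ℝ}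
    {x x' : ℝ} (hV : Sends V x x) (hV' : Sends V x' x') (hne : x ≠ x') (hj : |jac V x| ≠ 1)
    (h : RegularAt (q - slash k q V) x) :
    ∃ c, RegularAt (q - RatFunc.C c * phi k x x') x := by
  obtain ⟨ψ, hψ, he⟩ := phi_eq_order k (a := x) (b := x') (by exact_mod_cast hne)
  have hX := X_sub_C_ne_zero (x : ℂ)
  have hφ : phi k x x' ≠ 0 := by
    rw [he]
    exact mul_ne_zero (zpow_ne_zero _ hX) (hψ.ne_zero one_ne_zero)
  have hφV := phi_slash_real (k := k) hV hV'
  -- the quotient of `q` by the invariant function `φ`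
  obtain ⟨f, hf⟩ : ∃ f, q = f * phi k x x' := ⟨q / phi k x x', (div_mul_cancel₀ _ hφ).symm⟩
  have hinv : ∀ c : ℂ, RegularAt (((f - RatFunc.C c) - moebHom V (f - RatFunc.C c))
      * phi k x x') x := by
    intro c
    convert h using 1
    rw [hf, slash_eq, map_mul, mul_left_comm, ← slash_eq, hφV, map_sub, moebHom_C]
    ring
  have hreg : ∀ (m : ℤ) (g : RatFunc ℂ), RegularAt g x → (k : ℤ) ≤ m →
      RegularAt ((RatFunc.X - RatFunc.C (x : ℂ)) ^ m * g * phi k x x') x := by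
    intro m g hg hm
    have e : (RatFunc.X - RatFunc.C (x : ℂ)) ^ m * g * phi k x x'
        = (RatFunc.X - RatFunc.C (x : ℂ)) ^ (m - k) * (g * ψ) := by
      rw [he, sub_eq_add_neg m, zpow_add₀ hX]
      ring
    rw [e]
    exact regularAt_zpow_mul (by omega) (hg.mul hψ.regularAt)
  have hsub : ∀ c, q - RatFunc.C c * phi k x x' = (f - RatFunc.C c) * phi k x x' := by
    intro c; rw [hf]; ring
  by_cases hf0 : f = 0
  · refine ⟨0, ?_⟩
    rw [hsub, hf0]
    simpa using (hasVal_zero _).regularAt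
  obtain ⟨m, g, v, hv, hg, hfm⟩ := exists_order hf0 x
  by_cases hm : m = 0
  · refine ⟨v, ?_⟩
    rw [hsub]
    by_cases hf1 : f - RatFunc.C v = 0
    · rw [hf1, zero_mul]
      exact (hasVal_zero _).regularAt
    obtain ⟨m', g', v', hv', hg', hfm'⟩ := exists_order hf1 x
    have hm' : m' ≠ 0 := by
      rintro rfl
      rw [zpow_zero, one_mul] at hfm'
      rw [hm, zpow_zero, one_mul] at hfm
      have h1 := hg.sub (hasVal_C v x)
      rw [← hfm, hfm', sub_self] at h1
      exact hv' (hg'.unique h1)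
    have h1 := hinv v
    rw [hfm'] at h1 ⊢
    exact hreg _ _ hg'.regularAt (order_of_invariant hV hne hj hv' hg' hm' h1)
  · refine ⟨0, ?_⟩
    have h1 := hinv 0
    rw [map_zero, sub_zero, hfm] at h1
    rw [map_zero, zero_mul, sub_zero, hf, hfm]
    exact hreg _ _ hg.regularAt (order_of_invariant hV hne hj hv hg hm h1)

theorem PoleDynamics.exists_coefficient {p k : ℕ} {q : RatFunc ℂ} {ν : ℝ → ℕ} {σ : ℝ → ℝ}
    (hp : 3 ≤ p) (H : PoleDynamics p k q ν σ) {x : ℝ} (hx : x ∈ posPoles q) :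
    ∃ c, RegularAt (q - RatFunc.C c * phi k x (heckeConj p x)) x := by
  obtain ⟨m, hl, hreg⟩ := H.exists_fixedBy hp hx
  obtain ⟨Q, hQ, hx'⟩ := H.exists_isFormPair hp hx
  obtain ⟨M, hM, -⟩ := id hQ
  have hne : x ≠ heckeConj p x := (hx'.trans hx.1).ne'
  refine HeckeRPF.exists_coefficient hl.sends (hM.sends_of_sends (word_mem _) hl.sends) hne ?_ hreg
  exact abs_jac_ne_one hl.sends ((hl.hyperbolic hp).2.2.trans_le (le_abs_self _))

/-! ### The pole at the origin -/

section Origin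

variable {p k : ℕ} {q : RatFunc ℂ} {ν : ℝ → ℕ} {σ : ℝ → ℝ}

/-- The points `U ^ n 0` with `0 < n < p` are not positive poles: each lies at an end of the images
of the positive half-line under the `U ^ n T`, while every positive pole lies inside one. -/
theorem PoleDynamics.not_sends_zero (hp : 3 ≤ p) (H : PoleDynamics p k q ν σ) {n : ℕ}
    (hn1 : 1 ≤ n) (hn2 : n < p) {y : ℝ} (h : Sends (matU p ^ n) 0 y) : y ∉ posPoles q := by
  intro hy
  obtain ⟨z, hz, rfl⟩ := H.surj y hy
  obtain ⟨hm1, hm2⟩ := H.valid z hz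
  have hs := H.sends z hz
  generalize ν z = m at *
  have hz0 := hz.1
  have hT : Sends matT (-1 / z) z := by
    rw [sends_matT_iff]; field_simp
  have hz1 : -1 / z < 0 := div_neg_of_neg_of_pos (by norm_num) hz0
  have hU : ∀ {d : ℕ} {u : ℝ}, Sends (posR p d) z u → Sends (matU p ^ d) (-1 / z) u := by
    intro d u h
    rw [matU_pow_eq]
    exact h.comp hT
  have hsub : ∀ {a d : ℕ} {u u' v : ℝ}, Sends (matU p ^ a) u v → Sends (matU p ^ (a + d)) u' v →
      Sends (matU p ^ d) u' u := by
    intro a d u u' v h1 h2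
    have := h1.inv.comp h2
    rwa [pow_add, inv_mul_cancel_left] at this
  rcases lt_trichotomy m n with hmn | rfl | hmn
  · obtain ⟨d, rfl⟩ : ∃ d, n = m + (d + 1) := ⟨n - m - 1, by omega⟩
    have h1 := (hsub (hU hs) h).2
    obtain ⟨e1, e2, e3, e4⟩ := matU_pow_apply hp d
    rw [e1, e2, e3, e4] at h1
    have h2 := one_le_sinRatio hp (n := d + 1) (by omega) (by omega)
    have h3 := sinRatio_nonneg hp (n := d) (by omega)
    nlinarith [mul_nonneg h3 (neg_pos.2 hz1).le]
  · have := h.injective (hU hs)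
    linarith
  · obtain ⟨d, rfl⟩ : ∃ d, m = n + (d + 1) := ⟨m - n - 1, by omega⟩
    have h1 := hsub h (hU hs)
    rw [matU_pow_eq] at h1
    have h2 := h1.comp hT.inv
    rw [mul_inv_cancel_right] at h2
    exact lt_irrefl _
      ((nonnegMat_posR hp (n := d + 1) (by omega) (by omega)).1.pos hz0 h2)

/-- The parabolic element `T U` fixes `0`, and the singular part of `q` at `0` is invariant under
it. -/
theorem PoleDynamics.regularAt_zero (hp : 3 ≤ p) (H : PoleDynamics p k q ν σ) :
    RegularAt (q - slash k q (matT * matU p)) 0 := by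
  have h1 : slash k q matT = -q := eq_neg_of_add_eq_zero_right H.rpf.relT
  have h2 : slash k q (matT * matU p) = -slash k q (matU p) := by
    rw [← slash_slash, h1, slash_neg]
  have h3 := H.rpf.relU
  rw [Finset.sum_eq_sum_Ico_succ_bot (by omega), pow_one] at h3
  rw [h2, sub_neg_eq_add]
  have h4 : q + slash k q (matU p) = -∑ n ∈ Finset.Ico (1 + 1) p, slash k q (matU p ^ n) := by
    rw [eq_neg_iff_add_eq_zero, add_assoc]; exact h3
  rw [h4]
  refine (regularAt_sum _ _ _ fun n hn => ?_).neg
  rw [Finset.mem_Ico] at hn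
  obtain ⟨m, rfl⟩ : ∃ m, n = m + 1 := ⟨n - 1, by omega⟩
  obtain ⟨e1, e2, e3, e4⟩ := matU_pow_apply hp m
  have s1 := one_le_sinRatio hp (n := m) (by omega) (by omega)
  have s2 := one_le_sinRatio hp (n := m + 1) (by omega) (by omega)
  have hs : Sends (matU p ^ (m + 1)) 0 (sinRatio p (m + 1) / sinRatio p m) := by
    simp only [Sends, e1, e2, e3, e4]
    refine ⟨by intro h; linarith, ?_⟩
    have : sinRatio p m ≠ 0 := by linarith
    field_simp
    ring
  have hpos : 0 < sinRatio p (m + 1) / sinRatio p m := div_pos (by linarith) (by linarith)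
  have hreg : ¬ IsPole q ((sinRatio p (m + 1) / sinRatio p m : ℝ) : ℂ) := fun h =>
    H.not_sends_zero hp (by omega) hn.2 hs ⟨hpos, h⟩
  have := (not_isPole_iff.1 hreg).slash (k := k) hs.toC
  rwa [Complex.ofReal_zero] at this

/-- The denominator `1 - λ z` of the parabolic substitution `z ↦ z / (1 - λ z)`. -/
def parDen (p : ℕ) : RatFunc ℂ := 1 - RatFunc.C (lam p : ℂ) * RatFunc.X

theorem mden_TU : mden (matT * matU p) = -parDen p := by
  obtain ⟨h1, h2, h3, h4⟩ := matT_apply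
  obtain ⟨e1, e2, e3, e4⟩ := matU_apply p
  simp [mden, parDen, mul_apply_two, h3, h4, e1, e2, e3, e4]
  ring

theorem hasVal_parDen : HasVal (parDen p) 0 1 := by
  simpa [parDen] using (hasVal_one 0).sub ((hasVal_C (lam p : ℂ) 0).mul (hasVal_X 0))

theorem parDen_ne_zero : parDen p ≠ 0 := hasVal_parDen.ne_zero one_ne_zero

theorem moebHom_TU_X : moebHom (matT * matU p) RatFunc.X = RatFunc.X * (parDen p)⁻¹ := by
  obtain ⟨h1, h2, h3, h4⟩ := matT_apply
  obtain ⟨e1, e2, e3, e4⟩ := matU_apply p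
  have : mnum (matT * matU p) = -RatFunc.X := by
    simp [mnum, mul_apply_two, h1, h2, e1, e2, e3, e4]
  rw [moebHom_X, this, mden_TU, ← div_eq_mul_inv]
  exact neg_div_neg_eq _ _

theorem sendsC_TU : SendsC (matT * matU p) 0 0 := by
  obtain ⟨h1, h2, h3, h4⟩ := matT_apply
  obtain ⟨e1, e2, e3, e4⟩ := matU_apply p
  simp [SendsC, mul_apply_two, h1, h2, h3, h4, e1, e2, e3, e4]

theorem parDen_pow (p j : ℕ) : ∃ r, RegularAt r 0 ∧
    parDen p ^ j = 1 - RatFunc.C ((j : ℂ) * lam p) * RatFunc.X + RatFunc.X ^ 2 * r := by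
  induction j with
  | zero => exact ⟨0, (hasVal_zero 0).regularAt, by simp⟩
  | succ j ih =>
    obtain ⟨r, hr, h⟩ := ih
    refine ⟨r * parDen p + RatFunc.C ((j : ℂ) * lam p) * RatFunc.C (lam p : ℂ),
      (hr.mul hasVal_parDen.regularAt).add ((regularAt_C _ _).mul (regularAt_C _ _)), ?_⟩
    rw [pow_succ, h, parDen]
    simp only [Nat.cast_succ, map_mul, map_add, add_mul, one_mul]
    ring

/-- A function regular at `0` is invariant under the parabolic substitution up to second order. -/
theorem moebHom_TU_sub {g : RatFunc ℂ} (hg : RegularAt g 0) : ∃ r, RegularAt r 0 ∧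
    moebHom (matT * matU p) g = g + RatFunc.X ^ 2 * r := by
  set φ := moebHom (matT * matU p) with hφ
  have hD := parDen_ne_zero (p := p)
  have hpoly : ∀ P : Polynomial ℂ, ∃ r, RegularAt r 0 ∧
      φ (algebraMap _ _ P) = algebraMap _ _ P + RatFunc.X ^ 2 * r := by
    intro P
    induction P using Polynomial.induction_on with
    | C a => exact ⟨0, (hasVal_zero 0).regularAt, by simp [hφ]⟩
    | add P Q hP hQ =>
      obtain ⟨r, hr, h⟩ := hP
      obtain ⟨s, hs, h'⟩ := hQ
      refine ⟨r + s, hr.add hs, ?_⟩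
      rw [map_add, map_add, h, h']
      ring
    | monomial n a ih =>
      obtain ⟨r, hr, h⟩ := ih
      have hX : φ RatFunc.X
          = RatFunc.X + RatFunc.X ^ 2 * (RatFunc.C (lam p : ℂ) * (parDen p)⁻¹) := by
        rw [hφ, moebHom_TU_X]
        field_simp
        rw [parDen]
        ring
      have hl : RegularAt (RatFunc.C (lam p : ℂ) * (parDen p)⁻¹) 0 :=
        (regularAt_C _ _).mul (hasVal_parDen.inv one_ne_zero).regularAt
      generalize RatFunc.C (lam p : ℂ) * (parDen p)⁻¹ = l at hX hl
      have hA := (hasVal_algebraMap (Polynomial.C a * Polynomial.X ^ n) 0).regularAt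
      have hX0 := (hasVal_X 0).regularAt
      rw [pow_succ, ← mul_assoc]
      generalize Polynomial.C a * Polynomial.X ^ n = A at *
      refine ⟨algebraMap _ _ A * l + r * RatFunc.X + RatFunc.X ^ 2 * (r * l),
        ((hA.mul hl).add (hr.mul hX0)).add ((hX0.pow 2).mul (hr.mul hl)), ?_⟩
      rw [map_mul, map_mul, h, RatFunc.algebraMap_X, hX]
      ring
  obtain ⟨v, n, d, hd, rfl, -⟩ := hg
  obtain ⟨r, hr, h⟩ := hpoly n
  obtain ⟨s, hs, h'⟩ := hpoly d
  have hd0 := algebraMap_ne_zero_of_eval hd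
  have hd1 := hasVal_algebraMap d 0
  have hn1 := hasVal_algebraMap n 0
  have hd2 : HasVal (φ (algebraMap _ _ d)) 0 (d.eval 0) := hd1.moebHom sendsC_TU
  have hd3 : φ (algebraMap _ _ d) ≠ 0 := hd2.ne_zero hd
  refine ⟨(r * algebraMap _ _ d - algebraMap _ _ n * s) * (algebraMap _ _ d)⁻¹
    * (φ (algebraMap _ _ d))⁻¹, (((hr.mul hd1.regularAt).sub (hn1.regularAt.mul hs)).mul
      (hd1.inv hd).regularAt).mul (hd2.inv hd).regularAt, ?_⟩
  rw [map_div₀, h]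
  field_simp
  rw [h']
  ring

theorem lam_pos (hp : 3 ≤ p) : 0 < lam p := by linarith [one_le_lam hp]

/-- The pole at `0` has order at most `2k`: if `q = z ^ (-2k - j) g` with `j > 0` and `g(0) ≠ 0`,
then the leading term of `q - q ∣ T U` is a nonzero multiple of `z ^ (-2k - j + 1)`. -/
theorem PoleDynamics.regularAt_X_pow_mul (hp : 3 ≤ p) (hk : 1 ≤ k) (H : PoleDynamics p k q ν σ) :
    RegularAt (RatFunc.X ^ (2 * k) * q) 0 := by
  by_cases hq : q = 0
  · rw [hq, mul_zero]; exact (hasVal_zero 0).regularAt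
  obtain ⟨m, g, v, hv, hg, hm⟩ := exists_order hq 0
  rw [map_zero, sub_zero] at hm
  have hX : (RatFunc.X : RatFunc ℂ) ≠ 0 := RatFunc.X_ne_zero
  by_cases hm2 : -(2 * k : ℤ) ≤ m
  · have e : RatFunc.X ^ (2 * k) * q
        = (RatFunc.X - RatFunc.C (0 : ℂ)) ^ ((2 * k : ℕ) + m : ℤ) * g := by
      rw [map_zero, sub_zero, zpow_add₀ hX, zpow_natCast, hm, mul_assoc]
    rw [e]
    exact regularAt_zpow_mul (by push_cast; omega) hg.regularAt
  · exfalso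
    obtain ⟨j, hj, rfl⟩ : ∃ j : ℕ, 0 < j ∧ m = -(2 * k + j : ℤ) :=
      ⟨(-m - 2 * k).toNat, by omega, by omega⟩
    have hD := parDen_ne_zero (p := p)
    have hslash : slash k q (matT * matU p)
        = RatFunc.X ^ (-(2 * k + j : ℤ)) * (parDen p ^ j * moebHom (matT * matU p) g) := by
      rw [slash_eq, mden_TU, (even_two_mul k).neg_pow, hm, map_mul, map_zpow₀, moebHom_TU_X,
        mul_zpow, inv_zpow', neg_neg, zpow_add₀ hD, zpow_natCast,
        show (2 * k : ℤ) = ((2 * k : ℕ) : ℤ) by push_cast; ring, zpow_natCast]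
      field_simp
    obtain ⟨r, hr, h1⟩ := parDen_pow p j
    obtain ⟨s, hs, h2⟩ := moebHom_TU_sub (p := p) hg.regularAt
    -- the coefficient of `z` in `g - (1 - λ z) ^ j g(z / (1 - λ z))` is `j λ g(0)`
    have hval : HasVal (RatFunc.C ((j : ℂ) * lam p) * g - RatFunc.X * (r * g + parDen p ^ j * s)) 0
        ((j : ℂ) * lam p * v) := by
      obtain ⟨w, hw⟩ := (hr.mul hg.regularAt).add ((hasVal_parDen.pow j).regularAt.mul hs)
      simpa using ((hasVal_C ((j : ℂ) * lam p) 0).mul hg).sub ((hasVal_X 0).mul hw)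
    have hne : (j : ℂ) * lam p * v ≠ 0 :=
      mul_ne_zero (mul_ne_zero (by exact_mod_cast hj.ne')
        (by exact_mod_cast (lam_pos hp).ne')) hv
    have hdiff : q - slash k q (matT * matU p)
        = (RatFunc.X - RatFunc.C (0 : ℂ)) ^ (-(2 * k + j : ℤ) + 1)
          * (RatFunc.C ((j : ℂ) * lam p) * g - RatFunc.X * (r * g + parDen p ^ j * s)) := by
      rw [hslash, h2, mul_add, h1, map_zero, sub_zero, zpow_add₀ hX, zpow_one]
      conv_lhs => lhs; rw [hm]
      ring
    have h3 := H.regularAt_zero hp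
    rw [hdiff] at h3
    have := order_nonneg hne hval h3
    omega

end Origin

/-! ### The Laurent part at the origin -/

theorem hasVal_sum {ι : Type*} (s : Finset ι) (f : ι → RatFunc ℂ) (v : ι → ℂ) (z : ℂ)
    (h : ∀ i ∈ s, HasVal (f i) z (v i)) : HasVal (∑ i ∈ s, f i) z (∑ i ∈ s, v i) := by
  classical
  induction s using Finset.induction_on with
  | empty => simpa using hasVal_zero z
  | insert a s ha ih =>
    rw [Finset.sum_insert ha, Finset.sum_insert ha]
    exact (h _ (by simp)).add (ih fun i hi => h i (by simp [hi]))

/-- For a polynomial `P` of degree at most `d`, the value of `z ^ d P(-1 / z)` at `0` is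
`(-1) ^ d` times the coefficient of degree `d`. -/
theorem hasVal_reverse {P : Polynomial ℂ} {d : ℕ} (hd : P.natDegree ≤ d) :
    HasVal (RatFunc.X ^ d * Polynomial.aeval (-RatFunc.X⁻¹ : RatFunc ℂ) P) 0
      ((-1) ^ d * P.coeff d) := by
  have hX : (RatFunc.X : RatFunc ℂ) ≠ 0 := RatFunc.X_ne_zero
  rw [Polynomial.aeval_eq_sum_range' (Nat.lt_succ_of_le hd), Finset.mul_sum]
  have h : ∀ i ∈ Finset.range (d + 1),
      HasVal (RatFunc.X ^ d * P.coeff i • (-RatFunc.X⁻¹ : RatFunc ℂ) ^ i) 0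
        (P.coeff i * (-1) ^ i * 0 ^ (d - i)) := by
    intro i hi
    rw [Finset.mem_range] at hi
    obtain ⟨e, rfl⟩ : ∃ e, d = i + e := ⟨d - i, by omega⟩
    have he : RatFunc.X ^ (i + e) * P.coeff i • (-RatFunc.X⁻¹ : RatFunc ℂ) ^ i
        = RatFunc.C (P.coeff i * (-1) ^ i) * RatFunc.X ^ e := by
      rw [RatFunc.smul_eq_C_mul, neg_pow, inv_pow, pow_add]
      simp only [map_mul, map_pow, map_neg, map_one]
      field_simp
    rw [he, Nat.add_sub_cancel_left]
    exact (hasVal_C _ _).mul ((hasVal_X 0).pow e)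
  have hv : ∑ i ∈ Finset.range (d + 1), P.coeff i * (-1) ^ i * 0 ^ (d - i)
      = (-1) ^ d * P.coeff d := by
    rw [Finset.sum_range_succ, Finset.sum_eq_zero]
    · rw [Nat.sub_self]
      ring
    · intro i hi
      rw [Finset.mem_range] at hi
      rw [zero_pow (by omega), mul_zero]
  exact hv ▸ hasVal_sum _ _ _ _ h

theorem mden_matT : mden matT = RatFunc.X := by
  obtain ⟨h1, h2, h3, h4⟩ := matT_apply
  simp [mden, h3, h4]

theorem mnum_matT : mnum matT = -1 := by
  obtain ⟨h1, h2, h3, h4⟩ := matT_apply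
  simp [mnum, h1, h2]

theorem moebHom_matT_X : moebHom matT RatFunc.X = -RatFunc.X⁻¹ := by
  rw [moebHom_X, mden_matT, mnum_matT]
  ring

/-- Let `R` be regular at the origin and vanish at infinity, and let `q - R` have no pole outside
the origin. Then `z ^ (2k) (q - R)` is a polynomial, of degree at most `2k`, and the relation
`q + q ∣ T = 0` links its extreme coefficients. -/
theorem eq_add_laurent {k : ℕ} (hk : 1 ≤ k) {q R : RatFunc ℂ} (hT : q + slash k q matT = 0)
    (h0 : RegularAt (RatFunc.X ^ (2 * k) * q) 0) (hR : RegularAt R 0)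
    (hR' : HasVal (moebHom matT R) 0 0) (hreg : ∀ z ≠ 0, RegularAt (q - R) z) :
    ∃ (a : ℂ) (c : ℕ → ℂ), q = R + RatFunc.C a * (1 - (RatFunc.X ^ (2 * k))⁻¹)
      + ∑ n ∈ Finset.Icc 1 (2 * k - 1), RatFunc.C (c n) / RatFunc.X ^ n := by
  have hX : (RatFunc.X : RatFunc ℂ) ≠ 0 := RatFunc.X_ne_zero
  obtain ⟨P, hP⟩ : ∃ P : Polynomial ℂ,
      RatFunc.X ^ (2 * k) * (q - R) = algebraMap (Polynomial ℂ) (RatFunc ℂ) P := by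
    refine exists_polynomial_of_regularAt fun z => ?_
    by_cases hz : z = 0
    · rw [hz, mul_sub]
      exact h0.sub (((hasVal_X 0).pow _).regularAt.mul hR)
    · exact ((hasVal_X z).pow _).regularAt.mul (hreg z hz)
  obtain ⟨w, hw⟩ := h0
  have hw0 : w = P.coeff 0 := by
    obtain ⟨r, hr⟩ := hR
    have h1 := hw.sub (((hasVal_X 0).pow (2 * k)).mul hr)
    rw [← mul_sub, hP] at h1
    have h2 := h1.unique (hasVal_algebraMap P 0)
    rw [zero_pow (by omega), zero_mul, sub_zero] at h2
    rw [h2, Polynomial.coeff_zero_eq_eval_zero]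
  have hqT : moebHom matT q = -(RatFunc.X ^ (2 * k) * q) := by
    have h1 : slash k q matT = -q := eq_neg_of_add_eq_zero_right hT
    rw [slash_eq, mden_matT, inv_mul_eq_iff_eq_mul₀ (pow_ne_zero _ hX)] at h1
    rw [h1, mul_neg]
  have hrev : HasVal (RatFunc.X ^ (2 * k) * Polynomial.aeval (-RatFunc.X⁻¹ : RatFunc ℂ) P) 0
      (-w) := by
    have h1 := congrArg (moebHom matT) hP
    rw [moebHom_algebraMap, ← moebHom_X, moebHom_matT_X, map_mul, map_pow, moebHom_matT_X,
      (even_two_mul k).neg_pow, inv_pow, map_sub, hqT] at h1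
    rw [← h1, mul_inv_cancel_left₀ (pow_ne_zero _ hX)]
    simpa using hw.neg.sub hR'
  have hdeg : P.natDegree ≤ 2 * k := by
    by_contra hlt
    have hP0 : P ≠ 0 := by rintro rfl; simp at hlt
    have h1 := hasVal_reverse (P := P) le_rfl
    have hne : (-1) ^ P.natDegree * P.coeff P.natDegree ≠ 0 :=
      mul_ne_zero (pow_ne_zero _ (by norm_num)) (Polynomial.leadingCoeff_ne_zero.2 hP0)
    have h2 := hrev.regularAt
    have e : RatFunc.X ^ (2 * k) * Polynomial.aeval (-RatFunc.X⁻¹ : RatFunc ℂ) P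
        = (RatFunc.X - RatFunc.C (0 : ℂ)) ^ (((2 * k : ℕ) : ℤ) - (P.natDegree : ℕ))
          * (RatFunc.X ^ P.natDegree * Polynomial.aeval (-RatFunc.X⁻¹ : RatFunc ℂ) P) := by
      rw [map_zero, sub_zero, zpow_sub₀ hX, zpow_natCast, zpow_natCast]
      field_simp
    rw [e] at h2
    have := order_nonneg hne h1 h2
    omega
  have htop : P.coeff (2 * k) = -P.coeff 0 := by
    have h1 := (hasVal_reverse hdeg).unique hrev
    rw [(even_two_mul k).neg_one_pow, one_mul] at h1
    rw [h1, hw0]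
  refine ⟨P.coeff (2 * k), fun n => P.coeff (2 * k - n), ?_⟩
  have hq : q = R + algebraMap (Polynomial ℂ) (RatFunc ℂ) P * (RatFunc.X ^ (2 * k))⁻¹ := by
    rw [← hP]
    field_simp
    ring
  have hsum : algebraMap (Polynomial ℂ) (RatFunc ℂ) P * (RatFunc.X ^ (2 * k))⁻¹
      = RatFunc.C (P.coeff (2 * k)) + RatFunc.C (P.coeff 0) * (RatFunc.X ^ (2 * k))⁻¹
        + ∑ n ∈ Finset.Icc 1 (2 * k - 1), RatFunc.C (P.coeff (2 * k - n)) / RatFunc.X ^ n := by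
    have h1 : algebraMap (Polynomial ℂ) (RatFunc ℂ) P
        = ∑ i ∈ Finset.range (2 * k + 1), RatFunc.C (P.coeff i) * RatFunc.X ^ i := by
      conv_lhs => rw [Polynomial.as_sum_range' P (2 * k + 1) (by omega), map_sum]
      refine Finset.sum_congr rfl fun i _ => ?_
      rw [← Polynomial.C_mul_X_pow_eq_monomial]
      simp
    obtain ⟨N, hN⟩ : ∃ N, 2 * k = N + 1 := ⟨2 * k - 1, by omega⟩
    rw [h1, hN, Finset.sum_range_succ, Finset.sum_range_succ', add_mul, add_mul,
      Finset.sum_mul]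
    have h2 : ∑ i ∈ Finset.range N, RatFunc.C (P.coeff (i + 1)) * RatFunc.X ^ (i + 1)
          * (RatFunc.X ^ (N + 1))⁻¹
        = ∑ n ∈ Finset.Icc 1 (N + 1 - 1), RatFunc.C (P.coeff (N + 1 - n)) / RatFunc.X ^ n := by
      refine Finset.sum_nbij' (fun i => N - i) (fun n => N - n) ?_ ?_ ?_ ?_ ?_
      · intro i hi; simp only [Finset.mem_range, Finset.mem_Icc] at *; omega
      · intro i hi; simp only [Finset.mem_range, Finset.mem_Icc] at *; omega
      · intro i hi; simp only [Finset.mem_range] at *; omega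
      · intro i hi; simp only [Finset.mem_Icc] at *; omega
      · intro i hi
        rw [Finset.mem_range] at hi
        obtain ⟨e, rfl⟩ : ∃ e, N = i + e := ⟨N - i, by omega⟩
        rw [show i + e + 1 - (i + e - i) = i + 1 by omega, show i + e - i = e by omega,
          show i + e + 1 = (i + 1) + e by omega, pow_add RatFunc.X (i + 1) e]
        field_simp
    rw [h2, pow_zero, mul_one, mul_assoc (RatFunc.C (P.coeff (N + 1))),
      mul_inv_cancel₀ (pow_ne_zero _ hX), mul_one]
    ring
  rw [htop] at hsum ⊢
  conv_lhs => rw [hq, hsum]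
  rw [map_neg]
  ring

/-! ### Assembling the decomposition -/

section Principal

variable {k p : ℕ} {f r : RatFunc ℂ} {α : ℂ}

theorem hasVal_X_sub_C_inv {z : ℂ} (hz : z ≠ α) :
    HasVal (RatFunc.X - RatFunc.C α)⁻¹ z (z - α)⁻¹ :=
  (hasVal_X_sub_C z α).inv (sub_ne_zero.2 hz)

theorem IsPrincipalPart.regularAt_of_ne (h : IsPrincipalPart α f r) {z : ℂ} (hz : z ≠ α) :
    RegularAt r z := by
  obtain ⟨⟨P, -, rfl⟩, -⟩ := h
  exact ((hasVal_X_sub_C_inv hz).aeval P).regularAt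

theorem moebHom_aeval (V : Matrix.SpecialLinearGroup (Fin 2) ℝ) (P : Polynomial ℂ)
    (g : RatFunc ℂ) : moebHom V (Polynomial.aeval g P) = Polynomial.aeval (moebHom V g) P := by
  rw [Polynomial.aeval_def, Polynomial.aeval_def, Polynomial.hom_eval₂]
  congr 1
  ext c
  exact moebHom_C V c

/-- A principal part vanishes at infinity. -/
theorem IsPrincipalPart.hasVal_matT (h : IsPrincipalPart α f r) :
    HasVal (moebHom matT r) 0 0 := by
  obtain ⟨⟨P, hP, rfl⟩, -⟩ := h
  have hX : (RatFunc.X : RatFunc ℂ) ≠ 0 := RatFunc.X_ne_zero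
  have h1 : moebHom matT (RatFunc.X - RatFunc.C α)⁻¹
      = -RatFunc.X * (1 + RatFunc.C α * RatFunc.X)⁻¹ := by
    have hd : (1 + RatFunc.C α * RatFunc.X : RatFunc ℂ) ≠ 0 := by
      have : HasVal (1 + RatFunc.C α * RatFunc.X) 0 1 := by
        simpa using (hasVal_one 0).add ((hasVal_C α 0).mul (hasVal_X 0))
      exact this.ne_zero one_ne_zero
    rw [map_inv₀, map_sub, moebHom_matT_X, moebHom_C, inv_eq_iff_eq_inv, mul_inv_rev, inv_inv]
    field_simp
    ring
  have h2 : HasVal (moebHom matT (RatFunc.X - RatFunc.C α)⁻¹) 0 0 := by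
    have h3 : HasVal (1 + RatFunc.C α * RatFunc.X) 0 1 := by
      simpa using (hasVal_one 0).add ((hasVal_C α 0).mul (hasVal_X 0))
    rw [h1]
    simpa using (hasVal_X 0).neg.mul (h3.inv one_ne_zero)
  rw [moebHom_aeval]
  have h3 := h2.aeval P
  rwa [← Polynomial.coeff_zero_eq_eval_zero, hP] at h3

theorem qPart_spec (p k : ℕ) (x : ℝ) :
    IsPrincipalPart (x : ℂ) (phi k x (heckeConj p x)) (qPart p k x) :=
  principalPart_spec _ _

theorem IsPrincipalPart.regularAt_sub (h : IsPrincipalPart α f r) : RegularAt (f - r) α :=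
  not_isPole_iff.1 h.2

end Principal

variable {p k : ℕ} {q : RatFunc ℂ} {ν : ℝ → ℕ} {σ : ℝ → ℝ}

theorem PoleDynamics.heckeConj_neg_inv (hp : 3 ≤ p) (H : PoleDynamics p k q ν σ) {x : ℝ}
    (hx : x ∈ posPoles q) : heckeConj p (-1 / x) = -1 / heckeConj p x := by
  obtain ⟨Q, hQ, hx'⟩ := H.exists_isFormPair hp hx
  exact (H.sends_conj hp hx matT_mem (sends_matT hx.1.ne')).unique (sends_matT hx'.ne)

/-- By `q ∣ T = -q`, the singular part of `q` at `-1 / x` is opposite to that at `x`. -/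
theorem PoleDynamics.regularAt_neg_inv (hp : 3 ≤ p) (H : PoleDynamics p k q ν σ) {x : ℝ} {c : ℂ}
    (hx : x ∈ posPoles q) (h : RegularAt (q - RatFunc.C c * phi k x (heckeConj p x)) x) :
    RegularAt (q + RatFunc.C c * phi k (-1 / x : ℝ) (heckeConj p (-1 / x))) (-1 / x : ℝ) := by
  have hx' := (H.exists_isFormPair hp hx).choose_spec.2
  have h1 : Sends matT (-1 / x) x := by
    rw [sends_matT_iff]; have := hx.1.ne'; field_simp
  have h2 : Sends matT (-1 / heckeConj p x) (heckeConj p x) := by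
    rw [sends_matT_iff]; have := hx'.ne; field_simp
  have hT : slash k q matT = -q := eq_neg_of_add_eq_zero_right H.rpf.relT
  have h3 := (h.slash (k := k) h1.toC).neg
  rw [slash_sub, slash_C_mul, phi_slash_real h1 h2, hT] at h3
  rw [H.heckeConj_neg_inv hp hx]
  convert h3 using 1
  ring

/-- The function `q` is the sum of its principal parts at the positive poles `x`, of those at the
negative poles `-1 / x`, and of a Laurent polynomial. -/
theorem PoleDynamics.exists_laurent (hp : 3 ≤ p) (hk : 1 ≤ k) (H : PoleDynamics p k q ν σ)
    (s : Finset ℝ) (hs : ∀ x, x ∈ s ↔ x ∈ posPoles q) (c : ℝ → ℂ)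
    (hc : ∀ x ∈ s, RegularAt (q - RatFunc.C (c x) * phi k x (heckeConj p x)) x) :
    ∃ (a : ℂ) (d : ℕ → ℂ),
      q = ∑ x ∈ s, RatFunc.C (c x) * (qPart p k x - qPart p k (-1 / x))
        + RatFunc.C a * (1 - (RatFunc.X ^ (2 * k))⁻¹)
        + ∑ n ∈ Finset.Icc 1 (2 * k - 1), RatFunc.C (d n) / RatFunc.X ^ n := by
  have hpos : ∀ x ∈ s, 0 < x := fun x hx => ((hs x).1 hx).1
  have hneg : ∀ x ∈ s, -1 / x < 0 := fun x hx => div_neg_of_neg_of_pos (by norm_num) (hpos x hx)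
  have hterm : ∀ x ∈ s, ∀ z : ℂ, z ≠ x → z ≠ (-1 / x : ℝ) →
      RegularAt (RatFunc.C (c x) * (qPart p k x - qPart p k (-1 / x))) z := fun x _ z h1 h2 =>
    (regularAt_C _ _).mul (((qPart_spec p k x).regularAt_of_ne h1).sub
      ((qPart_spec p k (-1 / x)).regularAt_of_ne h2))
  have hinv : ∀ x y : ℝ, -1 / x = -1 / y → x = y := by
    intro x y h
    simpa [neg_div] using h
  refine eq_add_laurent hk H.rpf.relT (H.regularAt_X_pow_mul hp hk) ?_ ?_ ?_
  · refine regularAt_sum _ _ _ fun x hx => hterm x hx 0 ?_ ?_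
    · exact_mod_cast (hpos x hx).ne
    · exact_mod_cast (hneg x hx).ne'
  · rw [map_sum]
    have := hasVal_sum s (fun x => moebHom matT
      (RatFunc.C (c x) * (qPart p k x - qPart p k (-1 / x)))) (fun _ => 0) 0 ?_
    · simpa using this
    · intro x hx
      rw [map_mul, map_sub, moebHom_C]
      have h1 := (qPart_spec p k x).hasVal_matT
      have h2 := (qPart_spec p k (-1 / x)).hasVal_matT
      simpa using (hasVal_C (c x) 0).mul (h1.sub h2)
  · intro z hz
    by_cases hpole : IsPole q z
    · -- all poles are real
      obtain ⟨x, rfl⟩ : ∃ x : ℝ, z = x :=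
        ⟨z.re, Complex.ext rfl (by simpa using H.rpf.im_eq_zero hp hpole)⟩
      have hx0 : x ≠ 0 := by exact_mod_cast hz
      rcases lt_or_gt_of_ne hx0 with hx | hx
      · have hy0 : 0 < -1 / x := div_pos_of_neg_of_neg (by norm_num) hx
        have hy : -1 / x ∈ posPoles q := ⟨hy0, H.rpf.isPole_matT (sends_matT hx0).toC hpole⟩
        obtain ⟨y, hy', rfl⟩ : ∃ y ∈ s, x = -1 / y := ⟨-1 / x, (hs _).2 hy, by field_simp⟩
        rw [← Finset.add_sum_erase _ _ hy']
        have h1 := H.regularAt_neg_inv hp ((hs y).1 hy') (hc y hy')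
        have h2 := (qPart_spec p k (-1 / y)).regularAt_sub
        have h3 := (qPart_spec p k y).regularAt_of_ne (z := ((-1 / y : ℝ) : ℂ))
          (by exact_mod_cast (hx.trans (hpos y hy')).ne)
        have h4 : RegularAt (∑ x ∈ s.erase y,
            RatFunc.C (c x) * (qPart p k x - qPart p k (-1 / x))) ((-1 / y : ℝ) : ℂ) := by
          refine regularAt_sum _ _ _ fun x hx' => ?_
          rw [Finset.mem_erase] at hx'
          refine hterm x hx'.2 _ ?_ ?_
          · exact_mod_cast (hx.trans (hpos x hx'.2)).ne
          · exact_mod_cast fun h => hx'.1 (hinv _ _ h).symm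
        convert (h1.sub ((regularAt_C (c y) _).mul (h2.add h3))).sub h4 using 1
        ring
      · have hx' : x ∈ s := (hs x).2 ⟨hx, hpole⟩
        rw [← Finset.add_sum_erase _ _ hx']
        have h1 := hc x hx'
        have h2 := (qPart_spec p k x).regularAt_sub
        have h3 := (qPart_spec p k (-1 / x)).regularAt_of_ne (z := (x : ℂ))
          (by exact_mod_cast ((hneg x hx').trans hx).ne')
        have h4 : RegularAt (∑ x ∈ s.erase x,
            RatFunc.C (c x) * (qPart p k x - qPart p k (-1 / x))) (x : ℂ) := by
          refine regularAt_sum _ _ _ fun y hy => ?_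
          rw [Finset.mem_erase] at hy
          refine hterm y hy.2 _ ?_ ?_
          · exact_mod_cast hy.1.symm
          · exact_mod_cast ((hneg y hy.2).trans hx).ne'
        convert (h1.add ((regularAt_C (c x) _).mul (h2.add h3))).sub h4 using 1
        ring
    · refine (not_isPole_iff.1 hpole).sub (regularAt_sum _ _ _ fun x hx => hterm x hx z ?_ ?_)
      · rintro rfl
        exact hpole ((hs x).1 hx).2
      · rintro rfl
        exact hpole (H.rpf.isPole_matT (sends_matT (hpos x hx).ne').toC ((hs x).1 hx).2)

instance (p : ℕ) : Nonempty (BQF p) :=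
  ⟨{ A := 1, B := 0, C := -1
     disc_pos := by push_cast; norm_num
     primitive := fun _ => by simp }⟩

/-- The sum over the conjugates of `Z_{-𝒜}`, rewritten as a sum over `Z_𝒜`. -/
theorem finsum_negClass (hp : 3 ≤ p) {x x' : ℝ} {Q : BQF p} (hx : ∃ l, FixedBy p l x)
    (h : IsFormPair Q x x') (g : ℝ → RatFunc ℂ) :
    simpleNumbers (negClass Q.eqvClass)
        = (fun z => -1 / heckeConj p z) '' simpleNumbers Q.eqvClass ∧
    ∑ᶠ y ∈ simpleNumbers (negClass Q.eqvClass), g (heckeConj p y)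
      = ∑ᶠ z ∈ simpleNumbers Q.eqvClass, g (-1 / z) := by
  obtain ⟨h1, h2⟩ := mem_simpleNumbers_negClass hp hx h
  have himg : simpleNumbers (negClass Q.eqvClass)
      = (fun z => -1 / heckeConj p z) '' simpleNumbers Q.eqvClass := by
    ext y
    constructor
    · intro hy
      obtain ⟨z, hz, rfl⟩ := h1 y hy
      exact ⟨z, hz, rfl⟩
    · rintro ⟨z, hz, rfl⟩
      exact (h2 z hz).1
  refine ⟨himg, ?_⟩
  rw [himg, finsum_mem_image]
  · exact finsum_mem_congr rfl fun z hz => by rw [(h2 z hz).2]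
  · intro z hz w hw hzw
    have h3 : -1 / z = -1 / w := by
      rw [← (h2 z hz).2, ← (h2 w hw).2]
      exact congrArg _ hzw
    simpa [neg_div] using h3

end HeckeRPF

end

theorem mainTheorem2 (p : ℕ) (hp : 3 ≤ p) (k : ℕ) (hk : 1 ≤ k) (q : RatFunc ℂ)
    (hq : HeckeRPF.IsRPF p k q) :
    ∃ (L : ℕ) (𝒜 : Fin L → Set (HeckeRPF.BQF p)) (C : Fin L → ℂ) (a₀ b₁ c₀ : ℂ) (c : ℕ → ℂ),
      Function.Injective 𝒜 ∧
      (∀ l, HeckeRPF.IsHyperbolicClass (𝒜 l)) ∧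
      (∀ l, (HeckeRPF.simpleNumbers (𝒜 l)).Finite ∧
        (HeckeRPF.simpleNumbers (HeckeRPF.negClass (𝒜 l))).Finite) ∧
      {x : ℝ | 0 < x ∧ HeckeRPF.IsPole q (x : ℂ)} = ⋃ l, HeckeRPF.simpleNumbers (𝒜 l) ∧
      q = ∑ l, RatFunc.C (C l) *
            ((∑ᶠ α ∈ HeckeRPF.simpleNumbers (𝒜 l), HeckeRPF.qPart p k α) -
              ∑ᶠ α ∈ HeckeRPF.simpleNumbers (HeckeRPF.negClass (𝒜 l)),
                HeckeRPF.qPart p k (HeckeRPF.heckeConj p α))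
          + RatFunc.C c₀ * HeckeRPF.qZero k a₀ b₁
          + ∑ n ∈ Finset.Icc 1 (2 * k - 1), RatFunc.C (c n) / RatFunc.X ^ n := by
  classical
  obtain ⟨ν, σ, H⟩ := hq.exists_poleDynamics hp
  choose! Q hQ using fun x (hx : x ∈ HeckeRPF.posPoles q) =>
    (H.exists_isFormPair hp hx).imp fun _ h => h.1
  set s := (HeckeRPF.finite_posPoles q).toFinset with hs_def
  have hs : ∀ x, x ∈ s ↔ x ∈ HeckeRPF.posPoles q := fun x => Set.Finite.mem_toFinset _
  -- the classes of the forms of the positive poles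
  set F := s.image fun x => (Q x).eqvClass with hF
  set 𝒜 : Fin F.card → Set (HeckeRPF.BQF p) := fun l => (F.equivFin.symm l).1 with h𝒜
  have hinj : Function.Injective 𝒜 :=
    Subtype.val_injective.comp F.equivFin.symm.injective
  have hrep : ∀ l, ∃ x ∈ HeckeRPF.posPoles q, (Q x).eqvClass = 𝒜 l := by
    intro l
    obtain ⟨x, hx, h⟩ := Finset.mem_image.1 (F.equivFin.symm l).2
    exact ⟨x, (hs x).1 hx, h⟩
  have hcls : ∀ x ∈ HeckeRPF.posPoles q, ∃ l, (Q x).eqvClass = 𝒜 l := by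
    intro x hx
    refine ⟨F.equivFin ⟨_, Finset.mem_image_of_mem _ ((hs x).2 hx)⟩, ?_⟩
    simp [h𝒜]
  choose r hr hrA using hrep
  have hmem : ∀ l y, y ∈ HeckeRPF.simpleNumbers (𝒜 l) ↔ ∃ m, y = σ^[m] (r l) := by
    intro l y
    rw [← hrA l]
    exact H.mem_simpleNumbers hp (hr l) (hQ _ (hr l))
  have hsub : ∀ l, HeckeRPF.simpleNumbers (𝒜 l) ⊆ HeckeRPF.posPoles q := by
    intro l y hy
    obtain ⟨m, rfl⟩ := (hmem l y).1 hy
    exact (H.iterate_spec hp m (hr l)).1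
  have hmem' : ∀ l, ∀ x ∈ HeckeRPF.posPoles q,
      x ∈ HeckeRPF.simpleNumbers (𝒜 l) ↔ (Q x).eqvClass = 𝒜 l := by
    intro l x hx
    constructor
    · rintro ⟨Q', hQ', hA, -⟩
      obtain ⟨x', hx'⟩ := hQ'.exists_isFormPair hp
      obtain rfl := (hx'.unique (hQ x hx)).1
      rw [← hrA l] at hA ⊢
      exact HeckeRPF.BQF.eqvClass_eq hA
    · intro h
      rw [← h]
      exact (H.mem_simpleNumbers hp hx (hQ x hx)).2 ⟨0, rfl⟩
  have hfin : ∀ l, (HeckeRPF.simpleNumbers (𝒜 l)).Finite := fun l =>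
    (HeckeRPF.finite_posPoles q).subset (hsub l)
  have hneg := fun l => HeckeRPF.finsum_negClass hp (H.fixedBy hp (hr l)) (hQ _ (hr l))
    (HeckeRPF.qPart p k)
  simp only [hrA] at hneg
  choose C hC using fun l => H.exists_coefficient hp (hr l)
  -- the coefficient attached to a pole is the coefficient of its class
  set c' : ℝ → ℂ := fun x => ∑ l, if x ∈ HeckeRPF.simpleNumbers (𝒜 l) then C l else 0 with hc'
  have hc'_eq : ∀ l, ∀ x ∈ HeckeRPF.simpleNumbers (𝒜 l), c' x = C l := by
    intro l x hx
    rw [hc']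
    simp only
    rw [Finset.sum_eq_single l, if_pos hx]
    · intro l' _ hne
      rw [if_neg]
      intro hx'
      have hxP := hsub l hx
      exact hne (hinj (((hmem' l' x hxP).1 hx').symm.trans ((hmem' l x hxP).1 hx)))
    · intro h; exact absurd (Finset.mem_univ l) h
  obtain ⟨a, d, hqd⟩ := H.exists_laurent hp hk s hs c' (by
    intro x hx
    have hxP := (hs x).1 hx
    obtain ⟨l, hl⟩ := hcls x hxP
    have hxl := (hmem' l x hxP).2 hl
    rw [hc'_eq l x hxl]
    obtain ⟨m, rfl⟩ := (hmem l x).1 hxl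
    exact H.regularAt_iterate hp m (hr l) (hC l))
  -- `b₁ = 0`: for `2k = 2` the term `b₁ / z` is already among the powers of `1 / z`
  refine ⟨F.card, 𝒜, C, a, 0, 1, d, hinj, fun l => ?_, fun l => ⟨hfin l, ?_⟩, ?_, ?_⟩
  · exact ⟨Q (r l), ⟨_, (hQ _ (hr l)).isFormOf⟩, (hrA l).symm⟩
  · rw [(hneg l).1]
    exact (hfin l).image _
  · ext x
    rw [Set.mem_iUnion]
    constructor
    · intro hx
      obtain ⟨l, hl⟩ := hcls x hx
      exact ⟨l, (hmem' l x hx).2 hl⟩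
    · rintro ⟨l, hl⟩
      exact hsub l hl
  · have hzero : RatFunc.C (1 : ℂ) * HeckeRPF.qZero k a 0
        = RatFunc.C a * (1 - (RatFunc.X ^ (2 * k))⁻¹) := by
      rw [map_one, one_mul, HeckeRPF.qZero]
      split_ifs with h
      · rfl
      · rw [not_not.1 h, map_zero, zero_mul, add_zero]
    have hsum : ∑ l, RatFunc.C (C l) *
            ((∑ᶠ α ∈ HeckeRPF.simpleNumbers (𝒜 l), HeckeRPF.qPart p k α) -
              ∑ᶠ α ∈ HeckeRPF.simpleNumbers (HeckeRPF.negClass (𝒜 l)),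
                HeckeRPF.qPart p k (HeckeRPF.heckeConj p α))
        = ∑ x ∈ s, RatFunc.C (c' x) * (HeckeRPF.qPart p k x - HeckeRPF.qPart p k (-1 / x)) := by
      have hl : ∀ l, RatFunc.C (C l) *
            ((∑ᶠ α ∈ HeckeRPF.simpleNumbers (𝒜 l), HeckeRPF.qPart p k α) -
              ∑ᶠ α ∈ HeckeRPF.simpleNumbers (HeckeRPF.negClass (𝒜 l)),
                HeckeRPF.qPart p k (HeckeRPF.heckeConj p α))
          = ∑ x ∈ s, RatFunc.C (if x ∈ HeckeRPF.simpleNumbers (𝒜 l) then C l else 0)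
              * (HeckeRPF.qPart p k x - HeckeRPF.qPart p k (-1 / x)) := by
        intro l
        have hset : (hfin l).toFinset = s.filter (· ∈ HeckeRPF.simpleNumbers (𝒜 l)) := by
          ext x
          rw [Set.Finite.mem_toFinset, Finset.mem_filter, hs]
          exact ⟨fun h => ⟨hsub l h, h⟩, fun h => h.2⟩
        rw [(hneg l).2, finsum_mem_eq_finite_toFinset_sum _ (hfin l),
          finsum_mem_eq_finite_toFinset_sum _ (hfin l), ← Finset.sum_sub_distrib, hset,
          Finset.mul_sum, Finset.sum_filter]
        refine Finset.sum_congr rfl fun x _ => ?_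
        split_ifs
        · rfl
        · rw [map_zero, zero_mul]
      rw [Finset.sum_congr rfl fun l _ => hl l, Finset.sum_comm]
      refine Finset.sum_congr rfl fun x _ => ?_
      rw [← Finset.sum_mul, hc', map_sum]
    rw [hsum, hzero]
    exact hqd
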